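/- **Volume-Preserving Decoupling Transformation.** Let $n\ge 1$, let $M\subset\mathbb{R}^j$ be open, and let $\omega_0\in\mathbb{R}^l$ be Diophantine: for some $c,\mu>0$, $|m\cdot\omega_0-q|\ge c|m|^{-\mu}$ for all $m\in\mathbb{Z}^l\setminus\{0\}$, $q\in\mathbb{Z}$, where $|m|$ is the maximum norm. For $|\kappa|<\kappa_1$ let $f=f_\kappa$ be the map on $\mathbb{T}^l\times M$ (with $\mathbb{T}^l=\mathbb{R}^l/\mathbb{Z}^l$, and values in $\mathbb{T}^l\times\mathbb{R}^j$) $$\theta'=\theta+\omega_0+\sum_{i=1}^{n-1}\kappa^i\bar F^{(i)}(J)+\kappa^nF^{(n)}(\theta,J;\kappa),\qquad J'=J+\sum_{i=1}^{n-1}\kappa^i\bar G^{(i)}(J)+\kappa^nG^{(n)}(\theta,J;\kappa),$$ where $\bar F^{(i)},\bar G^{(i)}$ are real analytic on $M$, and $F^{(n)},G^{(n)}$ are real analytic in $(\theta,J,\kappa)\in\mathbb{T}^l\times M\times(-\kappa_1,\kappa_1)$. Write $\bar F^{(n)}(J)=\int_{\mathbb{T}^l}F^{(n)}(\theta,J;0)\,d\theta$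 and $\bar G^{(n)}(J)=\int_{\mathbb{T}^l}G^{(n)}(\theta,J;0)\,d\theta$. Suppose that $f_\kappa$ is volume-preserving, $\det Df_\kappa\equiv1$ on $\mathbb{T}^l\times M$, for all $|\kappa|<\kappa_1$. Then: 1. The vector field $\bigl(F^{(n)}(\psi,I;0)-\bar F^{(n)}(I),\;G^{(n)}(\psi,I;0)-\bar G^{(n)}(I)\bigr)$ is real analytic and divergence-free on $\mathbb{T}^l\times M$. 2. There is a real analytic divergence-free vector field $V=(T^{(n)},S^{(n)})$ on $\mathbb{T}^l\times M$ that solves the homological equation $$V(\psi+\omega_0,I)-V(\psi,I)=\bigl(F^{(n)}(\psi,I;0)-\bar F^{(n)}(I),\;G^{(n)}(\psi,I;0)-\bar G^{(n)}(I)\bigr)$$ and whose exponential is a volume-preserving decoupling transformation in the following sense. For every compact $K\subset M$ there are $0<\kappa_0\le\kappa_1$, open sets $K\subset U\subset W\subset M$, and maps $\Phi_\kappa$ on $\mathbb{T}^l\times W$ for $|\kappa|<\kappa_0$, such that: * for each $|\kappa|<\kappa_0$, $\Phi_\kappa=e^{\kappa^nV}$ on $\mathbb{T}^l\times W$, that is,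 $\Phi_\kappa$ is the time-one map of the flow of $\kappa^nV$ in $\mathbb{T}^l\times M$; * $\Phi_\kappa(\psi,I)$ is real analytic in $(\psi,I,\kappa)$, and $\Phi_\kappa(\psi,I)=(\psi+\kappa^nT^{(n)}(\psi,I),\,I+\kappa^nS^{(n)}(\psi,I))+O(\kappa^{2n})$ uniformly on $\mathbb{T}^l\times W$; * for each $|\kappa|<\kappa_0$, $\Phi_\kappa$ is a real analytic diffeomorphism of $\mathbb{T}^l\times W$ onto an open set, and it is volume-preserving, $\det D\Phi_\kappa\equiv1$; * the substitution $(\theta,J)=\Phi_\kappa(\psi,I)$ conjugates $f_\kappa$ to the map $$\psi'=\psi+\omega_0+\sum_{i=1}^{n}\kappa^i\bar F^{(i)}(I)+\kappa^{n+1}F^{(n+1)}(\psi,I;\kappa),\qquad I'=I+\sum_{i=1}^{n}\kappa^i\bar G^{(i)}(I)+\kappa^{n+1}G^{(n+1)}(\psi,I;\kappa),$$ with $F^{(n+1)},G^{(n+1)}$ real analytic on $\mathbb{T}^l\times U\times(-\kappa_0,\kappa_0)$: for $(\psi,I)\in\mathbb{T}^l\times U$ and $|\kappa|<\kappa_0$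 one has $(\psi',I')\in\mathbb{T}^l\times W$ and $f_\kappa(\Phi_\kappa(\psi,I))=\Phi_\kappa(\psi',I')$. -/

import Mathlib

open Set MeasureTheory

namespace Decoupling

/-- The universal cover `ℝ^l × ℝ^j` of `𝕋^l × ℝ^j`, with points `(θ, J)`.  Maps and vector fields on
`𝕋^l × M` are represented by their lifts to `ℝ^l × M`. -/
abbrev Phase (l j : ℕ) := (Fin l → ℝ) × (Fin j → ℝ)

/-- The lift `ℝ^l × M` of `𝕋^l × M`. -/
def strip (l : ℕ) {j : ℕ} (M : Set (Fin j → ℝ)) : Set (Phase l j) := univ ×ˢ M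

/-- An integer vector, as a deck transformation of `ℝ^l → 𝕋^l = ℝ^l / ℤ^l`. -/
def intVec {l : ℕ} (k : Fin l → ℤ) : Fin l → ℝ := fun i => (k i : ℝ)

/-- `X` is `ℤ^l`-periodic in the angles on `ℝ^l × M`, i.e. it descends to `𝕋^l × M`. -/
def AnglePeriodicOn {l j : ℕ} {E : Type*} (X : Phase l j → E) (M : Set (Fin j → ℝ)) : Prop :=
  ∀ (k : Fin l → ℤ) (θ : Fin l → ℝ), ∀ J ∈ M, X (θ + intVec k, J) = X (θ, J)

/-- `Φ` commutes with the integer translations of the angles on `ℝ^l × M`, i.e. it is the lift of a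
map on `𝕋^l × M` that is homotopic to the identity in the angles. -/
def AngleEquivariantOn {l j : ℕ} (Φ : Phase l j → Phase l j) (M : Set (Fin j → ℝ)) : Prop :=
  ∀ (k : Fin l → ℤ) (θ : Fin l → ℝ), ∀ J ∈ M, Φ (θ + intVec k, J) = Φ (θ, J) + (intVec k, 0)

/-- The Diophantine frequency vectors `𝒟(c, μ)`; `‖m‖` is the maximum norm. -/
def IsDiophantine {l : ℕ} (c μ : ℝ) (ω : Fin l → ℝ) : Prop :=
  ∀ (m : Fin l → ℤ) (q : ℤ), m ≠ 0 → c * ‖m‖ ^ (-μ) ≤ |(∑ i, (m i : ℝ) * ω i) - (q : ℝ)|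

/-- The average over the angles at `κ = 0`: `J ↦ ∫_{𝕋^l} G(θ, J; 0) dθ`. -/
noncomputable def angleAverage {l j : ℕ} {E : Type*} [NormedAddCommGroup E] [NormedSpace ℝ E]
    (G : Phase l j × ℝ → E) (J : Fin j → ℝ) : E :=
  ∫ θ in Icc (0 : Fin l → ℝ) 1, G ((θ, J), 0)

/-- The divergence of a vector field, `∇ · V = tr DV`. -/
noncomputable def divergence {l j : ℕ} (V : Phase l j → Phase l j) (x : Phase l j) : ℝ :=
  LinearMap.trace ℝ (Phase l j) (fderiv ℝ V x : Phase l j →ₗ[ℝ] Phase l j)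

/-- The Jacobian determinant of `Φ` is identically one on `D`. -/
def VolumePreservingOn {l j : ℕ} (Φ : Phase l j → Phase l j) (D : Set (Phase l j)) : Prop :=
  ∀ x ∈ D, DifferentiableAt ℝ Φ x ∧ (fderiv ℝ Φ x).det = 1

/-- `Φ` is a real analytic diffeomorphism from `D` onto the open set `Φ(D)`. -/
def AnalyticDiffeoOn {l j : ℕ} (Φ : Phase l j → Phase l j) (D : Set (Phase l j)) : Prop :=
  AnalyticOnNhd ℝ Φ D ∧ IsOpen (Φ '' D) ∧
    ∃ h : Phase l j → Phase l j, AnalyticOnNhd ℝ h (Φ '' D) ∧ ∀ x ∈ D, h (Φ x) = x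

/-- On `D`, `Φ` is the exponential (time-one map of the flow) of the vector field `V` on `N`: each
`x ∈ D` is joined to `Φ x` by an integral curve of `V` over `[0, 1]` that stays in `N`. -/
def IsExpOn {l j : ℕ} (V : Phase l j → Phase l j) (N : Set (Phase l j))
    (Φ : Phase l j → Phase l j) (D : Set (Phase l j)) : Prop :=
  ∀ x ∈ D, ∃ γ : ℝ → Phase l j, γ 0 = x ∧ γ 1 = Φ x ∧
    ∀ t ∈ Icc (0 : ℝ) 1, γ t ∈ N ∧ HasDerivWithinAt γ (V (γ t)) (Icc 0 1) t

/-- The slow-fast map whose terms of order below `n` are independent of the angles: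
`θ' = θ + ω + ∑_{1 ≤ i < n} κ^i A_i(J) + κ^n F(θ, J; κ)`,
`J' = J + ∑_{1 ≤ i < n} κ^i B_i(J) + κ^n G(θ, J; κ)`. -/
noncomputable def slowFastMap {l j : ℕ} (n : ℕ) (ω : Fin l → ℝ)
    (A : ℕ → (Fin j → ℝ) → (Fin l → ℝ)) (B : ℕ → (Fin j → ℝ) → (Fin j → ℝ))
    (F : Phase l j × ℝ → (Fin l → ℝ)) (G : Phase l j × ℝ → (Fin j → ℝ))
    (κ : ℝ) (x : Phase l j) : Phase l j :=
  (x.1 + ω + ∑ i ∈ Finset.Ico 1 n, κ ^ i • A i x.2 + κ ^ n • F (x, κ),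
   x.2 + ∑ i ∈ Finset.Ico 1 n, κ ^ i • B i x.2 + κ ^ n • G (x, κ))

/-- The right-hand side of the homological equation, the oscillating part at `κ = 0`:
`(F(ψ, I; 0) - F̄(I), G(ψ, I; 0) - Ḡ(I))`. -/
noncomputable def oscillatingPart {l j : ℕ}
    (F : Phase l j × ℝ → (Fin l → ℝ)) (G : Phase l j × ℝ → (Fin j → ℝ))
    (x : Phase l j) : Phase l j :=
  (F (x, 0) - angleAverage F x.2, G (x, 0) - angleAverage G x.2)

end Decoupling

/-! Write X = (F, G). Two points with the same slow variable J see the same terms of order below n.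
Comparing det Df = 1 at them to order κ^n, where the derivative of det at the identity is the trace,
shows that the divergence of X at κ = 0 is independent of θ (`divergence_eq_of_volumePreserving`).
Averaging over the angles commutes with the divergence, so the oscillating part u = X - (average of
X) is divergence-free (`divergence_oscillatingPart`).

The homological equation is solved without complex strips or exponential decay of Fourier
coefficients. Put P = ∑ ∂_{θ_i}^{2p}, and let V be the average of the angle translates of P u
against the kernel with coefficients 1 / (P̂(m) (e^{2πi m·ω₀} - 1)), m ≠ 0. For large p the
Diophantine bound makes these absolutely summable, so the kernel is continuous. Angle derivatives
and averages of translates preserve both analyticity and zero divergence, so V inherits these from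
u. Comparing Fourier coefficients gives the equation, because u has mean zero
(`homological_equation`, `exists_homological_solution`).

Φ_κ is the flow φ of V at time κ^n. Its Jacobian is 1 by Liouville's formula
(`IsFlowOn.det_fderiv`), and periodicity reduces uniform existence times on the noncompact lift to a
compact fundamental domain. In φ_{-κ^n} ∘ f_κ ∘ φ_{κ^n} the new contribution at order κ^n is V(x) +
X(x, 0) - V(x + ω₀), which the homological equation turns into the average
(`IsFlowOn.isBigO_conjugation`). The remainder is O(κ^{n+1}) at each point and analytic, hence
κ^{n+1} times an analytic map (`exists_eq_pow_smul_of_isBigO`).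

One tool supplies the analyticity: u ↦ f ∘ u is an analytic operator on continuous functions on a
compact space, near constants. It yields analytic parametric integrals and, through the implicit
function theorem for the Picard equation, analytic flows. -/

namespace Decoupling

open Filter Topology
open scoped ENNReal NNReal

/-! ### Analyticity of the superposition operator on continuous functions. -/

section Superposition

variable {S E F : Type*} [TopologicalSpace S] [CompactSpace S]
  [NormedAddCommGroup E] [NormedSpace ℝ E] [NormedAddCommGroup F] [NormedSpace ℝ F]

/-- A continuous multilinear map acts pointwise on tuples of continuous functions. -/
noncomputable def pointwiseMultilinear (S : Type*) [TopologicalSpace S] [CompactSpace S] {k : ℕ}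
    (q : E [×k]→L[ℝ] F) : C(S, E) [×k]→L[ℝ] C(S, F) :=
  MultilinearMap.mkContinuous
    { toFun := fun v => ⟨fun s => q fun i => v i s, by fun_prop⟩
      map_update_add' := by
        intro _ v i a b
        ext s
        have (w : C(S, E)) : (fun i' => (Function.update v i w) i' s) =
            Function.update (fun i' => v i' s) i (w s) := by
          ext i'
          by_cases h : i' = i
          · subst h; simp
          · simp [h]
        simp [this]
      map_update_smul' := by
        intro _ v i a b
        ext s
        have (w : C(S, E)) : (fun i' => (Function.update v i w) i' s) =
            Function.update (fun i' => v i' s) i (w s) := by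
          ext i'
          by_cases h : i' = i
          · subst h; simp
          · simp [h]
        simp [this] }
    ‖q‖ (fun v => by
      refine (ContinuousMap.norm_le _ (by positivity)).2 fun s => ?_
      refine (q.le_opNorm _).trans ?_
      gcongr with i
      exact (v i).norm_coe_le_norm s)

theorem norm_pointwiseMultilinear_le {k : ℕ} (q : E [×k]→L[ℝ] F) :
    ‖pointwiseMultilinear S q‖ ≤ ‖q‖ :=
  MultilinearMap.mkContinuous_norm_le _ (norm_nonneg _) _

open scoped Classical in
/-- The superposition operator `u ↦ f ∘ u` on continuous functions. -/
noncomputable def superposition (S : Type*) [TopologicalSpace S] (f : E → F) (u : C(S, E)) :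
    C(S, F) :=
  if h : Continuous (fun s => f (u s)) then ⟨fun s => f (u s), h⟩ else 0

omit [CompactSpace S] [NormedSpace ℝ E] [NormedSpace ℝ F] in
theorem superposition_apply {f : E → F} {u : C(S, E)} (h : Continuous fun s => f (u s)) (s : S) :
    superposition S f u s = f (u s) := by
  simp [superposition, h]

/-- The coefficients of f act pointwise on C(S, E) with no larger norm, so the series keeps its
radius. Evaluation at each s identifies the sum with f ∘ u. -/
theorem hasFPowerSeriesOnBall_superposition [CompleteSpace F] {f : E → F}
    {p : FormalMultilinearSeries ℝ E F} {x : E} {r : ℝ≥0∞} (hf : HasFPowerSeriesOnBall f p x r) :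
    HasFPowerSeriesOnBall (superposition S f) (fun k => pointwiseMultilinear S (p k))
      (ContinuousMap.const S x) r where
  r_le := by
    refine hf.r_le.trans (FormalMultilinearSeries.radius_le_of_le fun k => ?_)
    exact norm_pointwiseMultilinear_le _
  r_pos := hf.r_pos
  hasSum := by
    intro y hy
    have hr : r ≤ FormalMultilinearSeries.radius
        (fun k => pointwiseMultilinear S (p k) : FormalMultilinearSeries ℝ C(S, E) C(S, F)) :=
      hf.r_le.trans (FormalMultilinearSeries.radius_le_of_le fun k =>
        norm_pointwiseMultilinear_le _)
    have hs := FormalMultilinearSeries.hasSum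
      (fun k => pointwiseMultilinear S (p k) : FormalMultilinearSeries ℝ C(S, E) C(S, F))
      (Metric.eball_subset_eball hr hy)
    convert hs using 1
    have key (s : S) : FormalMultilinearSeries.sum
        (fun k => pointwiseMultilinear S (p k) : FormalMultilinearSeries ℝ C(S, E) C(S, F)) y s =
        f (x + y s) := by
      have h1 := (ContinuousMap.evalCLM ℝ s).hasSum hs
      have hy' : y s ∈ Metric.eball (0 : E) r := by
        rw [Metric.mem_eball, edist_zero_right] at hy ⊢
        refine lt_of_le_of_lt ?_ hy
        rw [enorm_le_iff_norm_le]
        exact y.norm_coe_le_norm s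
      exact h1.unique (hf.hasSum hy')
    -- Continuity of f ∘ u comes from the sum of the series in C(S, F), so the default value 0 of
    -- `superposition` does not occur here.
    have hc : Continuous fun s => f ((ContinuousMap.const S x + y) s) := by
      have := (FormalMultilinearSeries.sum
        (fun k => pointwiseMultilinear S (p k) : FormalMultilinearSeries ℝ C(S, E) C(S, F)) y).2
      convert this using 2 with s
      exact (key s).symm
    ext s
    rw [superposition_apply hc, key s]
    rfl

/-- The radius is chosen before S: later S is a piece of a compact set cut out at the scale r. -/
theorem exists_analyticOnNhd_superposition [CompleteSpace F] {f : E → F} {x : E}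
    (hf : AnalyticAt ℝ f x) :
    ∃ r > 0, AnalyticOnNhd ℝ f (Metric.ball x r) ∧
      ∀ (S : Type*) [TopologicalSpace S] [CompactSpace S],
      AnalyticOnNhd ℝ (superposition S f) (Metric.ball (ContinuousMap.const S x) r) := by
  obtain ⟨p, r, hp⟩ := hf
  obtain ⟨r', hr', hr'r⟩ := ENNReal.lt_iff_exists_nnreal_btwn.1 hp.r_pos
  refine ⟨r', by simpa using hr', ?_, fun S _ _ => ?_⟩
  · rw [← Metric.eball_coe]
    exact (hp.mono hr' hr'r.le).analyticOnNhd
  · rw [← Metric.eball_coe]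
    exact ((hasFPowerSeriesOnBall_superposition hp).mono hr' hr'r.le).analyticOnNhd

end Superposition

/-! ### Integrals depending analytically on a parameter. -/

section ParametricIntegral

variable {E P F : Type*} [NormedAddCommGroup E] [NormedSpace ℝ E]
  [NormedAddCommGroup P] [NormedSpace ℝ P] [MeasurableSpace P] [BorelSpace P]
  [SecondCountableTopology P] [NormedAddCommGroup F] [NormedSpace ℝ F]

/-- Integration against an integrable weight, on a compact space. -/
noncomputable def weightedIntegralCLM {T : Type*} [TopologicalSpace T] [CompactSpace T]
    [MeasurableSpace T] [BorelSpace T] [SecondCountableTopology T] (ν : Measure T) (g : T → ℝ)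
    (hg : Integrable g ν) : C(T, F) →L[ℝ] F :=
  have hi (u : C(T, F)) : Integrable (fun t => g t • u t) ν :=
    hg.smul_bdd ‖u‖ u.continuous.aestronglyMeasurable
      (Eventually.of_forall u.norm_coe_le_norm)
  LinearMap.mkContinuous
    { toFun := fun u => ∫ t, g t • u t ∂ν
      map_add' := fun u v => by
        simp only [ContinuousMap.add_apply, smul_add]
        exact integral_add (hi u) (hi v)
      map_smul' := fun a u => by
        simp only [ContinuousMap.smul_apply, RingHom.id_apply, smul_comm _ a]
        exact integral_smul _ _ }
    (∫ t, ‖g t‖ ∂ν) (fun u => by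
      rw [← integral_mul_const]
      refine norm_integral_le_of_norm_le (hg.norm.mul_const _) (Eventually.of_forall fun t => ?_)
      rw [norm_smul]
      gcongr
      exact u.norm_coe_le_norm t)

omit [MeasurableSpace P] [BorelSpace P] [SecondCountableTopology P] in
theorem eventually_forall_analyticAt [CompleteSpace F] {S : Set P} (hS : IsCompact S)
    {f : E × P → F} {x₀ : E} (hf : ∀ p ∈ S, AnalyticAt ℝ f (x₀, p)) :
    ∀ᶠ x in 𝓝 x₀, ∀ p ∈ S, AnalyticAt ℝ f (x, p) :=
  hS.eventually_forall_of_forall_eventually fun p hp => (hf p hp).eventually_analyticAt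

/-- The integral is a composite of analytic maps: the affine map sending x to the function p ↦ (x,
p) on T, superposition with f, and a continuous linear integration functional. Smallness of T keeps
the function p ↦ (x, p) near the constant (x₀, p₀). -/
theorem analyticAt_setIntegral_smul_of_superposition [CompleteSpace F] {ν : Measure P} {T t : Set P}
    [CompactSpace T] (htT : t ⊆ T) (ht : MeasurableSet t) {f : E × P → F} {x₀ : E} {p₀ : P}
    {r : ℝ} (hr : 0 < r) (hTr : T ⊆ Metric.closedBall p₀ (r / 2))
    (hf : AnalyticOnNhd ℝ f (Metric.ball (x₀, p₀) r))
    (hf' : AnalyticOnNhd ℝ (superposition T f) (Metric.ball (ContinuousMap.const T (x₀, p₀)) r))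
    {g : P → ℝ} (hg : IntegrableOn g t ν) :
    AnalyticAt ℝ (fun x => ∫ p in t, g p • f (x, p) ∂ν) x₀ := by
  have hTm := (isCompact_iff_compactSpace.2 ‹CompactSpace T›).measurableSet
  have hg' : Integrable (fun p : T => t.indicator g p) (ν.comap Subtype.val) := by
    rw [← integrable_indicator_iff ht] at hg
    exact (integrableOn_iff_comap_subtypeVal hTm).1 hg.integrableOn
  let u₀ : C(T, E × P) := ⟨fun p => (0, (p : P)), by fun_prop⟩
  let L : E →L[ℝ] C(T, E × P) := (ContinuousLinearMap.const ℝ T).comp (.inl ℝ E P)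
  have hu (x : E) (p : T) : (L x + u₀) p = (x, (p : P)) := by simp [L, u₀]
  have hball (x : E) (hx : x ∈ Metric.ball x₀ r) :
      L x + u₀ ∈ Metric.ball (ContinuousMap.const T (x₀, p₀)) r := by
    rw [Metric.mem_ball]
    refine lt_of_le_of_lt ((ContinuousMap.dist_le (C := max (dist x x₀) (r / 2))
      (by positivity)).2 fun p => ?_) (max_lt hx (by linarith))
    rw [hu, ContinuousMap.const_apply, Prod.dist_eq]
    exact max_le_max le_rfl (hTr p.2)
  have h1 : AnalyticAt ℝ (fun x => weightedIntegralCLM (ν.comap Subtype.val) _ hg'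
      (superposition T f (L x + u₀))) x₀ := by
    have h2 : AnalyticAt ℝ (fun x => L x + u₀) x₀ := (L.analyticAt x₀).add analyticAt_const
    exact (ContinuousLinearMap.analyticAt _ _).comp
      ((hf' _ (hball x₀ (by simpa))).fun_comp_of_eq h2 rfl)
  refine h1.congr ?_
  filter_upwards [Metric.ball_mem_nhds x₀ hr] with x hx
  have hc : Continuous fun p : T => f ((L x + u₀) p) := by
    rw [continuous_iff_continuousAt]
    intro p
    have : ContinuousAt f ((L x + u₀) p) := by
      refine (hf _ ?_).continuousAt
      rw [hu, ← ball_prod_same]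
      exact ⟨hx, Metric.closedBall_subset_ball (by linarith) (hTr p.2)⟩
    exact this.comp (L x + u₀).continuous.continuousAt
  have : ∀ p : T, t.indicator g p • superposition T f (L x + u₀) p =
      (fun p => t.indicator (fun p => g p • f (x, p)) p) p := by
    intro p
    rw [superposition_apply hc, hu]
    by_cases hp : (p : P) ∈ t <;> simp [hp]
  change ∫ p : T, t.indicator g p • superposition T f (L x + u₀) p ∂_ = _
  simp_rw [this]
  rw [integral_subtype_comap hTm, setIntegral_indicator ht, inter_eq_right.2 htT]

omit [NormedSpace ℝ P] in
theorem integrableOn_smul_of_continuousOn {ν : Measure P} {S : Set P} (hS : IsCompact S)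
    {h : P → F} (hh : ContinuousOn h S) {g : P → ℝ} (hg : IntegrableOn g S ν) :
    IntegrableOn (fun p => g p • h p) S ν := by
  obtain ⟨C, hC⟩ := hS.exists_bound_of_continuousOn hh
  exact hg.smul_bdd C (hh.aestronglyMeasurable hS.measurableSet)
    ((ae_restrict_iff' hS.measurableSet).2 (Eventually.of_forall hC))

theorem analyticAt_setIntegral_smul [CompleteSpace F] {ν : Measure P} {S : Set P}
    (hS : IsCompact S) {f : E × P → F} {x₀ : E} (hf : ∀ p ∈ S, AnalyticAt ℝ f (x₀, p))
    {g : P → ℝ} (hg : IntegrableOn g S ν) :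
    AnalyticAt ℝ (fun x => ∫ p in S, g p • f (x, p) ∂ν) x₀ := by
  have hint : ∀ᶠ x in 𝓝 x₀, IntegrableOn (fun p => g p • f (x, p)) S ν := by
    filter_upwards [eventually_forall_analyticAt hS hf] with x hx
    refine integrableOn_smul_of_continuousOn hS (fun p hp => ?_) hg
    exact ((hx p hp).continuousAt.comp (by fun_prop)).continuousWithinAt
  -- The property is made hereditary in measurable subsets so that, in the union step of the
  -- compactness induction, t can be split into the disjoint pieces t ∩ A and t \ A.
  suffices h : ∃ S' : Set P, MeasurableSet S' ∧ S ⊆ S' ∧ ∀ t ⊆ S', t ⊆ S → MeasurableSet t →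
      AnalyticAt ℝ (fun x => ∫ p in t, g p • f (x, p) ∂ν) x₀ by
    obtain ⟨S', -, hSS', h⟩ := h
    exact h S hSS' subset_rfl hS.measurableSet
  refine hS.induction_on (p := fun s => ∃ S' : Set P, MeasurableSet S' ∧ s ⊆ S' ∧
    ∀ t ⊆ S', t ⊆ S → MeasurableSet t →
      AnalyticAt ℝ (fun x => ∫ p in t, g p • f (x, p) ∂ν) x₀) ?_ ?_ ?_ ?_
  · refine ⟨∅, .empty, subset_rfl, fun t ht _ _ => ?_⟩
    rw [subset_empty_iff.1 ht]
    simpa using analyticAt_const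
  · rintro s s' hss' ⟨S', hm, hS', h⟩
    exact ⟨S', hm, hss'.trans hS', h⟩
  · rintro s s' ⟨A, hA, hsA, h⟩ ⟨B, hB, hsB, h'⟩
    refine ⟨A ∪ B, hA.union hB, union_subset_union hsA hsB, fun t ht htS htm => ?_⟩
    refine ((h (t ∩ A) inter_subset_right (inter_subset_left.trans htS) (htm.inter hA)).add
      (h' (t \ A) (fun p hp => (ht hp.1).resolve_left hp.2) (sdiff_subset.trans htS)
        (htm.diff hA))).congr ?_
    filter_upwards [hint] with x hx
    exact integral_inter_add_sdiff hA (hx.mono_set htS)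
  · intro p₀ hp₀
    obtain ⟨r, hr, hfr, hfr'⟩ := exists_analyticOnNhd_superposition (hf p₀ hp₀)
    refine ⟨S ∩ Metric.closedBall p₀ (r / 2), inter_mem self_mem_nhdsWithin
      (mem_nhdsWithin_of_mem_nhds (Metric.closedBall_mem_nhds _ (by positivity))),
      S ∩ Metric.closedBall p₀ (r / 2), hS.measurableSet.inter Metric.isClosed_closedBall.measurableSet,
      subset_rfl, fun t ht htS htm => ?_⟩
    have hT : IsCompact (S ∩ Metric.closedBall p₀ (r / 2)) := hS.inter_right Metric.isClosed_closedBall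
    have := isCompact_iff_compactSpace.1 hT
    exact analyticAt_setIntegral_smul_of_superposition ht htm hr inter_subset_right hfr
      (hfr' ↥(S ∩ Metric.closedBall p₀ (r / 2))) (hg.mono_set htS)

omit [MeasurableSpace P] [BorelSpace P] [SecondCountableTopology P] in
theorem analyticAt_fderiv_comp_inl [CompleteSpace F] {S : Set P} {f : E × P → F} {x₀ : E}
    (hf : ∀ p ∈ S, AnalyticAt ℝ f (x₀, p)) :
    ∀ p ∈ S, AnalyticAt ℝ (fun q => (fderiv ℝ f q).comp (.inl ℝ E P)) (x₀, p) :=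
  fun p hp => ((ContinuousLinearMap.compL ℝ E (E × P) F).flip (.inl ℝ E P)).analyticAt _ |>.comp
    (hf p hp).fderiv

omit [MeasurableSpace P] [BorelSpace P] [SecondCountableTopology P] in
theorem continuousOn_fderiv_comp_inl [CompleteSpace F] {S : Set P} {f : E × P → F} {x₀ : E}
    (hf : ∀ p ∈ S, AnalyticAt ℝ f (x₀, p)) :
    ContinuousOn (fun p => (fderiv ℝ f (x₀, p)).comp (.inl ℝ E P)) S := fun p hp =>
  ((analyticAt_fderiv_comp_inl hf p hp).continuousAt.comp (f := fun p => (x₀, p))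
    (by fun_prop)).continuousWithinAt

theorem hasFDerivAt_setIntegral_smul [CompleteSpace F] {ν : Measure P} {S : Set P}
    (hS : IsCompact S) {f : E × P → F} {x₀ : E} (hf : ∀ p ∈ S, AnalyticAt ℝ f (x₀, p))
    {g : P → ℝ} (hg : IntegrableOn g S ν) :
    HasFDerivAt (fun x => ∫ p in S, g p • f (x, p) ∂ν)
      (∫ p in S, g p • (fderiv ℝ f (x₀, p)).comp (.inl ℝ E P) ∂ν) x₀ := by
  have hint : ∀ᶠ x in 𝓝 x₀, IntegrableOn (fun p => g p • f (x, p)) S ν := by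
    filter_upwards [eventually_forall_analyticAt hS hf] with x hx
    refine integrableOn_smul_of_continuousOn hS (fun p hp => ?_) hg
    exact ((hx p hp).continuousAt.comp (by fun_prop)).continuousWithinAt
  have hf' := analyticAt_fderiv_comp_inl hf
  have hc := continuousOn_fderiv_comp_inl hf
  obtain ⟨C, hC⟩ := hS.exists_bound_of_continuousOn hc
  -- The bound C at x₀ persists as C + 1 on a neighbourhood uniform in p, by compactness of S; this
  -- gives the dominating function.
  have hb : ∀ᶠ x in 𝓝 x₀, ∀ p ∈ S, ‖(fderiv ℝ f (x, p)).comp (.inl ℝ E P)‖ < C + 1 :=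
    hS.eventually_forall_of_forall_eventually fun p hp =>
      (hf' p hp).continuousAt.norm.eventually_lt continuousAt_const ((hC p hp).trans_lt (by simp))
  have hs := (eventually_forall_analyticAt hS hf).and hb
  refine hasFDerivAt_integral_of_dominated_of_fderiv_le (bound := fun p => ‖g p‖ * (C + 1))
    (F' := fun x p => g p • (fderiv ℝ f (x, p)).comp (.inl ℝ E P)) hs
    (hint.mono fun x hx => hx.aestronglyMeasurable) hint.self_of_nhds ?_ ?_ (hg.norm.mul_const _) ?_
  · exact (integrableOn_smul_of_continuousOn hS hc hg).aestronglyMeasurable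
  · refine (ae_restrict_iff' hS.measurableSet).2 (Eventually.of_forall fun p hp x hx => ?_)
    rw [norm_smul]
    gcongr
    exact (hx.2 p hp).le
  · refine (ae_restrict_iff' hS.measurableSet).2 (Eventually.of_forall fun p hp x hx => ?_)
    refine HasFDerivAt.const_smul ?_ _
    exact (hx.1 p hp).differentiableAt.hasFDerivAt.comp x (hasFDerivAt_prodMk_left x p)

theorem hasDerivAt_setIntegral_smul [CompleteSpace F] {ν : Measure P} {S : Set P}
    (hS : IsCompact S) {f : ℝ × P → F} {t₀ : ℝ} (hf : ∀ p ∈ S, AnalyticAt ℝ f (t₀, p))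
    {g : P → ℝ} (hg : IntegrableOn g S ν) {f' : P → F}
    (hf' : ∀ p ∈ S, HasDerivAt (fun t => f (t, p)) (f' p) t₀) :
    HasDerivAt (fun t => ∫ p in S, g p • f (t, p) ∂ν) (∫ p in S, g p • f' p ∂ν) t₀ := by
  refine (hasFDerivAt_setIntegral_smul hS hf hg).hasDerivAt.congr_deriv ?_
  rw [ContinuousLinearMap.integral_apply
    (integrableOn_smul_of_continuousOn hS (continuousOn_fderiv_comp_inl hf) hg)]
  refine setIntegral_congr_fun hS.measurableSet fun p hp => ?_
  have h := ((hf p hp).differentiableAt.hasFDerivAt.comp t₀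
    (hasFDerivAt_prodMk_left t₀ p)).hasDerivAt
  rw [(hf' p hp).unique h]
  rfl

end ParametricIntegral

end Decoupling

namespace Decoupling

open Filter Topology Asymptotics
open scoped ENNReal NNReal ContDiff

/-! ### Division of analytic functions by powers of the parameter. -/

section Division

variable {X F : Type*} [NormedAddCommGroup X] [NormedSpace ℝ X]
  [NormedAddCommGroup F] [NormedSpace ℝ F] [CompleteSpace F]

/-- Hadamard's formula: the difference quotient equals ∫₀¹ ∂_κ f(x, sκ) ds, a parametric integral
that is also analytic across κ = 0. -/
theorem analyticOnNhd_dslope {f : X × ℝ → F} {S : Set X} {a : ℝ} (hS : IsOpen S)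
    (hf : AnalyticOnNhd ℝ f (S ×ˢ Ioo (-a) a)) :
    AnalyticOnNhd ℝ (fun p => dslope (fun κ => f (p.1, κ)) 0 p.2) (S ×ˢ Ioo (-a) a) := by
  have hmem {p : X × ℝ} (hp : p ∈ S ×ˢ Ioo (-a) a) {s : ℝ} (hs : s ∈ Icc (0 : ℝ) 1) :
      (p.1, s * p.2) ∈ S ×ˢ Ioo (-a) a := by
    obtain ⟨hx, h1, h2⟩ := hp
    obtain ⟨hs0, hs1⟩ := hs
    refine ⟨hx, ?_, ?_⟩ <;> simp only <;> nlinarith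
  have hder {p : X × ℝ} (hp : p ∈ S ×ˢ Ioo (-a) a) :
      HasDerivAt (fun κ => f (p.1, κ)) (fderiv ℝ f p (0, 1)) p.2 :=
    (hf p hp).differentiableAt.hasFDerivAt.comp_hasDerivAt p.2
      ((hasDerivAt_const p.2 p.1).prodMk (hasDerivAt_id p.2))
  have hg {p : X × ℝ} (hp : p ∈ S ×ˢ Ioo (-a) a) {s : ℝ} (hs : s ∈ Icc (0 : ℝ) 1) :
      AnalyticAt ℝ (fun q : (X × ℝ) × ℝ => fderiv ℝ f (q.1.1, q.2 * q.1.2) (0, 1)) (p, s) := by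
    have h1 : AnalyticAt ℝ (fun q : (X × ℝ) × ℝ => (q.1.1, q.2 * q.1.2)) (p, s) :=
      (analyticAt_fst.fun_comp_of_eq analyticAt_fst rfl).prod
        (analyticAt_snd.mul (analyticAt_snd.fun_comp_of_eq analyticAt_fst rfl))
    have h2 : AnalyticAt ℝ (fun q : X × ℝ => fderiv ℝ f q (0, 1)) (p.1, s * p.2) :=
      (ContinuousLinearMap.apply ℝ F ((0, 1) : X × ℝ)).analyticAt _ |>.comp
        (hf _ (hmem hp hs)).fderiv
    exact h2.fun_comp_of_eq h1 rfl
  intro p hp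
  refine (analyticAt_setIntegral_smul (ν := volume) (isCompact_Icc (a := (0 : ℝ)) (b := 1))
    (f := fun q : (X × ℝ) × ℝ => fderiv ℝ f (q.1.1, q.2 * q.1.2) (0, 1)) (x₀ := p)
    (fun s hs => hg hp hs) (g := fun _ => 1) (by simp)).congr ?_
  filter_upwards [(hS.prod isOpen_Ioo).mem_nhds hp] with q hq
  have ha : 0 < a := by have := hq.2.1.trans hq.2.2; linarith
  rw [integral_Icc_eq_integral_Ioc, ← intervalIntegral.integral_of_le zero_le_one]
  simp only [one_smul]
  by_cases h0 : q.2 = 0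
  · rw [h0, dslope_same]
    simp only [mul_zero, intervalIntegral.integral_const, sub_zero, one_smul]
    exact (hder (p := (q.1, 0)) ⟨hq.1, by simpa⟩).deriv.symm
  · have h1 := intervalIntegral.integral_unitInterval_deriv_eq_sub (𝕜 := ℝ)
      (f := fun κ => f (q.1, κ)) (f' := fun κ => fderiv ℝ f (q.1, κ) (0, 1)) (z₀ := 0) (z₁ := q.2)
      ?_ ?_
    · simp only [zero_add, smul_eq_mul] at h1
      rw [dslope_of_ne _ h0, slope_def_module, sub_zero, ← h1, inv_smul_smul₀ h0]
    · intro s hs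
      have := (hg hq hs).continuousAt.comp (f := fun s => (q, s)) (by fun_prop)
      simpa [Function.comp_def] using this.continuousWithinAt
    · intro s hs
      simpa using hder (p := (q.1, s * q.2)) (hmem hq hs)

/-- Each factor κ is removed by one difference quotient, since the O-bound forces f(x, 0) = 0. Only
a bound for each fixed x is needed. The last clause holds because the quotient at x depends only on
the slice f(x, ·); it transmits angle periodicity to the remainder. -/
theorem exists_eq_pow_smul_of_isBigO {S : Set X} {a : ℝ} (hS : IsOpen S) (ha : 0 < a) (N : ℕ) :
    ∀ {f : X × ℝ → F}, AnalyticOnNhd ℝ f (S ×ˢ Ioo (-a) a) →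
    (∀ x ∈ S, (fun κ => f (x, κ)) =O[𝓝[≠] 0] fun κ => κ ^ N) →
    ∃ R : X × ℝ → F, AnalyticOnNhd ℝ R (S ×ˢ Ioo (-a) a) ∧
      (∀ x ∈ S, ∀ κ ∈ Ioo (-a) a, f (x, κ) = κ ^ N • R (x, κ)) ∧
      ∀ x y, (∀ κ ∈ Ioo (-a) a, f (x, κ) = f (y, κ)) → ∀ κ ∈ Ioo (-a) a, R (x, κ) = R (y, κ) := by
  induction N with
  | zero => exact fun {f} hf _ => ⟨f, hf, by simp, fun _ _ h => h⟩
  | succ N ih =>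
    intro f hf hO
    have h0 (x) (hx : x ∈ S) : f (x, 0) = 0 := by
      have h1 : Tendsto (fun κ => f (x, κ)) (𝓝[≠] 0) (𝓝 0) :=
        (hO x hx).trans_tendsto ((Continuous.tendsto' (by fun_prop) _ _ (by simp)).mono_left
          nhdsWithin_le_nhds)
      have h2 : ContinuousAt (fun κ => f (x, κ)) 0 :=
        ((hf (x, 0) ⟨hx, by simpa⟩).continuousAt.comp (f := fun κ => (x, κ)) (by fun_prop))
      exact tendsto_nhds_unique (h2.tendsto.mono_left nhdsWithin_le_nhds) h1
    obtain ⟨R, hR, hfR, hRper⟩ := ih (analyticOnNhd_dslope hS hf) (fun x hx => by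
      rw [isBigO_iff]
      obtain ⟨C, hC⟩ := isBigO_iff.1 (hO x hx)
      refine ⟨C, ?_⟩
      filter_upwards [hC, self_mem_nhdsWithin] with κ hκ hne
      have hne' : κ ≠ 0 := hne
      rw [dslope_of_ne _ hne, slope_def_module, h0 x hx, sub_zero, sub_zero, norm_smul, norm_inv]
      rw [pow_succ, norm_mul] at hκ
      rw [inv_mul_le_iff₀ (by simpa using hne')]
      linarith)
    refine ⟨R, hR, fun x hx κ hκ => ?_, fun x y hxy => hRper x y fun κ hκ => ?_⟩
    · rw [pow_succ', mul_smul, ← hfR x hx κ hκ]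
      have := sub_smul_dslope (fun κ => f (x, κ)) 0 κ
      simpa [h0 x hx] using this.symm
    · simp only
      by_cases h : κ = 0
      · subst h
        rw [dslope_same, dslope_same]
        exact EventuallyEq.deriv_eq (by
          filter_upwards [Ioo_mem_nhds hκ.1 hκ.2] with κ' h' using hxy κ' h')
      · rw [dslope_of_ne _ h, dslope_of_ne _ h, slope_def_module, slope_def_module, hxy κ hκ,
          hxy 0 (by simpa)]

end Division

/-! ### Analytic local flows from the implicit function theorem. -/

section LocalFlow

variable {E : Type*} [NormedAddCommGroup E] [NormedSpace ℝ E] [CompleteSpace E]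

omit [CompleteSpace E] in
theorem norm_integral_projIcc_le (u : C(Icc (0 : ℝ) 1, E)) {s : ℝ} (hs : s ∈ Icc (0 : ℝ) 1) :
    ‖∫ τ in (0 : ℝ)..s, u (projIcc 0 1 zero_le_one τ)‖ ≤ ‖u‖ := by
  refine (intervalIntegral.norm_integral_le_of_norm_le_const (C := ‖u‖)
    fun τ _ => u.norm_coe_le_norm _).trans ?_
  rw [sub_zero, abs_of_nonneg hs.1]
  exact mul_le_of_le_one_right (norm_nonneg _) hs.2

/-- The primitive vanishing at `0`, on continuous functions on `[0, 1]`. -/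
noncomputable def primitiveCLM : C(Icc (0 : ℝ) 1, E) →L[ℝ] C(Icc (0 : ℝ) 1, E) :=
  have hc (u : C(Icc (0 : ℝ) 1, E)) : Continuous fun τ => u (projIcc 0 1 zero_le_one τ) :=
    u.continuous.comp continuous_projIcc
  LinearMap.mkContinuous
    { toFun := fun u => ⟨fun s => ∫ τ in (0 : ℝ)..s, u (projIcc 0 1 zero_le_one τ),
        (intervalIntegral.continuous_primitive (fun a b => (hc u).intervalIntegrable a b) 0).comp
          continuous_subtype_val⟩
      map_add' := fun u v => by
        ext s
        exact intervalIntegral.integral_add ((hc u).intervalIntegrable _ _)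
          ((hc v).intervalIntegrable _ _)
      map_smul' := fun c u => by
        ext s
        exact intervalIntegral.integral_smul _ _ }
    1 (fun u => by
      rw [one_mul]
      exact (ContinuousMap.norm_le _ (norm_nonneg _)).2 fun s => norm_integral_projIcc_le u s.2)

omit [CompleteSpace E] in
theorem primitiveCLM_apply (u : C(Icc (0 : ℝ) 1, E)) (s : Icc (0 : ℝ) 1) :
    primitiveCLM u s = ∫ τ in (0 : ℝ)..s, u (projIcc 0 1 zero_le_one τ) := rfl

/-- The Picard equation for the time-`t` rescaled integral curve. -/
noncomputable def picardDefect (V : E → E) (q : (E × ℝ) × C(Icc (0 : ℝ) 1, E)) :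
    C(Icc (0 : ℝ) 1, E) :=
  q.2 - ContinuousLinearMap.const ℝ (Icc (0 : ℝ) 1) q.1.1 -
    q.1.2 • primitiveCLM (superposition (Icc (0 : ℝ) 1) V q.2)

/-- With time rescaled to [0, 1], t enters the Picard equation as a factor of the integral. At t = 0
the derivative in the curve is therefore the identity, and the analytic implicit function theorem
applies at the constant curve. -/
theorem exists_analytic_picard_solution {V : E → E} {x₀ : E} (hV : AnalyticAt ℝ V x₀) :
    ∃ ψ : E × ℝ → C(Icc (0 : ℝ) 1, E), AnalyticAt ℝ ψ (x₀, 0) ∧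
      ∀ᶠ q in 𝓝 ((x₀, (0 : ℝ)), ContinuousMap.const (Icc (0 : ℝ) 1) x₀),
        picardDefect V q = 0 → ψ q.1 = q.2 := by
  obtain ⟨r, hr, -, hN⟩ := exists_analyticOnNhd_superposition hV
  have hN := hN (Icc (0 : ℝ) 1) _ (Metric.mem_ball_self hr)
  set u₀ := ((x₀, (0 : ℝ)), ContinuousMap.const (Icc (0 : ℝ) 1) x₀)
  have hN' : AnalyticAt ℝ (fun q : (E × ℝ) × C(Icc (0 : ℝ) 1, E) =>
      primitiveCLM (superposition (Icc (0 : ℝ) 1) V q.2)) u₀ :=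
    (primitiveCLM.analyticAt _).fun_comp_of_eq (hN.fun_comp_of_eq analyticAt_snd rfl) rfl
  have hc : AnalyticAt ℝ (fun q : (E × ℝ) × C(Icc (0 : ℝ) 1, E) =>
      ContinuousLinearMap.const ℝ (Icc (0 : ℝ) 1) q.1.1) u₀ :=
    ((ContinuousLinearMap.const ℝ (M := E) (Icc (0 : ℝ) 1)).analyticAt x₀).fun_comp_of_eq
      (analyticAt_fst.fun_comp_of_eq analyticAt_fst rfl) rfl
  have ht : AnalyticAt ℝ (fun q : (E × ℝ) × C(Icc (0 : ℝ) 1, E) => q.1.2) u₀ :=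
    analyticAt_snd.fun_comp_of_eq analyticAt_fst rfl
  have hG : AnalyticAt ℝ (picardDefect V) u₀ := (analyticAt_snd.sub hc).sub (ht.smul hN')
  have hG0 : picardDefect V u₀ = 0 := by
    ext s
    simp [picardDefect, u₀]
  have hfd : (fderiv ℝ (picardDefect V) u₀).comp (.inr ℝ (E × ℝ) C(Icc (0 : ℝ) 1, E)) =
      .id ℝ _ := by
    have h1 : HasFDerivAt (fun γ => picardDefect V ((x₀, 0), γ))
        ((fderiv ℝ (picardDefect V) u₀).comp (.inr ℝ (E × ℝ) C(Icc (0 : ℝ) 1, E)))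
        (ContinuousMap.const (Icc (0 : ℝ) 1) x₀) :=
      hG.differentiableAt.hasFDerivAt.comp _ (hasFDerivAt_prodMk_right _ _)
    have h2 : HasFDerivAt (fun γ => picardDefect V ((x₀, 0), γ)) (.id ℝ _)
        (ContinuousMap.const (Icc (0 : ℝ) 1) x₀) := by
      simp only [picardDefect, zero_smul, sub_zero]
      exact (hasFDerivAt_id _).sub_const _
    exact h1.unique h2
  have hinv : ((fderiv ℝ (picardDefect V) u₀).comp
      (.inr ℝ (E × ℝ) C(Icc (0 : ℝ) 1, E))).IsInvertible := by
    rw [hfd]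
    exact ⟨.refl ℝ _, rfl⟩
  have hGd : ContDiffAt ℝ ω (picardDefect V) u₀ := hG.contDiffAt
  refine ⟨hGd.implicitFunction (by simp) hinv,
    (hGd.contDiffAt_implicitFunction (by simp) hinv).analyticAt, ?_⟩
  filter_upwards [hGd.eventually_apply_eq_iff_implicitFunction (by simp) hinv] with q hq h
  exact hq.1 (h.trans hG0.symm)

/-- Picard–Lindelöf supplies a continuous local flow α. The rescaled curve s ↦ α(x, ts) satisfies
the Picard equation and lies near the constant x₀, so it is the implicit function at (x, t). Its
value at s = 1 shows that α is analytic. -/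
theorem exists_local_analytic_flow {V : E → E} {Ω : Set E} (hΩ : IsOpen Ω)
    (hV : AnalyticOnNhd ℝ V Ω) {x₀ : E} (hx₀ : x₀ ∈ Ω) :
    ∃ α : E × ℝ → E, ∃ r > 0, AnalyticOnNhd ℝ α (Metric.ball x₀ r ×ˢ Ioo (-r) r) ∧
      ∀ x ∈ Metric.ball x₀ r, α (x, 0) = x ∧ ∀ t ∈ Ioo (-r) r,
        α (x, t) ∈ Ω ∧ HasDerivAt (fun t => α (x, t)) (V (α (x, t))) t := by
  obtain ⟨ε, hε, a, r, L, K, hr, hpl⟩ :=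
    IsPicardLindelof.of_contDiffAt_one (hV x₀ hx₀).contDiffAt
  obtain ⟨α, hα, hαc⟩ :=
    (hpl 0).exists_forall_mem_closedBall_eq_hasDerivWithinAt_continuousOn
  simp only [zero_sub, zero_add] at hα hαc
  obtain ⟨ψ, hψ, hψu⟩ := exists_analytic_picard_solution (hV x₀ hx₀)
  have hα0 : α (x₀, 0) = x₀ := (hα x₀ (Metric.mem_closedBall_self (by positivity))).1
  have hcont : ContinuousAt α (x₀, 0) := hαc.continuousAt
    (prod_mem_nhds (Metric.closedBall_mem_nhds _ (by positivity))
      (Icc_mem_nhds (by linarith) hε))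
  obtain ⟨ρ, hρ, hρu⟩ := Metric.eventually_nhds_iff_ball.1 hψu
  -- A closed ball of half the radius: the sup distance of the whole curve to x₀ is then at most ρ /
  -- 2, hence strictly below ρ.
  have hev : ∀ᶠ p in 𝓝 (x₀, (0 : ℝ)), α p ∈ Ω ∩ Metric.closedBall x₀ (ρ / 2) :=
    hcont.eventually_mem (by
      rw [hα0]
      exact inter_mem (hΩ.mem_nhds hx₀) (Metric.closedBall_mem_nhds _ (by positivity)))
  obtain ⟨δ, hδ, hδα⟩ := Metric.eventually_nhds_iff_ball.1 hev
  set d := min (min δ ρ) (min r ε)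
  have hd : 0 < d := by positivity
  have hdδ : d ≤ δ := (min_le_left _ _).trans (min_le_left _ _)
  have hdρ : d ≤ ρ := (min_le_left _ _).trans (min_le_right _ _)
  have hdr : d ≤ r := (min_le_right _ _).trans (min_le_left _ _)
  have hdε : d ≤ ε := (min_le_right _ _).trans (min_le_right _ _)
  have hmem (x) (hx : x ∈ Metric.ball x₀ d) (t) (ht : t ∈ Ioo (-d) d) :
      α (x, t) ∈ Ω ∩ Metric.closedBall x₀ (ρ / 2) := by
    refine hδα _ ?_
    rw [← ball_prod_same, Real.ball_eq_Ioo]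
    exact ⟨Metric.ball_subset_ball hdδ hx, by constructor <;> linarith [ht.1, ht.2]⟩
  have hder (x) (hx : x ∈ Metric.ball x₀ d) (t) (ht : t ∈ Ioo (-d) d) :
      HasDerivAt (fun t => α (x, t)) (V (α (x, t))) t :=
    ((hα x (Metric.ball_subset_closedBall (Metric.ball_subset_ball hdr hx))).2 t
      ⟨by linarith [ht.1], by linarith [ht.2]⟩).hasDerivAt
      (Icc_mem_nhds (by linarith [ht.1]) (by linarith [ht.2]))
  have heq (x) (hx : x ∈ Metric.ball x₀ d) (t) (ht : t ∈ Ioo (-d) d) :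
      ψ (x, t) ⟨1, by simp⟩ = α (x, t) := by
    have hts (s : ℝ) (hs : s ∈ Icc (0 : ℝ) 1) : t * s ∈ Ioo (-d) d := by
      obtain ⟨hs0, hs1⟩ := hs
      obtain ⟨h1, h2⟩ := ht
      constructor <;> nlinarith
    have hγd (s : ℝ) (hs : s ∈ Icc (0 : ℝ) 1) :
        HasDerivAt (fun s => α (x, t * s)) (t • V (α (x, t * s))) s := by
      have := (hder x hx _ (hts s hs)).scomp s ((hasDerivAt_id s).const_mul t)
      simpa [Function.comp_def] using this
    let γ : C(Icc (0 : ℝ) 1, E) := ⟨fun s => α (x, t * s), by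
      rw [continuous_iff_continuousAt]
      exact fun s => ContinuousAt.comp (g := fun s : ℝ => α (x, t * s))
        (hγd s s.2).continuousAt continuous_subtype_val.continuousAt⟩
    have hVγ : ContinuousOn (fun s : ℝ => V (α (x, t * s))) (Icc 0 1) := fun s hs =>
      ((hV _ (hmem x hx _ (hts s hs)).1).continuousAt.comp (f := fun s => α (x, t * s))
        (hγd s hs).continuousAt).continuousWithinAt
    have hVγ' : Continuous fun s : Icc (0 : ℝ) 1 => V (γ s) := 
      continuousOn_iff_continuous_domRestrict.1 hVγ
    have hzero : picardDefect V ((x, t), γ) = 0 := by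
      ext s
      have hint : ∫ τ in (0 : ℝ)..s, t • V (α (x, t * τ)) = α (x, t * s) - α (x, t * 0) := by
        have hsub : uIcc (0 : ℝ) s ⊆ Icc 0 1 := by
          rw [uIcc_of_le s.2.1]
          exact Icc_subset_Icc_right s.2.2
        refine intervalIntegral.integral_eq_sub_of_hasDerivAt
          (fun τ hτ => hγd τ (hsub hτ)) ?_
        exact ((hVγ.mono hsub).const_smul t).intervalIntegrable
      have hprim : primitiveCLM (superposition (Icc (0 : ℝ) 1) V γ) s =
          ∫ τ in (0 : ℝ)..s, V (α (x, t * τ)) := by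
        rw [primitiveCLM_apply]
        refine intervalIntegral.integral_congr fun τ hτ => ?_
        rw [uIcc_of_le s.2.1] at hτ
        have hτ' : τ ∈ Icc (0 : ℝ) 1 := ⟨hτ.1, hτ.2.trans s.2.2⟩
        rw [superposition_apply hVγ', projIcc_of_mem zero_le_one hτ']
        rfl
      have hx0 : α (x, 0) = x :=
        (hα x (Metric.ball_subset_closedBall (Metric.ball_subset_ball hdr hx))).1
      rw [intervalIntegral.integral_smul, mul_zero, hx0] at hint
      simp only [picardDefect, ContinuousMap.sub_apply, ContinuousMap.smul_apply, hprim, hint]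
      simp [γ]
    have hnear : ((x, t), γ) ∈ Metric.ball ((x₀, (0 : ℝ)), ContinuousMap.const (Icc (0 : ℝ) 1) x₀) ρ := by
      rw [← ball_prod_same, ← ball_prod_same, Real.ball_eq_Ioo]
      refine ⟨⟨Metric.ball_subset_ball hdρ hx, by constructor <;> linarith [ht.1, ht.2]⟩, ?_⟩
      rw [Metric.mem_ball]
      refine lt_of_le_of_lt ((ContinuousMap.dist_le (C := ρ / 2) (by positivity)).2 fun s => ?_)
        (half_lt_self hρ)
      exact (hmem x hx _ (hts s s.2)).2
    have := hρu _ hnear hzero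
    simp only at this
    rw [this]
    simp [γ]
  have hαan : AnalyticAt ℝ α (x₀, 0) := by
    have h1 : AnalyticAt ℝ (fun p => ψ p ⟨1, by simp⟩) (x₀, 0) :=
      (ContinuousMap.evalCLM ℝ (M := E) (⟨1, by simp⟩ : Icc (0 : ℝ) 1)).analyticAt _ |>.comp hψ
    refine h1.congr ?_
    filter_upwards [prod_mem_nhds (Metric.ball_mem_nhds x₀ hd)
      (Ioo_mem_nhds (by linarith : -d < 0) hd)] with p hp
    exact heq p.1 hp.1 p.2 hp.2
  obtain ⟨b, hb, hbα⟩ := Metric.eventually_nhds_iff_ball.1 hαan.eventually_analyticAt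
  refine ⟨α, min b d, by positivity, fun p hp => hbα p ?_, fun x hx => ?_⟩
  · rw [← ball_prod_same, Real.ball_eq_Ioo]
    exact ⟨Metric.ball_subset_ball (min_le_left _ _) hp.1,
      by constructor <;> linarith [hp.2.1, hp.2.2, min_le_left b d]⟩
  · have hx' := Metric.ball_subset_ball (min_le_right b d) hx
    refine ⟨(hα x (Metric.ball_subset_closedBall (Metric.ball_subset_ball hdr hx'))).1,
      fun t ht => ?_⟩
    have ht' : t ∈ Ioo (-d) d := by constructor <;> linarith [ht.1, ht.2, min_le_right b d]
    exact ⟨(hmem x hx' t ht').1, hder x hx' t ht'⟩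

end LocalFlow

/-! ### Derivative of the determinant. -/

section Determinant

variable {E : Type*} [NormedAddCommGroup E] [NormedSpace ℝ E] [FiniteDimensional ℝ E]

theorem contDiff_det : ContDiff ℝ ω (fun A : E →L[ℝ] E => A.det) := by
  let b := Module.finBasis ℝ E
  have h (A : E →L[ℝ] E) : A.det = ∑ σ : Equiv.Perm (Fin (Module.finrank ℝ E)),
      (Equiv.Perm.sign σ : ℝ) * ∏ i, b.coord (σ i) (A (b i)) := by
    rw [ContinuousLinearMap.det, ← LinearMap.det_toMatrix b, Matrix.det_apply']
    simp [LinearMap.toMatrix_apply]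
  simp_rw [h]
  refine ContDiff.sum fun σ _ => contDiff_const.mul (contDiff_prod fun i _ => ?_)
  have : (fun A : E →L[ℝ] E => b.coord (σ i) (A (b i))) =
      fun A => (b.coord (σ i)).toContinuousLinearMap (ContinuousLinearMap.apply ℝ E (b i) A) := rfl
  rw [this]
  exact (ContinuousLinearMap.contDiff _).comp (ContinuousLinearMap.contDiff _)

theorem hasDerivAt_det_one_add_smul (L : E →L[ℝ] E) :
    HasDerivAt (fun s : ℝ => (1 + s • L).det) (LinearMap.trace ℝ E (L : E →ₗ[ℝ] E)) 0 := by
  let b := Module.finBasis ℝ E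
  have h (s : ℝ) : (1 + s • L).det = 1 + LinearMap.trace ℝ E (L : E →ₗ[ℝ] E) * s +
      ((1 + (Polynomial.X : Polynomial ℝ) •
        (LinearMap.toMatrix b b (L : E →ₗ[ℝ] E)).map Polynomial.C).det).divX.divX.eval s * s ^ 2 := by
    rw [ContinuousLinearMap.det, ← LinearMap.det_toMatrix b, LinearMap.trace_eq_matrix_trace ℝ b,
      ← Matrix.det_one_add_smul]
    congr 1
    have : ((1 + s • L : E →L[ℝ] E) : E →ₗ[ℝ] E) = LinearMap.id + s • (L : E →ₗ[ℝ] E) := rfl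
    rw [this, map_add, map_smul, LinearMap.toMatrix_id]
  simp_rw [h]
  have h1 := ((hasDerivAt_id (0 : ℝ)).const_mul
    (LinearMap.trace ℝ E (L : E →ₗ[ℝ] E))).const_add 1
  have h2 := ((((1 + (Polynomial.X : Polynomial ℝ) •
        (LinearMap.toMatrix b b (L : E →ₗ[ℝ] E)).map Polynomial.C).det).divX.divX.hasDerivAt
        (0 : ℝ)).mul ((hasDerivAt_id (0 : ℝ)).pow 2))
  have h3 := h1.add h2
  simp only [id_eq, mul_one] at h3
  exact h3.congr_deriv (by simp)

/-- Jacobi's formula in a form that needs no invertibility of B: det(B + sLB) = det(1 + sL) det B,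
and the linear coefficient of det(1 + sL) is the trace. -/
theorem fderiv_det_comp (L B : E →L[ℝ] E) :
    fderiv ℝ (fun A : E →L[ℝ] E => A.det) B (L.comp B) =
      LinearMap.trace ℝ E (L : E →ₗ[ℝ] E) * B.det := by
  have h1 : HasDerivAt (fun s : ℝ => (B + s • L.comp B).det)
      (fderiv ℝ (fun A : E →L[ℝ] E => A.det) B (L.comp B)) 0 := by
    have hd : HasFDerivAt (fun A : E →L[ℝ] E => A.det)
        (fderiv ℝ (fun A : E →L[ℝ] E => A.det) B) (B + (0 : ℝ) • L.comp B) := by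
      rw [zero_smul, add_zero]
      exact (contDiff_det.differentiable (by simp)).differentiableAt.hasFDerivAt
    have := hd.comp_hasDerivAt (0 : ℝ)
      (((hasDerivAt_id (0 : ℝ)).smul_const (L.comp B)).const_add B)
    simpa [Function.comp_def] using this
  have h2 : HasDerivAt (fun s : ℝ => (B + s • L.comp B).det)
      (LinearMap.trace ℝ E (L : E →ₗ[ℝ] E) * B.det) 0 := by
    refine ((hasDerivAt_det_one_add_smul L).mul_const B.det).congr_of_eventuallyEq
      (Eventually.of_forall fun s => ?_)
    have : B + s • L.comp B = (1 + s • L).comp B := by ext v; simp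
    simp only [this]
    exact LinearMap.det_comp _ _
  exact h1.unique h2

theorem fderiv_det_one (L : E →L[ℝ] E) :
    fderiv ℝ (fun A : E →L[ℝ] E => A.det) 1 L = LinearMap.trace ℝ E (L : E →ₗ[ℝ] E) := by
  have := fderiv_det_comp L 1
  have h1 : (1 : E →L[ℝ] E).det = 1 := LinearMap.det_id
  rw [h1, mul_one] at this
  exact this

end Determinant

/-! ### Flows of analytic vector fields: uniqueness, gluing, Liouville's formula. -/

section Flow

variable {E : Type*} [NormedAddCommGroup E] [NormedSpace ℝ E]

/-- `φ` is an analytic flow of `V` in `Ω`, starting in `D` and defined for times in `(-δ, δ)`. -/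
structure IsFlowOn (V : E → E) (Ω D : Set E) (δ : ℝ) (φ : E × ℝ → E) : Prop where
  analytic : AnalyticOnNhd ℝ φ (D ×ˢ Ioo (-δ) δ)
  zero : ∀ x ∈ D, φ (x, 0) = x
  mem : ∀ x ∈ D, ∀ t ∈ Ioo (-δ) δ, φ (x, t) ∈ Ω
  deriv : ∀ x ∈ D, ∀ t ∈ Ioo (-δ) δ, HasDerivAt (fun t => φ (x, t)) (V (φ (x, t))) t

theorem IsFlowOn.mono {V : E → E} {Ω D D' : Set E} {δ δ' : ℝ} {φ : E × ℝ → E}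
    (h : IsFlowOn V Ω D δ φ) (hD : D' ⊆ D) (hδ : δ' ≤ δ) : IsFlowOn V Ω D' δ' φ := by
  have hI : Ioo (-δ') δ' ⊆ Ioo (-δ) δ := Ioo_subset_Ioo (by linarith) hδ
  exact ⟨h.analytic.mono (prod_mono hD hI), fun x hx => h.zero x (hD hx),
    fun x hx t ht => h.mem x (hD hx) t (hI ht), fun x hx t ht => h.deriv x (hD hx) t (hI ht)⟩

theorem integralCurve_unique {V : E → E} {Ω : Set E} (hV : AnalyticOnNhd ℝ V Ω)
    [CompleteSpace E] {δ : ℝ} {γ₁ γ₂ : ℝ → E}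
    (h₁ : ∀ t ∈ Ioo (-δ) δ, γ₁ t ∈ Ω ∧ HasDerivAt γ₁ (V (γ₁ t)) t)
    (h₂ : ∀ t ∈ Ioo (-δ) δ, γ₂ t ∈ Ω ∧ HasDerivAt γ₂ (V (γ₂ t)) t) (h0 : γ₁ 0 = γ₂ 0) :
    EqOn γ₁ γ₂ (Ioo (-δ) δ) := by
  intro t ht
  obtain ⟨b, htb, hbδ⟩ := exists_between (abs_lt.2 ht)
  have hb : 0 < b := (abs_nonneg t).trans_lt htb
  have hsub : Icc (-b) b ⊆ Ioo (-δ) δ := fun s hs => ⟨by linarith [hs.1], by linarith [hs.2]⟩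
  have hc {γ : ℝ → E} (h : ∀ t ∈ Ioo (-δ) δ, γ t ∈ Ω ∧ HasDerivAt γ (V (γ t)) t) :
      IsCompact (γ '' Icc (-b) b) := isCompact_Icc.image_of_continuousOn fun s hs =>
    (h s (hsub hs)).2.continuousAt.continuousWithinAt
  -- Local Lipschitz bounds become one Lipschitz constant on the union of the two compact traces,
  -- which is what the ODE uniqueness theorem needs.
  have hll : LocallyLipschitzOn (γ₁ '' Icc (-b) b ∪ γ₂ '' Icc (-b) b) V := by
    intro x hx
    have hxΩ : x ∈ Ω := by
      rcases hx with ⟨s, hs, rfl⟩ | ⟨s, hs, rfl⟩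
      exacts [(h₁ s (hsub hs)).1, (h₂ s (hsub hs)).1]
    obtain ⟨K, u, hu, hK⟩ := (hV x hxΩ).contDiffAt.exists_lipschitzOnWith
    exact ⟨K, u, mem_nhdsWithin_of_mem_nhds hu, hK⟩
  obtain ⟨K, hK⟩ := hll.exists_lipschitzOnWith_of_compact ((hc h₁).union (hc h₂))
  exact ODE_solution_unique_of_mem_Ioo (v := fun _ => V)
    (s := fun _ => γ₁ '' Icc (-b) b ∪ γ₂ '' Icc (-b) b) (fun _ _ => hK)
    (t₀ := 0) ⟨by linarith, hb⟩
    (fun s hs => ⟨(h₁ s (hsub (Ioo_subset_Icc_self hs))).2,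
      Or.inl ⟨s, Ioo_subset_Icc_self hs, rfl⟩⟩)
    (fun s hs => ⟨(h₂ s (hsub (Ioo_subset_Icc_self hs))).2,
      Or.inr ⟨s, Ioo_subset_Icc_self hs, rfl⟩⟩) h0 (abs_lt.1 htb)

variable [CompleteSpace E]

theorem IsFlowOn.eqOn {V : E → E} {Ω D D' : Set E} {δ : ℝ} {φ φ' : E × ℝ → E}
    (hV : AnalyticOnNhd ℝ V Ω) (h : IsFlowOn V Ω D δ φ) (h' : IsFlowOn V Ω D' δ φ') {x : E}
    (hx : x ∈ D) (hx' : x ∈ D') {t : ℝ} (ht : t ∈ Ioo (-δ) δ) : φ (x, t) = φ' (x, t) :=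
  integralCurve_unique hV (γ₁ := fun t => φ (x, t)) (γ₂ := fun t => φ' (x, t))
    (fun t ht => ⟨h.mem x hx t ht, h.deriv x hx t ht⟩)
    (fun t ht => ⟨h'.mem x hx' t ht, h'.deriv x hx' t ht⟩)
    (by simp only [h.zero x hx, h'.zero x hx']) ht

/-- Both s ↦ φ(φ(x, t), s) and s ↦ φ(x, t + s) are integral curves through φ(x, t). Half the time is
given up so that t + s stays in (-δ, δ). -/
theorem IsFlowOn.flow_neg {V : E → E} {Ω D : Set E} {δ : ℝ} {φ : E × ℝ → E}
    (hV : AnalyticOnNhd ℝ V Ω) (h : IsFlowOn V Ω D δ φ) {x : E} (hx : x ∈ D) {t : ℝ}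
    (ht : t ∈ Ioo (-(δ / 2)) (δ / 2)) (hxt : φ (x, t) ∈ D) : φ (φ (x, t), -t) = x := by
  have hδ : 0 < δ := by linarith [ht.1.trans ht.2]
  have hsub {s : ℝ} (hs : s ∈ Ioo (-(δ / 2)) (δ / 2)) : t + s ∈ Ioo (-δ) δ :=
    ⟨by linarith [ht.1, hs.1], by linarith [ht.2, hs.2]⟩
  have h2 := h.mono (D' := D) subset_rfl (δ' := δ / 2) (by linarith)
  have := integralCurve_unique hV (δ := δ / 2) (γ₁ := fun s => φ (φ (x, t), s))
    (γ₂ := fun s => φ (x, t + s))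
    (fun s hs => ⟨h2.mem _ hxt s hs, h2.deriv _ hxt s hs⟩)
    (fun s hs => ⟨h.mem x hx _ (hsub hs), (h.deriv x hx _ (hsub hs)).comp_const_add t s⟩)
    (by simp only [h.zero _ hxt, add_zero])
  have := this (x := -t) ⟨by linarith [ht.2], by linarith [ht.1]⟩
  simpa [h.zero x hx] using this

/-- Each x uses its own local flow. Uniqueness shows that near x these choices agree with the single
flow chosen at x, hence depend analytically on the point. -/
theorem exists_isFlowOn_of_local {V : E → E} {Ω D : Set E} {δ : ℝ} (hD : IsOpen D)
    (hV : AnalyticOnNhd ℝ V Ω)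
    (hloc : ∀ x ∈ D, ∃ φ, ∃ r > 0, IsFlowOn V Ω (Metric.ball x r) δ φ) :
    ∃ φ, IsFlowOn V Ω D δ φ := by
  classical
  choose! ψ r hr hψ using hloc
  have heq (x) (hx : x ∈ D) (y) (hy : y ∈ D) (hyx : y ∈ Metric.ball x (r x)) (t : ℝ)
      (ht : t ∈ Ioo (-δ) δ) : ψ y (y, t) = ψ x (y, t) :=
    (hψ y hy).eqOn hV (hψ x hx) (Metric.mem_ball_self (hr y hy)) hyx ht
  refine ⟨fun p => ψ p.1 p, ⟨fun p hp => ?_, fun x hx => ?_, fun x hx => ?_, fun x hx => ?_⟩⟩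
  · refine ((hψ p.1 hp.1).analytic p ⟨Metric.mem_ball_self (hr _ hp.1), hp.2⟩).congr ?_
    filter_upwards [prod_mem_nhds (inter_mem (hD.mem_nhds hp.1)
      (Metric.ball_mem_nhds _ (hr _ hp.1))) (isOpen_Ioo.mem_nhds hp.2)] with q hq
    exact (heq p.1 hp.1 q.1 hq.1.1 hq.1.2 q.2 hq.2).symm
  · exact (hψ x hx).zero x (Metric.mem_ball_self (hr x hx))
  · exact (hψ x hx).mem x (Metric.mem_ball_self (hr x hx))
  · exact (hψ x hx).deriv x (Metric.mem_ball_self (hr x hx))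

theorem exists_uniform_isFlowOn {V : E → E} {Ω C : Set E} (hΩ : IsOpen Ω)
    (hV : AnalyticOnNhd ℝ V Ω) (hC : IsCompact C) (hCΩ : C ⊆ Ω) :
    ∃ δ > 0, ∀ x ∈ C, ∃ φ, ∃ r > 0, IsFlowOn V Ω (Metric.ball x r) δ φ := by
  refine hC.induction_on
    (p := fun s => ∃ δ > 0, ∀ x ∈ s, ∃ φ, ∃ r > 0, IsFlowOn V Ω (Metric.ball x r) δ φ)
    ⟨1, one_pos, by simp⟩ ?_ ?_ ?_
  · rintro s t hst ⟨δ, hδ, h⟩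
    exact ⟨δ, hδ, fun x hx => h x (hst hx)⟩
  · rintro s t ⟨δ, hδ, h⟩ ⟨δ', hδ', h'⟩
    refine ⟨min δ δ', by positivity, ?_⟩
    rintro x (hx | hx)
    · obtain ⟨φ, r, hr, hφ⟩ := h x hx
      exact ⟨φ, r, hr, hφ.mono subset_rfl (min_le_left _ _)⟩
    · obtain ⟨φ, r, hr, hφ⟩ := h' x hx
      exact ⟨φ, r, hr, hφ.mono subset_rfl (min_le_right _ _)⟩
  · intro x hx
    obtain ⟨α, r, hr, hα, h⟩ := exists_local_analytic_flow hΩ hV (hCΩ hx)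
    refine ⟨Metric.ball x (r / 2), mem_nhdsWithin_of_mem_nhds
      (Metric.ball_mem_nhds _ (by positivity)), r, hr, fun y hy => ⟨α, r / 2, by positivity, ?_⟩⟩
    have hfl : IsFlowOn V Ω (Metric.ball x r) r α :=
      ⟨hα, fun x hx => (h x hx).1, fun x hx t ht => ((h x hx).2 t ht).1,
        fun x hx t ht => ((h x hx).2 t ht).2⟩
    exact hfl.mono (Metric.ball_subset_ball' (by rw [Metric.mem_ball] at hy; linarith)) le_rfl

omit [CompleteSpace E] in
theorem IsFlowOn.translate {V : E → E} {Ω D : Set E} {δ : ℝ} {φ : E × ℝ → E} {k : E}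
    (h : IsFlowOn V Ω D δ φ) (hk : ∀ x ∈ Ω, x + k ∈ Ω ∧ V (x + k) = V x) {D' : Set E}
    (hD' : ∀ x ∈ D', x - k ∈ D) :
    IsFlowOn V Ω D' δ (fun p => φ (p.1 - k, p.2) + k) where
  analytic p hp := by
    have h1 : AnalyticAt ℝ (fun p : E × ℝ => (p.1 - k, p.2)) p :=
      (analyticAt_fst.sub analyticAt_const).prod analyticAt_snd
    exact ((h.analytic (p.1 - k, p.2) ⟨hD' _ hp.1, hp.2⟩).fun_comp_of_eq h1 rfl).add
      analyticAt_const
  zero x hx := by simp [h.zero _ (hD' x hx)]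
  mem x hx t ht := (hk _ (h.mem _ (hD' x hx) t ht)).1
  deriv x hx t ht := by
    simp only
    rw [(hk _ (h.mem _ (hD' x hx) t ht)).2]
    exact (h.deriv _ (hD' x hx) t ht).add_const k

/-- The first variational equation: symmetry of the second derivative of φ on E × ℝ exchanges the
time and space derivatives, and the flow equation is then differentiated in space. -/
theorem IsFlowOn.hasDerivAt_fderiv {V : E → E} {Ω D : Set E} {δ : ℝ} {φ : E × ℝ → E}
    (hD : IsOpen D) (hV : AnalyticOnNhd ℝ V Ω) (h : IsFlowOn V Ω D δ φ) {x : E} (hx : x ∈ D)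
    {t : ℝ} (ht : t ∈ Ioo (-δ) δ) :
    HasDerivAt (fun t => fderiv ℝ (fun x => φ (x, t)) x)
      ((fderiv ℝ V (φ (x, t))).comp (fderiv ℝ (fun x => φ (x, t)) x)) t := by
  have hpart {y : E} (hy : y ∈ D) {s : ℝ} (hs : s ∈ Ioo (-δ) δ) :
      HasFDerivAt (fun x => φ (x, s)) ((fderiv ℝ φ (y, s)).comp (.inl ℝ E ℝ)) y :=
    (h.analytic _ ⟨hy, hs⟩).differentiableAt.hasFDerivAt.comp y (hasFDerivAt_prodMk_left y s)
  have han := h.analytic (x, t) ⟨hx, ht⟩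
  have h2 : HasFDerivAt (fderiv ℝ φ) (fderiv ℝ (fderiv ℝ φ) (x, t)) (x, t) :=
    han.fderiv.differentiableAt.hasFDerivAt
  have hsymm : IsSymmSndFDerivAt ℝ φ (x, t) := ContDiffAt.isSymmSndFDerivAt_of_omega
    (AnalyticAt.contDiffAt (n := ω) han)
  have h3 : HasDerivAt (fun s => fderiv ℝ φ (x, s)) (fderiv ℝ (fderiv ℝ φ) (x, t) (0, 1)) t :=
    h2.comp_hasDerivAt t ((hasDerivAt_const t x).prodMk (hasDerivAt_id t))
  have h4 : HasDerivAt (fun s => (fderiv ℝ φ (x, s)).comp (.inl ℝ E ℝ))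
      ((fderiv ℝ (fderiv ℝ φ) (x, t) (0, 1)).comp (.inl ℝ E ℝ)) t :=
    ((ContinuousLinearMap.compL ℝ E (E × ℝ) E).flip (.inl ℝ E ℝ)).hasFDerivAt.comp_hasDerivAt t h3
  have h5 : HasFDerivAt (fun y => fderiv ℝ φ (y, t) (0, 1))
      ((ContinuousLinearMap.apply ℝ E ((0, 1) : E × ℝ)).comp
        ((fderiv ℝ (fderiv ℝ φ) (x, t)).comp (.inl ℝ E ℝ))) x :=
    (ContinuousLinearMap.apply ℝ E ((0, 1) : E × ℝ)).hasFDerivAt.comp x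
      (h2.comp x (hasFDerivAt_prodMk_left x t))
  have h6 : HasFDerivAt (fun y => fderiv ℝ φ (y, t) (0, 1))
      ((fderiv ℝ V (φ (x, t))).comp ((fderiv ℝ φ (x, t)).comp (.inl ℝ E ℝ))) x := by
    refine ((hV _ (h.mem x hx t ht)).differentiableAt.hasFDerivAt.comp x
      (hpart hx ht)).congr_of_eventuallyEq ?_
    filter_upwards [hD.mem_nhds hx] with y hy
    have : HasDerivAt (fun s => φ (y, s)) (fderiv ℝ φ (y, t) (0, 1)) t :=
      (h.analytic _ ⟨hy, ht⟩).differentiableAt.hasFDerivAt.comp_hasDerivAt t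
        ((hasDerivAt_const t y).prodMk (hasDerivAt_id t))
    exact this.unique (h.deriv y hy t ht)
  rw [(hpart hx ht).fderiv]
  have h7 : (fderiv ℝ (fderiv ℝ φ) (x, t) (0, 1)).comp (.inl ℝ E ℝ) =
      (fderiv ℝ V (φ (x, t))).comp ((fderiv ℝ φ (x, t)).comp (.inl ℝ E ℝ)) := by
    rw [← h5.unique h6]
    ext v
    exact hsymm (0, 1) (v, 0)
  rw [← h7]
  refine h4.congr_of_eventuallyEq ?_
  filter_upwards [isOpen_Ioo.mem_nhds ht] with s hs
  exact (hpart hx hs).fderiv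

/-- Liouville's formula: by the variational equation the Jacobian has logarithmic derivative tr DV =
0, and it equals 1 at time 0. -/
theorem IsFlowOn.det_fderiv [FiniteDimensional ℝ E] {V : E → E} {Ω D : Set E} {δ : ℝ}
    {φ : E × ℝ → E} (hD : IsOpen D) (hV : AnalyticOnNhd ℝ V Ω)
    (hdiv : ∀ x ∈ Ω, LinearMap.trace ℝ E (fderiv ℝ V x : E →ₗ[ℝ] E) = 0)
    (h : IsFlowOn V Ω D δ φ) {x : E} (hx : x ∈ D) {t : ℝ} (ht : t ∈ Ioo (-δ) δ) :
    (fderiv ℝ (fun x => φ (x, t)) x).det = 1 := by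
  have hd (s) (hs : s ∈ Ioo (-δ) δ) :
      HasDerivAt (fun t => (fderiv ℝ (fun x => φ (x, t)) x).det) 0 s := by
    have h1 : HasFDerivAt (fun A : E →L[ℝ] E => A.det) _ (fderiv ℝ (fun x => φ (x, s)) x) :=
      (contDiff_det.differentiable (by simp)).differentiableAt.hasFDerivAt
    have h2 := h1.comp_hasDerivAt s (h.hasDerivAt_fderiv hD hV hx hs)
    rw [fderiv_det_comp, hdiv _ (h.mem x hx s hs), zero_mul] at h2
    exact h2
  have h0 : (0 : ℝ) ∈ Ioo (-δ) δ := by constructor <;> linarith [ht.1.trans ht.2]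
  have := isOpen_Ioo.is_const_of_deriv_eq_zero isPreconnected_Ioo
    (f := fun t => (fderiv ℝ (fun x => φ (x, t)) x).det)
    (fun s hs => (hd s hs).differentiableAt.differentiableWithinAt)
    (fun s hs => (hd s hs).deriv) ht h0
  rw [this]
  have hid : fderiv ℝ (fun x => φ (x, 0)) x = 1 := by
    have : (fun x => φ (x, 0)) =ᶠ[𝓝 x] id := by
      filter_upwards [hD.mem_nhds hx] with y hy using h.zero y hy
    rw [this.fderiv_eq]
    exact fderiv_id
  simp only [hid]
  exact LinearMap.det_id

end Flow

/-! ### Characters and Fourier series of periodic functions on ℝ^l. -/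

section TorusFourier

variable {l j : ℕ}

/-- The character `θ ↦ exp (2πi m · θ)`. -/
noncomputable def angleChar (m : Fin l → ℤ) (θ : Fin l → ℝ) : ℂ :=
  Complex.exp (2 * Real.pi * Complex.I * ∑ i, (m i : ℂ) * (θ i : ℂ))

theorem angleChar_add (m : Fin l → ℤ) (θ ψ : Fin l → ℝ) :
    angleChar m (θ + ψ) = angleChar m θ * angleChar m ψ := by
  simp only [angleChar, ← Complex.exp_add, ← mul_add, ← Finset.sum_add_distrib]
  simp [mul_add]

theorem angleChar_neg_left (m : Fin l → ℤ) (θ : Fin l → ℝ) :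
    angleChar (-m) θ = angleChar m (-θ) := by
  simp [angleChar]

theorem angleChar_zero_right (m : Fin l → ℤ) : angleChar m 0 = 1 := by
  simp [angleChar]

theorem norm_angleChar (m : Fin l → ℤ) (θ : Fin l → ℝ) : ‖angleChar m θ‖ = 1 := by
  have : angleChar m θ = Complex.exp (((2 * Real.pi * ∑ i, (m i : ℝ) * θ i : ℝ) : ℂ) *
      Complex.I) := by
    rw [angleChar]
    push_cast
    ring_nf
  rw [this, Complex.norm_exp_ofReal_mul_I]

theorem angleChar_intVec (m k : Fin l → ℤ) : angleChar m (intVec k) = 1 := by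
  rw [angleChar, Complex.exp_eq_one_iff]
  refine ⟨∑ i, m i * k i, ?_⟩
  simp only [intVec]
  push_cast
  ring

theorem mFourier_coe (m : Fin l → ℤ) (θ : Fin l → ℝ) :
    UnitAddTorus.mFourier m (fun i => (θ i : UnitAddCircle)) = angleChar m θ := by
  simp only [UnitAddTorus.mFourier, ContinuousMap.coe_mk, fourier_coe_apply, angleChar,
    ← Complex.exp_sum, Finset.mul_sum]
  congr 1
  refine Finset.sum_congr rfl fun i _ => ?_
  push_cast
  ring

theorem continuous_angleChar (m : Fin l → ℤ) : Continuous (angleChar m) := by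
  unfold angleChar
  fun_prop

/-- The function on the torus induced by a function on `ℝ^l` (meaningful if it is periodic). -/
noncomputable def torusLift {F : Type*} (h : (Fin l → ℝ) → F) (x : UnitAddTorus (Fin l)) : F :=
  h fun i => ((AddCircle.equivIco 1 0 (x i) : Ico (0 : ℝ) (0 + 1)) : ℝ)

theorem torusLift_coe {F : Type*} {h : (Fin l → ℝ) → F}
    (hper : ∀ (k : Fin l → ℤ) θ, h (θ + intVec k) = h θ) (θ : Fin l → ℝ) :
    torusLift h (fun i => (θ i : UnitAddCircle)) = h θ := by
  rw [torusLift, ← hper (fun i => ⌊θ i⌋)]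
  congr 1
  ext i
  simp [intVec, AddCircle.coe_equivIco_mk_apply]

theorem continuous_torusLift {F : Type*} [TopologicalSpace F] {h : (Fin l → ℝ) → F}
    (hc : Continuous h) (hper : ∀ (k : Fin l → ℤ) θ, h (θ + intVec k) = h θ) :
    Continuous (torusLift h) := by
  have hq : IsOpenQuotientMap (fun (θ : Fin l → ℝ) i => (θ i : UnitAddCircle)) :=
    IsOpenQuotientMap.piMap fun _ => QuotientAddGroup.isOpenQuotientMap_mk
  rw [hq.isQuotientMap.continuous_iff]
  convert hc using 1
  ext θ
  exact torusLift_coe hper θ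

/-- The integral over any unit cube is the Haar integral on the torus; as the right-hand side does
not involve ψ, translation invariance follows. -/
theorem setIntegral_Icc_comp_add {F : Type*} [NormedAddCommGroup F] [NormedSpace ℝ F]
    {h : (Fin l → ℝ) → F} (hper : ∀ (k : Fin l → ℤ) θ, h (θ + intVec k) = h θ) (ψ : Fin l → ℝ) :
    ∫ θ in Icc (0 : Fin l → ℝ) 1, h (ψ + θ) = ∫ x, torusLift h x ∂(Measure.pi fun _ : Fin l => AddCircle.haarAddCircle) := by
  have h1 : ∫ θ in Icc (0 : Fin l → ℝ) 1, h (ψ + θ) = ∫ θ in Icc ψ (ψ + 1), h θ := by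
    have := (measurePreserving_add_left volume ψ).setIntegral_preimage_emb
      (MeasurableEquiv.addLeft ψ).measurableEmbedding h (Icc ψ (ψ + 1))
    rw [← this]
    simp
  rw [h1]
  have h2 := UnitAddTorus.integral_preimage (torusLift h) ψ
  simp_rw [torusLift_coe hper] at h2
  refine Eq.trans ?_ h2.symm
  have : {x : Fin l → ℝ | ∀ i, x i ∈ Ioc (ψ i) (ψ i + 1)} =
      univ.pi fun i => Ioc (ψ i) (ψ i + 1) := by ext; simp
  rw [this]
  exact setIntegral_congr_set (Measure.univ_pi_Ioc_ae_eq_Icc (f := ψ) (g := ψ + 1)).symm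

theorem setIntegral_Icc_comp_add_eq {F : Type*} [NormedAddCommGroup F] [NormedSpace ℝ F]
    {h : (Fin l → ℝ) → F} (hper : ∀ (k : Fin l → ℤ) θ, h (θ + intVec k) = h θ) (ψ : Fin l → ℝ) :
    ∫ θ in Icc (0 : Fin l → ℝ) 1, h (ψ + θ) = ∫ θ in Icc (0 : Fin l → ℝ) 1, h θ := by
  rw [setIntegral_Icc_comp_add hper, ← setIntegral_Icc_comp_add hper 0]
  simp

theorem hasSum_fourier_of_summable {h : (Fin l → ℝ) → ℂ} (hc : Continuous h)
    (hper : ∀ (k : Fin l → ℤ) θ, h (θ + intVec k) = h θ)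
    (hs : Summable fun m : Fin l → ℤ => ∫ θ in Icc (0 : Fin l → ℝ) 1, angleChar (-m) θ * h θ)
    (ψ : Fin l → ℝ) :
    HasSum (fun m : Fin l → ℤ =>
      (∫ θ in Icc (0 : Fin l → ℝ) 1, angleChar (-m) θ * h θ) * angleChar m ψ) (h ψ) := by
  let H : C(UnitAddTorus (Fin l), ℂ) := ⟨torusLift h, continuous_torusLift hc hper⟩
  have hcoef (m : Fin l → ℤ) : UnitAddTorus.mFourierCoeff H m =
      ∫ θ in Icc (0 : Fin l → ℝ) 1, angleChar (-m) θ * h θ := by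
    have hp (k : Fin l → ℤ) (θ : Fin l → ℝ) :
        angleChar (-m) (θ + intVec k) * h (θ + intVec k) = angleChar (-m) θ * h θ := by
      rw [angleChar_add, angleChar_intVec, hper, mul_one]
    rw [UnitAddTorus.mFourierCoeff_eq_integral _ _ 0]
    have : {x : Fin l → ℝ | ∀ i, x i ∈ Ioc ((0 : Fin l → ℝ) i) ((0 : Fin l → ℝ) i + 1)} =
        univ.pi fun i => Ioc ((0 : Fin l → ℝ) i) ((1 : Fin l → ℝ) i) := by ext; simp
    rw [this]
    refine (setIntegral_congr_set
      (Measure.univ_pi_Ioc_ae_eq_Icc (f := (0 : Fin l → ℝ)) (g := 1))).trans ?_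
    refine integral_congr_ae (Eventually.of_forall fun θ => ?_)
    simp only [mFourier_coe, smul_eq_mul]
    congr 1
    exact torusLift_coe hper θ
  have hs' : Summable (UnitAddTorus.mFourierCoeff H) := by
    convert hs using 1
    ext m
    exact hcoef m
  have := UnitAddTorus.hasSum_mFourier_series_apply_of_summable hs' (fun i => (ψ i : UnitAddCircle))
  have hψ : H (fun i => (ψ i : UnitAddCircle)) = h ψ := torusLift_coe hper ψ
  rw [hψ] at this
  simpa only [hcoef, mFourier_coe, smul_eq_mul] using this

theorem summable_norm_int_rpow (r : ℝ) (hr : r < -l) :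
    Summable fun m : Fin l → ℤ => ‖m‖ ^ r := by
  let L := Submodule.span ℤ (range (Pi.basisFun ℝ (Fin l)))
  have hrank : Module.finrank ℤ L = l := by
    rw [ZLattice.rank ℝ L]
    simp
  have h := ZLattice.summable_norm_rpow L r (by rwa [hrank])
  have hmem (m : Fin l → ℤ) : (intVec m : Fin l → ℝ) ∈ L := by
    have : (intVec m : Fin l → ℝ) = ∑ i, m i • Pi.basisFun ℝ (Fin l) i := by
      ext k
      simp [intVec, Finset.sum_apply, Pi.single_apply]
    rw [this]
    exact Submodule.sum_mem _ fun i _ => Submodule.smul_mem _ _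
      (Submodule.subset_span (mem_range_self i))
  have hinj : Function.Injective fun m : Fin l → ℤ => (⟨intVec m, hmem m⟩ : L) := by
    intro m m' h
    ext i
    have := congrFun (congrArg Subtype.val h) i
    simpa [intVec] using this
  refine (h.comp_injective hinj).congr fun m => ?_
  have : ‖(intVec m : Fin l → ℝ)‖ = ‖m‖ := by
    simp only [Pi.norm_def]
    congr 2
  simp [this]

end TorusFourier

/-! ### Derivatives in the angles. -/

section AngleDerivative

variable {l j : ℕ} {E : Type*} [NormedAddCommGroup E] [NormedSpace ℝ E]

theorem isOpen_strip {M : Set (Fin j → ℝ)} (hM : IsOpen M) : IsOpen (strip l M) :=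
  isOpen_univ.prod hM

theorem mk_mem_strip {M : Set (Fin j → ℝ)} {θ : Fin l → ℝ} {J : Fin j → ℝ} :
    (θ, J) ∈ strip l M ↔ J ∈ M := by
  simp [strip]

theorem mem_strip {M : Set (Fin j → ℝ)} {x : Phase l j} : x ∈ strip l M ↔ x.2 ∈ M := by
  simp [strip]

/-- Differentiation in the `i`-th angle. -/
noncomputable def angleDeriv (i : Fin l) (u : Phase l j → E) (x : Phase l j) : E :=
  fderiv ℝ u x (Pi.single i 1, 0)

theorem analyticOnNhd_angleDeriv [CompleteSpace E] (i : Fin l) {u : Phase l j → E}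
    {D : Set (Phase l j)} (hu : AnalyticOnNhd ℝ u D) : AnalyticOnNhd ℝ (angleDeriv i u) D :=
  fun x hx => (ContinuousLinearMap.apply ℝ E ((Pi.single i 1, 0) : Phase l j)).analyticAt _ |>.comp
    (hu x hx).fderiv

theorem AnglePeriodicOn.fderiv {u : Phase l j → E} {M : Set (Fin j → ℝ)} (hM : IsOpen M)
    (hu : AnglePeriodicOn u M) : AnglePeriodicOn (fderiv ℝ u) M := by
  intro k θ J hJ
  have h1 : (fun x : Phase l j => u (x + (intVec k, 0))) =ᶠ[𝓝 (θ, J)] u := by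
    filter_upwards [(isOpen_strip hM).mem_nhds (mk_mem_strip.2 hJ)] with x hx
    have := hu k x.1 x.2 (mem_strip.1 hx)
    simpa [Prod.add_def] using this
  have h2 := h1.fderiv_eq (𝕜 := ℝ)
  rw [fderiv_comp_add_right] at h2
  simpa [Prod.add_def] using h2

theorem AnglePeriodicOn.angleDeriv {u : Phase l j → E} {M : Set (Fin j → ℝ)} (hM : IsOpen M)
    (hu : AnglePeriodicOn u M) (i : Fin l) : AnglePeriodicOn (angleDeriv i u) M := by
  intro k θ J hJ
  simp only [Decoupling.angleDeriv, hu.fderiv hM k θ J hJ]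

/-- The elliptic operator `∑ i, ∂_{θ_i} ^ (2 p)`. -/
noncomputable def angleLaplace (p : ℕ) (u : Phase l j → E) (x : Phase l j) : E :=
  ∑ i : Fin l, (angleDeriv i)^[2 * p] u x

theorem analyticOnNhd_iterate_angleDeriv [CompleteSpace E] (i : Fin l) {u : Phase l j → E}
    {D : Set (Phase l j)} (hu : AnalyticOnNhd ℝ u D) (k : ℕ) :
    AnalyticOnNhd ℝ ((angleDeriv i)^[k] u) D := by
  induction k with
  | zero => exact hu
  | succ k ih => rw [Function.iterate_succ_apply']; exact analyticOnNhd_angleDeriv i ih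

theorem AnglePeriodicOn.iterate_angleDeriv {u : Phase l j → E} {M : Set (Fin j → ℝ)}
    (hM : IsOpen M) (hu : AnglePeriodicOn u M) (i : Fin l) (k : ℕ) :
    AnglePeriodicOn ((Decoupling.angleDeriv i)^[k] u) M := by
  induction k with
  | zero => exact hu
  | succ k ih => rw [Function.iterate_succ_apply']; exact ih.angleDeriv hM i

theorem analyticOnNhd_angleLaplace [CompleteSpace E] (p : ℕ) {u : Phase l j → E}
    {D : Set (Phase l j)} (hu : AnalyticOnNhd ℝ u D) : AnalyticOnNhd ℝ (angleLaplace p u) D :=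
  Finset.analyticOnNhd_fun_sum _ fun i _ => analyticOnNhd_iterate_angleDeriv i hu _

theorem AnglePeriodicOn.angleLaplace {u : Phase l j → E} {M : Set (Fin j → ℝ)}
    (hM : IsOpen M) (hu : AnglePeriodicOn u M) (p : ℕ) : AnglePeriodicOn (angleLaplace p u) M := by
  intro k θ J hJ
  exact Finset.sum_congr rfl fun i _ => hu.iterate_angleDeriv hM i _ k θ J hJ

end AngleDerivative

/-! ### Weighted averages of angle translates. -/

section AngleConvolution

variable {l j : ℕ} {E : Type*} [NormedAddCommGroup E] [NormedSpace ℝ E] [CompleteSpace E]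

/-- The average of the angle translates of `u` with weight `g`. -/
noncomputable def angleConv (g : (Fin l → ℝ) → ℝ) (u : Phase l j → E) (x : Phase l j) : E :=
  ∫ θ in Icc (0 : Fin l → ℝ) 1, g θ • u (x.1 + θ, x.2)

omit [CompleteSpace E] in
theorem analyticAt_angleTranslate {u : Phase l j → E} {M : Set (Fin j → ℝ)}
    (hu : AnalyticOnNhd ℝ u (strip l M)) {x : Phase l j} (hx : x ∈ strip l M) (θ : Fin l → ℝ) :
    AnalyticAt ℝ (fun q : Phase l j × (Fin l → ℝ) => u (q.1.1 + q.2, q.1.2)) (x, θ) := by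
  have h1 : AnalyticAt ℝ (fun q : Phase l j × (Fin l → ℝ) => (q.1.1 + q.2, q.1.2)) (x, θ) :=
    ((analyticAt_fst.fun_comp_of_eq analyticAt_fst rfl).add analyticAt_snd).prod
      (analyticAt_snd.fun_comp_of_eq analyticAt_fst rfl)
  exact (hu (x.1 + θ, x.2) (mk_mem_strip.2 (mem_strip.1 hx))).fun_comp_of_eq h1 rfl

theorem analyticOnNhd_angleConv {g : (Fin l → ℝ) → ℝ} (hg : Continuous g) {u : Phase l j → E}
    {M : Set (Fin j → ℝ)} (hu : AnalyticOnNhd ℝ u (strip l M)) :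
    AnalyticOnNhd ℝ (angleConv g u) (strip l M) := fun _ hx =>
  analyticAt_setIntegral_smul (f := fun q : Phase l j × (Fin l → ℝ) => u (q.1.1 + q.2, q.1.2))
    isCompact_Icc (fun θ _ => analyticAt_angleTranslate hu hx θ)
    (hg.continuousOn.integrableOn_compact isCompact_Icc)

theorem hasFDerivAt_angleConv {g : (Fin l → ℝ) → ℝ} (hg : Continuous g) {u : Phase l j → E}
    {M : Set (Fin j → ℝ)} (hu : AnalyticOnNhd ℝ u (strip l M)) {x : Phase l j}
    (hx : x ∈ strip l M) : HasFDerivAt (angleConv g u) (angleConv g (fderiv ℝ u) x) x := by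
  have h := hasFDerivAt_setIntegral_smul (ν := volume)
    (f := fun q : Phase l j × (Fin l → ℝ) => u (q.1.1 + q.2, q.1.2)) (x₀ := x)
    (isCompact_Icc (a := (0 : Fin l → ℝ)) (b := 1))
    (fun θ _ => analyticAt_angleTranslate hu hx θ)
    (hg.continuousOn.integrableOn_compact isCompact_Icc)
  refine h.congr_fderiv (setIntegral_congr_fun measurableSet_Icc fun θ _ => ?_)
  congr 1
  have h1 := HasFDerivAt.comp x
    (analyticAt_angleTranslate hu hx θ).differentiableAt.hasFDerivAt
    (hasFDerivAt_prodMk_left (𝕜 := ℝ) x θ)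
  have h2 : HasFDerivAt (fun x : Phase l j => u (x + (θ, 0))) (fderiv ℝ u (x + (θ, 0))) x := by
    have hd := (hu (x + (θ, 0)) (mem_strip.2 (by simpa using mem_strip.1 hx))).differentiableAt
    simpa [Function.comp_def] using
      hd.hasFDerivAt.comp x ((hasFDerivAt_id x).add_const (θ, (0 : Fin j → ℝ)))
  have h3 : (fun x : Phase l j => u (x + (θ, 0))) = fun x : Phase l j => u (x.1 + θ, x.2) := by
    ext x
    simp [Prod.add_def]
  rw [h3] at h2
  exact (h1.unique h2).trans (by simp [Prod.add_def])

omit [CompleteSpace E] in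
theorem AnglePeriodicOn.angleConv {u : Phase l j → E} {M : Set (Fin j → ℝ)}
    (hu : AnglePeriodicOn u M) (g : (Fin l → ℝ) → ℝ) : AnglePeriodicOn (angleConv g u) M := by
  intro k θ J hJ
  refine integral_congr_ae (Eventually.of_forall fun τ => ?_)
  simp only
  rw [add_right_comm, hu k _ J hJ]

omit [CompleteSpace E] in
theorem integrableOn_angleConv {g : (Fin l → ℝ) → ℝ} (hg : Continuous g) {u : Phase l j → E}
    {M : Set (Fin j → ℝ)} (hu : ContinuousOn u (strip l M)) {x : Phase l j}
    (hx : x ∈ strip l M) :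
    IntegrableOn (fun θ => g θ • u (x.1 + θ, x.2)) (Icc (0 : Fin l → ℝ) 1) := by
  refine ContinuousOn.integrableOn_compact isCompact_Icc (hg.continuousOn.smul ?_)
  exact hu.comp (by fun_prop) fun θ _ => mk_mem_strip.2 (mem_strip.1 hx)

theorem map_angleConv {F : Type*} [NormedAddCommGroup F] [NormedSpace ℝ F] [CompleteSpace F]
    (L : E →L[ℝ] F) {g : (Fin l → ℝ) → ℝ} (hg : Continuous g) {u : Phase l j → E}
    {M : Set (Fin j → ℝ)} (hu : ContinuousOn u (strip l M)) {x : Phase l j}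
    (hx : x ∈ strip l M) : L (angleConv g u x) = angleConv g (fun x => L (u x)) x := by
  rw [angleConv, ← L.integral_comp_comm (integrableOn_angleConv hg hu hx)]
  simp [angleConv]

/-- The trace of a continuous endomorphism, as a continuous linear functional. -/
noncomputable def traceCLM (E : Type*) [NormedAddCommGroup E] [NormedSpace ℝ E]
    [FiniteDimensional ℝ E] : (E →L[ℝ] E) →L[ℝ] ℝ :=
  ((LinearMap.trace ℝ E).comp (ContinuousLinearMap.coeLM ℝ)).toContinuousLinearMap

theorem traceCLM_apply {E : Type*} [NormedAddCommGroup E] [NormedSpace ℝ E]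
    [FiniteDimensional ℝ E] (A : E →L[ℝ] E) :
    traceCLM E A = LinearMap.trace ℝ E (A : E →ₗ[ℝ] E) := rfl

theorem divergence_eq (u : Phase l j → Phase l j) (x : Phase l j) :
    divergence u x = traceCLM _ (fderiv ℝ u x) := rfl

theorem divergence_angleConv {g : (Fin l → ℝ) → ℝ} (hg : Continuous g)
    {u : Phase l j → Phase l j} {M : Set (Fin j → ℝ)} (hu : AnalyticOnNhd ℝ u (strip l M))
    {x : Phase l j} (hx : x ∈ strip l M) :
    divergence (angleConv g u) x = angleConv g (divergence u) x := by
  rw [divergence_eq, (hasFDerivAt_angleConv hg hu hx).fderiv,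
    map_angleConv _ hg hu.fderiv.continuousOn hx]
  rfl

/-- Symmetry of the second derivative: a directional derivative commutes with the trace of the first
derivative. -/
theorem divergence_angleDeriv (i : Fin l) {u : Phase l j → Phase l j} {x : Phase l j}
    (hu : AnalyticAt ℝ u x) : divergence (angleDeriv i u) x = angleDeriv i (divergence u) x := by
  have h2 : HasFDerivAt (fderiv ℝ u) (fderiv ℝ (fderiv ℝ u) x) x :=
    hu.fderiv.differentiableAt.hasFDerivAt
  have hsymm : IsSymmSndFDerivAt ℝ u x := ContDiffAt.isSymmSndFDerivAt_of_omega
    (AnalyticAt.contDiffAt (n := ω) hu)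
  have h3 : HasFDerivAt (angleDeriv i u)
      ((ContinuousLinearMap.apply ℝ (Phase l j) ((Pi.single i 1, 0) : Phase l j)).comp
        (fderiv ℝ (fderiv ℝ u) x)) x :=
    (ContinuousLinearMap.apply ℝ (Phase l j) ((Pi.single i 1, 0) : Phase l j)).hasFDerivAt.comp x h2
  have h4 : HasFDerivAt (divergence u) ((traceCLM _).comp (fderiv ℝ (fderiv ℝ u) x)) x :=
    (traceCLM (Phase l j)).hasFDerivAt.comp x h2
  rw [divergence_eq, h3.fderiv, angleDeriv, h4.fderiv, ContinuousLinearMap.comp_apply]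
  exact congrArg _ (ContinuousLinearMap.ext fun v => hsymm v _)

theorem divergence_iterate_angleDeriv (i : Fin l) {u : Phase l j → Phase l j}
    {M : Set (Fin j → ℝ)} (hM : IsOpen M) (hu : AnalyticOnNhd ℝ u (strip l M))
    (hdiv : ∀ x ∈ strip l M, divergence u x = 0) (k : ℕ) :
    ∀ x ∈ strip l M, divergence ((angleDeriv i)^[k] u) x = 0 := by
  induction k with
  | zero => exact hdiv
  | succ k ih =>
    intro x hx
    rw [Function.iterate_succ_apply',
      divergence_angleDeriv i (analyticOnNhd_iterate_angleDeriv i hu k x hx), angleDeriv]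
    have : divergence ((angleDeriv i)^[k] u) =ᶠ[𝓝 x] fun _ => 0 := by
      filter_upwards [(isOpen_strip hM).mem_nhds hx] with y hy using ih y hy
    rw [this.fderiv_eq]
    simp

theorem divergence_angleLaplace {u : Phase l j → Phase l j}
    {M : Set (Fin j → ℝ)} (hM : IsOpen M) (hu : AnalyticOnNhd ℝ u (strip l M))
    (hdiv : ∀ x ∈ strip l M, divergence u x = 0) (p : ℕ) {x : Phase l j} (hx : x ∈ strip l M) :
    divergence (angleLaplace p u) x = 0 := by
  have h : HasFDerivAt (angleLaplace p u)
      (∑ i : Fin l, fderiv ℝ ((angleDeriv i)^[2 * p] u) x) x :=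
    HasFDerivAt.fun_sum fun i _ =>
      (analyticOnNhd_iterate_angleDeriv i hu _ x hx).differentiableAt.hasFDerivAt
  rw [divergence_eq, h.fderiv, map_sum]
  exact Finset.sum_eq_zero fun i _ => divergence_iterate_angleDeriv i hM hu hdiv _ x hx

omit [CompleteSpace E] in
theorem angleAverage_eq (G : Phase l j × ℝ → E) (J : Fin j → ℝ) :
    angleAverage G J = angleConv (fun _ => 1) (fun x => G (x, 0)) ((0 : Fin l → ℝ), J) := by
  simp [angleAverage, angleConv]

end AngleConvolution

/-! ### Fourier coefficients in the angles. -/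

section FourierCoefficients

variable {l j : ℕ} {E : Type*} [NormedAddCommGroup E] [NormedSpace ℝ E]

/-- The Fourier coefficients in the angles of the component `L ∘ u` at the slow variable `J`. -/
noncomputable def angleCoeff (L : E →L[ℝ] ℝ) (u : Phase l j → E) (J : Fin j → ℝ)
    (m : Fin l → ℤ) : ℂ :=
  ∫ θ in Icc (0 : Fin l → ℝ) 1, angleChar (-m) θ * (L (u (θ, J)) : ℂ)

theorem angleCoeff_translate (L : E →L[ℝ] ℝ) {u : Phase l j → E} {M : Set (Fin j → ℝ)}
    (hu : AnglePeriodicOn u M) {J : Fin j → ℝ} (hJ : J ∈ M) (m : Fin l → ℤ) (ψ : Fin l → ℝ) :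
    ∫ θ in Icc (0 : Fin l → ℝ) 1, angleChar (-m) θ * (L (u (ψ + θ, J)) : ℂ) =
      angleChar m ψ * angleCoeff L u J m := by
  have h := setIntegral_Icc_comp_add_eq
    (h := fun θ : Fin l → ℝ => angleChar (-m) θ * (L (u (θ, J)) : ℂ))
    (fun k θ => by simp only [angleChar_add, angleChar_intVec, mul_one, hu k θ J hJ]) ψ
  rw [angleCoeff, ← h, ← integral_const_mul]
  refine integral_congr_ae (Eventually.of_forall fun θ => ?_)
  simp only
  rw [angleChar_add, angleChar_neg_left m ψ, ← mul_assoc, ← mul_assoc, ← angleChar_add,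
    add_neg_cancel, angleChar_zero_right, one_mul]

theorem continuousOn_component (L : E →L[ℝ] ℝ) {u : Phase l j → E} {M : Set (Fin j → ℝ)}
    (hu : ContinuousOn u (strip l M)) {J : Fin j → ℝ} (hJ : J ∈ M) (ψ : Fin l → ℝ) :
    Continuous fun θ : Fin l → ℝ => (L (u (ψ + θ, J)) : ℂ) := by
  have : Continuous fun θ : Fin l → ℝ => u (ψ + θ, J) :=
    hu.comp_continuous (by fun_prop) fun θ => mk_mem_strip.2 hJ
  exact Complex.continuous_ofReal.comp (L.continuous.comp this)

/-- In place of integration by parts, the translate of u by t in the i-th angle is considered: its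
coefficient is angleChar m (t e_i) times that of u, and both sides are differentiated at t = 0. -/
theorem angleCoeff_angleDeriv [CompleteSpace E] (L : E →L[ℝ] ℝ) {u : Phase l j → E}
    {M : Set (Fin j → ℝ)} (hu : AnalyticOnNhd ℝ u (strip l M)) (hper : AnglePeriodicOn u M)
    {J : Fin j → ℝ} (hJ : J ∈ M) (m : Fin l → ℤ) (i : Fin l) :
    angleCoeff L (angleDeriv i u) J m =
      (2 * Real.pi * Complex.I * m i) * angleCoeff L u J m := by
  let v : Phase l j := (Pi.single i 1, 0)
  have hline (t : ℝ) (θ : Fin l → ℝ) : ((t • Pi.single i 1 + θ : Fin l → ℝ), J) = t • v + (θ, J) := by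
    simp [v]
  have hchar : AnalyticOnNhd ℝ (fun θ : Fin l → ℝ => angleChar (-m) θ) univ := by
    have hlin : AnalyticOnNhd ℝ (fun θ : Fin l → ℝ =>
        2 * Real.pi * Complex.I * ∑ i, ((-m) i : ℂ) * (θ i : ℂ)) univ := by
      have : (fun θ : Fin l → ℝ => 2 * Real.pi * Complex.I * ∑ i, ((-m) i : ℂ) * (θ i : ℂ)) =
          ⇑(∑ i, (2 * Real.pi * Complex.I * ((-m) i : ℂ)) •
            (Complex.ofRealCLM.comp (ContinuousLinearMap.proj (R := ℝ) (φ := fun _ : Fin l => ℝ) i))) := by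
        ext θ
        simp [Finset.mul_sum, mul_assoc]
      rw [this]
      exact ContinuousLinearMap.analyticOnNhd _ _
    exact fun θ _ => (analyticAt_cexp.restrictScalars (𝕜 := ℝ)).comp (hlin θ trivial)
  have han (θ : Fin l → ℝ) : AnalyticAt ℝ (fun q : ℝ × (Fin l → ℝ) =>
      angleChar (-m) q.2 * (L (u (q.1 • v + (q.2, J))) : ℂ)) (0, θ) := by
    have h1 : AnalyticAt ℝ (fun q : ℝ × (Fin l → ℝ) => q.1 • v + (q.2, J)) (0, θ) :=
      (analyticAt_fst.smul analyticAt_const).add (analyticAt_snd.prod analyticAt_const)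
    have h2 : AnalyticAt ℝ (fun x => (L (u x) : ℂ)) (θ, J) :=
      ((Complex.ofRealCLM.comp L).analyticAt _).comp (hu (θ, J) (mk_mem_strip.2 hJ))
    exact ((hchar θ trivial).fun_comp_of_eq analyticAt_snd rfl).mul
      (h2.fun_comp_of_eq h1 (by simp))
  have h1 := hasDerivAt_setIntegral_smul (ν := volume) (t₀ := (0 : ℝ))
    (isCompact_Icc (a := (0 : Fin l → ℝ)) (b := 1)) (fun θ _ => han θ) (g := fun _ => 1)
    (continuousOn_const.integrableOn_compact isCompact_Icc)
    (f' := fun θ => angleChar (-m) θ * (L (angleDeriv i u (θ, J)) : ℂ)) (fun θ _ => by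
      have hd : HasFDerivAt (fun x => (L (u x) : ℂ))
          ((Complex.ofRealCLM.comp L).comp (fderiv ℝ u (θ, J))) ((0 : ℝ) • v + (θ, J)) := by
        rw [zero_smul, zero_add]
        exact (Complex.ofRealCLM.comp L).hasFDerivAt.comp _
          (hu (θ, J) (mk_mem_strip.2 hJ)).differentiableAt.hasFDerivAt
      have := hd.comp_hasDerivAt (0 : ℝ)
        (((hasDerivAt_id (0 : ℝ)).smul_const v).add_const (θ, J))
      simpa [angleDeriv, v, Function.comp_def] using this.const_mul (angleChar (-m) θ))
  simp only [one_smul] at h1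
  have h2 : HasDerivAt (fun t : ℝ => angleChar m (t • Pi.single i 1) * angleCoeff L u J m)
      ((2 * Real.pi * Complex.I * m i) * angleCoeff L u J m) 0 := by
    refine HasDerivAt.mul_const ?_ _
    have : (fun t : ℝ => angleChar m (t • Pi.single i 1)) =
        fun t : ℝ => Complex.exp (2 * Real.pi * Complex.I * m i * (t : ℂ)) := by
      ext t
      rw [angleChar]
      congr 1
      rw [Finset.sum_eq_single i]
      · simp [mul_assoc]
      · intro b _ hb
        simp [hb]
      · simp
    rw [this]
    have h := ((Complex.ofRealCLM.hasDerivAt (x := (0 : ℝ))).const_mul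
      (2 * Real.pi * Complex.I * m i)).cexp
    simpa using h
  have h3 : (fun t : ℝ => angleChar m (t • Pi.single i 1) * angleCoeff L u J m) =
      fun t : ℝ => ∫ θ in Icc (0 : Fin l → ℝ) 1,
        angleChar (-m) θ * (L (u (t • v + (θ, J))) : ℂ) := by
    ext t
    rw [← angleCoeff_translate L hper hJ]
    simp_rw [hline]
  rw [h3] at h2
  exact h1.unique h2

end FourierCoefficients

end Decoupling

namespace Decoupling

open Filter Topology Asymptotics
open scoped ENNReal NNReal

/-! ### Small divisors and the homological equation. -/

section Homological

variable {l j : ℕ} {E : Type*} [NormedAddCommGroup E] [NormedSpace ℝ E] [CompleteSpace E]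

theorem angleCoeff_iterate_angleDeriv (L : E →L[ℝ] ℝ) {u : Phase l j → E}
    {M : Set (Fin j → ℝ)} (hM : IsOpen M) (hu : AnalyticOnNhd ℝ u (strip l M))
    (hper : AnglePeriodicOn u M) {J : Fin j → ℝ} (hJ : J ∈ M) (m : Fin l → ℤ) (i : Fin l) (k : ℕ) :
    angleCoeff L ((angleDeriv i)^[k] u) J m =
      (2 * Real.pi * Complex.I * m i) ^ k * angleCoeff L u J m := by
  induction k with
  | zero => simp
  | succ k ih =>
    rw [Function.iterate_succ_apply', angleCoeff_angleDeriv L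
      (analyticOnNhd_iterate_angleDeriv i hu k) (hper.iterate_angleDeriv hM i k) hJ, ih]
    ring

/-- The symbol of `angleLaplace p`. -/
noncomputable def angleSymbol (p : ℕ) (m : Fin l → ℤ) : ℂ :=
  ∑ i, (2 * Real.pi * Complex.I * m i) ^ (2 * p)

/-- All terms of the symbol share the factor (2πi)^{2p}, and even powers of integers are
nonnegative, so nothing cancels and the largest |m_i| alone gives the bound. -/
theorem norm_pow_le_norm_angleSymbol (p : ℕ) {m : Fin l → ℤ} (hm : m ≠ 0) :
    ‖m‖ ^ (2 * p) ≤ ‖angleSymbol p m‖ := by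
  have h1 : angleSymbol p m = (2 * Real.pi * Complex.I) ^ (2 * p) *
      ((∑ i, (m i : ℝ) ^ (2 * p) : ℝ) : ℂ) := by
    rw [angleSymbol]
    push_cast
    rw [Finset.mul_sum]
    exact Finset.sum_congr rfl fun i _ => mul_pow _ _ _
  have hnn (i : Fin l) : 0 ≤ (m i : ℝ) ^ (2 * p) := by rw [pow_mul]; positivity
  have h2 : ‖m‖ ^ (2 * p) ≤ ∑ i, (m i : ℝ) ^ (2 * p) := by
    have hne : Nonempty (Fin l) := by
      by_contra h
      rw [not_nonempty_iff] at h
      exact hm (Subsingleton.elim _ _)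
    obtain ⟨i, hmax⟩ := Finite.exists_max fun i => ‖m i‖
    have hi : ‖m i‖ = ‖m‖ :=
      le_antisymm (norm_le_pi_norm m i) ((pi_norm_le_iff_of_nonneg (norm_nonneg _)).2 hmax)
    rw [← hi]
    have h3 : ‖m i‖ ^ (2 * p) = (m i : ℝ) ^ (2 * p) := by
      rw [Int.norm_eq_abs, pow_mul, sq_abs, ← pow_mul]
    rw [h3]
    exact Finset.single_le_sum (fun i _ => hnn i) (Finset.mem_univ i)
  rw [h1, norm_mul, Complex.norm_real, Real.norm_of_nonneg (Finset.sum_nonneg fun i _ => hnn i)]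
  refine h2.trans (le_mul_of_one_le_left (Finset.sum_nonneg fun i _ => hnn i) ?_)
  rw [norm_pow]
  refine one_le_pow₀ ?_
  simp only [norm_mul, Complex.norm_I, mul_one, Complex.norm_real, Complex.norm_ofNat,
    Real.norm_of_nonneg Real.pi_pos.le]
  linarith [Real.pi_gt_three]

omit [CompleteSpace E] in
theorem integrableOn_angleChar_mul (L : E →L[ℝ] ℝ) {u : Phase l j → E} {M : Set (Fin j → ℝ)}
    (hu : ContinuousOn u (strip l M)) {J : Fin j → ℝ} (hJ : J ∈ M) (m : Fin l → ℤ)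
    (ψ : Fin l → ℝ) :
    IntegrableOn (fun θ => angleChar m θ * (L (u (ψ + θ, J)) : ℂ)) (Icc (0 : Fin l → ℝ) 1) :=
  ((continuous_angleChar m).mul
    (continuousOn_component L hu hJ ψ)).continuousOn.integrableOn_compact isCompact_Icc

theorem angleCoeff_angleLaplace (L : E →L[ℝ] ℝ) {u : Phase l j → E}
    {M : Set (Fin j → ℝ)} (hM : IsOpen M) (hu : AnalyticOnNhd ℝ u (strip l M))
    (hper : AnglePeriodicOn u M) {J : Fin j → ℝ} (hJ : J ∈ M) (m : Fin l → ℤ) (p : ℕ) :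
    angleCoeff L (angleLaplace p u) J m = angleSymbol p m * angleCoeff L u J m := by
  have h1 : angleCoeff L (angleLaplace p u) J m =
      ∑ i, angleCoeff L ((angleDeriv i)^[2 * p] u) J m := by
    simp only [angleCoeff]
    rw [← integral_finsetSum]
    · simp [angleLaplace, Finset.mul_sum]
    · intro i _
      have := integrableOn_angleChar_mul L
        (analyticOnNhd_iterate_angleDeriv i hu (2 * p)).continuousOn hJ (-m) 0
      simpa [IntegrableOn] using this
  rw [h1, angleSymbol, Finset.sum_mul]
  exact Finset.sum_congr rfl fun i _ => angleCoeff_iterate_angleDeriv L hM hu hper hJ m i _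

omit [CompleteSpace E] in
theorem exists_norm_angleCoeff_le (L : E →L[ℝ] ℝ) (u : Phase l j → E) (J : Fin j → ℝ) :
    ∃ C, ∀ m : Fin l → ℤ, ‖angleCoeff L u J m‖ ≤ C := by
  refine ⟨∫ θ in Icc (0 : Fin l → ℝ) 1, ‖(L (u (θ, J)) : ℂ)‖, fun m => ?_⟩
  refine (norm_integral_le_integral_norm _).trans (le_of_eq ?_)
  simp [norm_angleChar]

/-- The symbol of `angleLaplace (l + 1)` gains 2(l + 1) powers of |m|, more than the l required for
summability over ℤ^l. -/
theorem summable_angleCoeff (L : E →L[ℝ] ℝ) {u : Phase l j → E}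
    {M : Set (Fin j → ℝ)} (hM : IsOpen M) (hu : AnalyticOnNhd ℝ u (strip l M))
    (hper : AnglePeriodicOn u M) {J : Fin j → ℝ} (hJ : J ∈ M) :
    Summable fun m : Fin l → ℤ => angleCoeff L u J m := by
  obtain ⟨C, hC⟩ := exists_norm_angleCoeff_le L (angleLaplace (l + 1) u) J
  have hs := (summable_norm_int_rpow (l := l) (-(2 * (l + 1) : ℕ)) (by push_cast; linarith)).mul_left C
  refine Summable.of_norm_bounded_eventually hs ?_
  filter_upwards [(finite_singleton (0 : Fin l → ℤ)).compl_mem_cofinite] with m hm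
  have hm0 : 0 < ‖m‖ := norm_pos_iff.2 hm
  have h1 := hC m
  rw [angleCoeff_angleLaplace L hM hu hper hJ, norm_mul] at h1
  have h2 := norm_pow_le_norm_angleSymbol (l + 1) (m := m) hm
  rw [Real.rpow_neg hm0.le, Real.rpow_natCast, ← div_eq_mul_inv, le_div_iff₀ (by positivity)]
  calc ‖angleCoeff L u J m‖ * ‖m‖ ^ (2 * (l + 1))
      ≤ ‖angleCoeff L u J m‖ * ‖angleSymbol (l + 1) m‖ := by gcongr
    _ ≤ C := by linarith

/-- Here |e^{2πix} - 1| = 2|sin π(x - round x)|, and Jordan's inequality |sin y| ≥ (2/π)|y| applies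
because |x - round x| ≤ 1/2. -/
theorem four_mul_abs_sub_round_le (x : ℝ) :
    4 * |x - round x| ≤ ‖Complex.exp (2 * Real.pi * Complex.I * x) - 1‖ := by
  have h1 : Complex.exp (2 * Real.pi * Complex.I * x) =
      Complex.exp (Complex.I * ((2 * Real.pi * (x - round x) : ℝ) : ℂ)) := by
    rw [Complex.exp_eq_exp_iff_exists_int]
    refine ⟨round x, ?_⟩
    push_cast
    ring
  rw [h1, Complex.norm_exp_I_mul_ofReal_sub_one, norm_mul, Real.norm_ofNat, Real.norm_eq_abs]
  have h2 := Real.mul_abs_le_abs_sin (x := Real.pi * (x - round x)) (by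
    rw [abs_mul, abs_of_pos Real.pi_pos]
    have := abs_sub_round x
    nlinarith [Real.pi_pos])
  have h3 : 2 / Real.pi * |Real.pi * (x - round x)| = 2 * |x - round x| := by
    rw [abs_mul, abs_of_pos Real.pi_pos]
    field_simp
  rw [h3] at h2
  have h4 : 2 * Real.pi * (x - round x) / 2 = Real.pi * (x - round x) := by ring
  rw [h4]
  linarith

theorem IsDiophantine.le_norm_angleChar_sub_one {c μ : ℝ} {ω : Fin l → ℝ}
    (hω : IsDiophantine c μ ω) {m : Fin l → ℤ} (hm : m ≠ 0) :
    4 * (c * ‖m‖ ^ (-μ)) ≤ ‖angleChar m ω - 1‖ := by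
  have h := four_mul_abs_sub_round_le (∑ i, (m i : ℝ) * ω i)
  have h2 := hω m (round (∑ i, (m i : ℝ) * ω i)) hm
  have h3 : angleChar m ω =
      Complex.exp (2 * Real.pi * Complex.I * ((∑ i, (m i : ℝ) * ω i : ℝ) : ℂ)) := by
    rw [angleChar]
    push_cast
    rfl
  rw [h3]
  linarith

open scoped Classical in
/-- The Fourier coefficients of the fundamental solution of the homological equation composed with
`angleLaplace p`. -/
noncomputable def kernelCoeff (p : ℕ) (ω : Fin l → ℝ) (m : Fin l → ℤ) : ℂ :=
  if m = 0 then 0 else (angleSymbol p m * (angleChar m ω - 1))⁻¹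

theorem IsDiophantine.exists_summable_kernelCoeff {c μ : ℝ} (hc : 0 < c) {ω : Fin l → ℝ}
    (hω : IsDiophantine c μ ω) : ∃ p, Summable fun m : Fin l → ℤ => ‖kernelCoeff p ω m‖ := by
  -- The divisor costs |m|^μ and the symbol gains |m|^{2p}; this p makes the exponent μ - 2p less
  -- than -l.
  obtain ⟨p, hp⟩ := exists_nat_gt (|μ| + l)
  have hp' : μ - (2 * p : ℕ) < -l := by
    have := le_abs_self μ
    have : (0 : ℝ) ≤ p := by positivity
    push_cast
    linarith
  refine ⟨p, Summable.of_norm_bounded ((summable_norm_int_rpow _ hp').mul_left (4 * c)⁻¹)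
    fun m => ?_⟩
  rw [norm_norm]
  by_cases hm : m = 0
  · simp only [kernelCoeff, hm, if_true, norm_zero]
    positivity
  · have hm0 : 0 < ‖m‖ := norm_pos_iff.2 hm
    have h1 := norm_pow_le_norm_angleSymbol p hm
    have h2 := hω.le_norm_angleChar_sub_one hm
    simp only [kernelCoeff, hm, if_false, norm_inv, norm_mul]
    have h3 : (4 * c)⁻¹ * ‖m‖ ^ (μ - (2 * p : ℕ)) = (‖m‖ ^ (2 * p) * (4 * (c * ‖m‖ ^ (-μ))))⁻¹ := by
      rw [Real.rpow_sub hm0, Real.rpow_natCast, Real.rpow_neg hm0.le]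
      have : 0 < ‖m‖ ^ μ := Real.rpow_pos_of_pos hm0 μ
      field_simp
    rw [h3]
    have : 0 < ‖m‖ ^ (-μ) := Real.rpow_pos_of_pos hm0 _
    gcongr

theorem IsDiophantine.angleChar_sub_one_ne_zero {c μ : ℝ} (hc : 0 < c) {ω : Fin l → ℝ}
    (hω : IsDiophantine c μ ω) {m : Fin l → ℤ} (hm : m ≠ 0) : angleChar m ω - 1 ≠ 0 := by
  have h := hω.le_norm_angleChar_sub_one hm
  have : 0 < ‖m‖ ^ (-μ) := Real.rpow_pos_of_pos (norm_pos_iff.2 hm) _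
  rw [← norm_pos_iff]
  exact lt_of_lt_of_le (by positivity) h

theorem angleSymbol_ne_zero (p : ℕ) {m : Fin l → ℤ} (hm : m ≠ 0) : angleSymbol p m ≠ 0 := by
  have := norm_pos_iff.2 hm
  rw [← norm_pos_iff]
  exact lt_of_lt_of_le (by positivity) (norm_pow_le_norm_angleSymbol p hm)

/-- The real kernel of the solution operator of the homological equation, after `angleLaplace p`. -/
noncomputable def homologicalKernel (p : ℕ) (ω : Fin l → ℝ) (θ : Fin l → ℝ) : ℝ :=
  (∑' m : Fin l → ℤ, kernelCoeff p ω m * angleChar (-m) θ).re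

theorem norm_kernelCoeff_mul (p : ℕ) (ω : Fin l → ℝ) (m : Fin l → ℤ) (θ : Fin l → ℝ) :
    ‖kernelCoeff p ω m * angleChar (-m) θ‖ = ‖kernelCoeff p ω m‖ := by
  rw [norm_mul, norm_angleChar, mul_one]

theorem continuous_homologicalKernel {p : ℕ} {ω : Fin l → ℝ}
    (hs : Summable fun m : Fin l → ℤ => ‖kernelCoeff p ω m‖) :
    Continuous (homologicalKernel p ω) :=
  Complex.continuous_re.comp (continuous_tsum
    (fun m => continuous_const.mul (continuous_angleChar (-m))) hs
    fun m θ => (norm_kernelCoeff_mul p ω m θ).le)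

/-- Absolute summability of the kernel coefficients permits exchanging sum and integral. Since
`angleConv` translates by +θ, the kernel is written with the characters of -m, which extract the
m-th coefficient. -/
theorem map_angleConv_homologicalKernel {p : ℕ} {ω : Fin l → ℝ}
    (hs : Summable fun m : Fin l → ℤ => ‖kernelCoeff p ω m‖) (L : E →L[ℝ] ℝ)
    {u : Phase l j → E} {M : Set (Fin j → ℝ)}
    (hu : ContinuousOn u (strip l M)) (hper : AnglePeriodicOn u M)
    {J : Fin j → ℝ} (hJ : J ∈ M) (ψ : Fin l → ℝ) :
    ∃ z : ℂ, HasSum (fun m => kernelCoeff p ω m * (angleChar m ψ * angleCoeff L u J m)) z ∧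
      L (angleConv (homologicalKernel p ω) u (ψ, J)) = z.re := by
  have hcont := continuousOn_component L hu hJ ψ
  have hsum := hasSum_integral_of_summable_integral_norm
    (μ := volume.restrict (Icc (0 : Fin l → ℝ) 1))
    (F := fun (m : Fin l → ℤ) θ => kernelCoeff p ω m * angleChar (-m) θ * (L (u (ψ + θ, J)) : ℂ))
    (fun m => ((continuous_const.mul (continuous_angleChar (-m))).mul
      hcont).continuousOn.integrableOn_compact isCompact_Icc) (by
      simp only [norm_mul, norm_angleChar, mul_one]
      simp_rw [integral_const_mul]
      exact hs.mul_right _)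
  have hterm (m : Fin l → ℤ) : ∫ θ in Icc (0 : Fin l → ℝ) 1,
      kernelCoeff p ω m * angleChar (-m) θ * (L (u (ψ + θ, J)) : ℂ) =
      kernelCoeff p ω m * (angleChar m ψ * angleCoeff L u J m) := by
    simp_rw [mul_assoc]
    rw [integral_const_mul, angleCoeff_translate L hper hJ]
  simp_rw [hterm] at hsum
  refine ⟨_, hsum, ?_⟩
  · rw [map_angleConv L (continuous_homologicalKernel hs) hu (mk_mem_strip.2 hJ)]
    have hre := integral_re (𝕜 := ℂ) (μ := volume.restrict (Icc (0 : Fin l → ℝ) 1))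
      (f := fun θ => ∑' m : Fin l → ℤ,
        kernelCoeff p ω m * angleChar (-m) θ * (L (u (ψ + θ, J)) : ℂ)) (by
        simp_rw [tsum_mul_right]
        refine ContinuousOn.integrableOn_compact isCompact_Icc
          (Continuous.continuousOn (Continuous.mul ?_ hcont))
        exact continuous_tsum (fun m => continuous_const.mul (continuous_angleChar (-m))) hs
          fun m θ => (norm_kernelCoeff_mul p ω m θ).le)
    simp only [RCLike.re_to_complex] at hre
    rw [← hre, angleConv]
    refine setIntegral_congr_fun measurableSet_Icc fun θ _ => ?_
    simp only [smul_eq_mul, homologicalKernel]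
    rw [tsum_mul_right, Complex.re_mul_ofReal]

/-- The homological equation is solved by `angleConv (homologicalKernel p ω) (angleLaplace p u)`. -/
theorem homological_equation {c μ : ℝ} (hc : 0 < c) {ω : Fin l → ℝ} (hω : IsDiophantine c μ ω)
    {p : ℕ} (hs : Summable fun m : Fin l → ℤ => ‖kernelCoeff p ω m‖) (L : E →L[ℝ] ℝ)
    {u : Phase l j → E} {M : Set (Fin j → ℝ)} (hM : IsOpen M)
    (hu : AnalyticOnNhd ℝ u (strip l M)) (hper : AnglePeriodicOn u M)
    {J : Fin j → ℝ} (hJ : J ∈ M) (hmean : angleCoeff L u J 0 = 0) (ψ : Fin l → ℝ) :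
    L (angleConv (homologicalKernel p ω) (angleLaplace p u) (ψ + ω, J) -
      angleConv (homologicalKernel p ω) (angleLaplace p u) (ψ, J)) = L (u (ψ, J)) := by
  have hPc := (analyticOnNhd_angleLaplace p hu).continuousOn
  have hPp := hper.angleLaplace hM p
  obtain ⟨z, hz, hLz⟩ := map_angleConv_homologicalKernel hs L hPc hPp hJ (ψ + ω)
  obtain ⟨z', hz', hLz'⟩ := map_angleConv_homologicalKernel hs L hPc hPp hJ ψ
  have hcu : Continuous fun θ : Fin l → ℝ => (L (u (θ, J)) : ℂ) := by
    simpa using continuousOn_component L hu.continuousOn hJ 0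
  have hf := hasSum_fourier_of_summable hcu
    (fun k θ => by rw [hper k θ J hJ]) (summable_angleCoeff L hM hu hper hJ) ψ
  -- The kernel is only the real part of its series, but z - z' is real, so taking real parts of
  -- this identity loses nothing. The coefficient m = 0, set to zero in the kernel, matches the zero
  -- mean of u.
  have key : z - z' = (L (u (ψ, J)) : ℂ) := by
    refine (hz.sub hz').unique (hf.congr_fun fun m => ?_)
    change _ = angleCoeff L u J m * angleChar m ψ
    by_cases hm : m = 0
    · subst hm
      simp [kernelCoeff, hmean]
    · rw [angleCoeff_angleLaplace L hM hu hper hJ, angleChar_add]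
      simp only [kernelCoeff, hm, if_false]
      have h1 := angleSymbol_ne_zero p hm
      have h2 := hω.angleChar_sub_one_ne_zero hc hm
      field_simp
  rw [map_sub, hLz, hLz', ← Complex.sub_re, key, Complex.ofReal_re]

end Homological

/-! ### The oscillating part has zero divergence and zero mean. -/

section OscillatingPart

variable {l j : ℕ}

theorem angleConv_one_add {E : Type*} [NormedAddCommGroup E] [NormedSpace ℝ E]
    {u : Phase l j → E} {M : Set (Fin j → ℝ)} (hper : AnglePeriodicOn u M) {x : Phase l j}
    (hx : x ∈ strip l M) :
    angleConv (fun _ => 1) u x = angleConv (fun _ => 1) u ((0 : Fin l → ℝ), x.2) := by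
  have h (ψ : Fin l → ℝ) := setIntegral_Icc_comp_add_eq (h := fun θ : Fin l → ℝ => u (θ, x.2))
    (fun k θ => hper k θ x.2 (mem_strip.1 hx)) ψ
  simp only [angleConv, one_smul]
  rw [h, h]

theorem setIntegral_Icc_const {E : Type*} [NormedAddCommGroup E] [NormedSpace ℝ E]
    [CompleteSpace E] (c : E) : ∫ _ in Icc (0 : Fin l → ℝ) 1, c = c := by
  simp [Measure.real, Real.volume_Icc_pi]

theorem angleConv_one_of_forall_eq {E : Type*} [NormedAddCommGroup E] [NormedSpace ℝ E]
    [CompleteSpace E] {u : Phase l j → E} {x : Phase l j} {c : E}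
    (h : ∀ θ, u (θ, x.2) = c) : angleConv (fun _ => 1) u x = c := by
  simp only [angleConv, one_smul, h]
  exact setIntegral_Icc_const c

/-- The part of the map that is of order `n`, as a vector field depending on `κ`. -/
def perturbation (F : Phase l j × ℝ → (Fin l → ℝ)) (G : Phase l j × ℝ → (Fin j → ℝ))
    (p : Phase l j × ℝ) : Phase l j := (F p, G p)

/-- The averaged terms, as a vector field on the phase space. -/
def averagedTerm (A : (Fin j → ℝ) → (Fin l → ℝ)) (B : (Fin j → ℝ) → (Fin j → ℝ))
    (x : Phase l j) : Phase l j := (A x.2, B x.2)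

variable {n : ℕ} {ω₀ : Fin l → ℝ} {A : ℕ → (Fin j → ℝ) → (Fin l → ℝ)}
  {B : ℕ → (Fin j → ℝ) → (Fin j → ℝ)} {F : Phase l j × ℝ → (Fin l → ℝ)}
  {G : Phase l j × ℝ → (Fin j → ℝ)} {M : Set (Fin j → ℝ)} {κ₁ : ℝ}

theorem slowFastMap_eq (κ : ℝ) (x : Phase l j) :
    slowFastMap n ω₀ A B F G κ x = x + (ω₀, 0) +
      ∑ i ∈ Finset.Ico 1 n, κ ^ i • averagedTerm (A i) (B i) x +
        κ ^ n • perturbation F G (x, κ) := by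
  ext1 <;> simp [slowFastMap, averagedTerm, perturbation, Prod.fst_sum, Prod.snd_sum]

theorem analyticOnNhd_averagedTerm {A : (Fin j → ℝ) → (Fin l → ℝ)}
    {B : (Fin j → ℝ) → (Fin j → ℝ)} (hA : AnalyticOnNhd ℝ A M) (hB : AnalyticOnNhd ℝ B M) :
    AnalyticOnNhd ℝ (averagedTerm A B) (strip l M) := fun _ hx =>
  ((hA _ (mem_strip.1 hx)).fun_comp_of_eq analyticAt_snd rfl).prod
    ((hB _ (mem_strip.1 hx)).fun_comp_of_eq analyticAt_snd rfl)

theorem fderiv_averagedTerm {A : (Fin j → ℝ) → (Fin l → ℝ)}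
    {B : (Fin j → ℝ) → (Fin j → ℝ)} (hA : AnalyticOnNhd ℝ A M) (hB : AnalyticOnNhd ℝ B M)
    {x : Phase l j} (hx : x ∈ strip l M) :
    fderiv ℝ (averagedTerm A B) x = ((fderiv ℝ A x.2).prod (fderiv ℝ B x.2)).comp (.snd ℝ _ _) :=
  (HasFDerivAt.comp x ((hA _ (mem_strip.1 hx)).differentiableAt.hasFDerivAt.prodMk
    (hB _ (mem_strip.1 hx)).differentiableAt.hasFDerivAt) hasFDerivAt_snd).fderiv

/-- The derivative of the map at x and at y is P κ + κ^n C(·, κ) with a common P → 1. Strict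
differentiability of det at 1 gives 0 = κ^n tr(C x κ - C y κ) + o(κ^n); one divides by κ^n and lets
κ → 0. Strictness matters because both arguments of det move with κ. -/
theorem divergence_eq_of_volumePreserving (hn : 1 ≤ n) (hκ₁ : 0 < κ₁)
    (hA : ∀ i ∈ Finset.Ico 1 n, AnalyticOnNhd ℝ (A i) M)
    (hB : ∀ i ∈ Finset.Ico 1 n, AnalyticOnNhd ℝ (B i) M)
    (hX : AnalyticOnNhd ℝ (perturbation F G) (strip l M ×ˢ Ioo (-κ₁) κ₁))
    (hvol : ∀ κ ∈ Ioo (-κ₁) κ₁,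
      VolumePreservingOn (slowFastMap n ω₀ A B F G κ) (strip l M))
    {x y : Phase l j} (hx : x ∈ strip l M) (hxy : x.2 = y.2) :
    divergence (fun x => perturbation F G (x, 0)) x =
      divergence (fun x => perturbation F G (x, 0)) y := by
  have hy : y ∈ strip l M := mem_strip.2 (hxy ▸ mem_strip.1 hx)
  let P (κ : ℝ) : Phase l j →L[ℝ] Phase l j := 1 + ∑ i ∈ Finset.Ico 1 n,
    κ ^ i • ((fderiv ℝ (A i) x.2).prod (fderiv ℝ (B i) x.2)).comp (.snd ℝ _ _)
  let C (z : Phase l j) (κ : ℝ) : Phase l j →L[ℝ] Phase l j :=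
    (fderiv ℝ (perturbation F G) (z, κ)).comp (.inl ℝ _ _)
  have h0 : (0 : ℝ) ∈ Ioo (-κ₁) κ₁ := by simpa
  have hC (z) (hz : z ∈ strip l M) (κ) (hκ : κ ∈ Ioo (-κ₁) κ₁) :
      HasFDerivAt (fun z => perturbation F G (z, κ)) (C z κ) z :=
    (hX _ ⟨hz, hκ⟩).differentiableAt.hasFDerivAt.comp z (hasFDerivAt_prodMk_left z κ)
  have hCc (z) (hz : z ∈ strip l M) : ContinuousAt (C z) 0 := by
    have h1 := (hX (z, 0) ⟨hz, h0⟩).fderiv.continuousAt.comp (f := fun κ : ℝ => (z, κ))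
      (by fun_prop)
    exact ((ContinuousLinearMap.compL ℝ (Phase l j) (Phase l j × ℝ) (Phase l j)).flip
      (.inl ℝ _ _)).continuous.continuousAt.comp h1
  have hD (z) (hz : z ∈ strip l M) (hzx : z.2 = x.2) (κ) (hκ : κ ∈ Ioo (-κ₁) κ₁) :
      (P κ + κ ^ n • C z κ).det = 1 := by
    rw [← (hvol κ hκ z hz).2]
    congr 1
    symm
    have h1 : HasFDerivAt (slowFastMap n ω₀ A B F G κ) (1 + ∑ i ∈ Finset.Ico 1 n,
        κ ^ i • fderiv ℝ (averagedTerm (A i) (B i)) z + κ ^ n • C z κ) z := by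
      have : slowFastMap n ω₀ A B F G κ = fun x => x + (ω₀, 0) +
          ∑ i ∈ Finset.Ico 1 n, κ ^ i • averagedTerm (A i) (B i) x +
            κ ^ n • perturbation F G (x, κ) := funext fun x => slowFastMap_eq κ x
      rw [this]
      refine HasFDerivAt.fun_add (HasFDerivAt.fun_add ((hasFDerivAt_id z).add_const _)
        (HasFDerivAt.fun_sum fun i hi => ?_)) ((hC z hz κ hκ).fun_const_smul _)
      exact ((analyticOnNhd_averagedTerm (hA i hi)
        (hB i hi) z hz).differentiableAt.hasFDerivAt).fun_const_smul _
    rw [h1.fderiv]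
    congr 2
    refine Finset.sum_congr rfl fun i hi => ?_
    rw [fderiv_averagedTerm (hA i hi) (hB i hi) hz, hzx]
  have hPc : Tendsto P (𝓝 0) (𝓝 1) := by
    refine Continuous.tendsto' (by fun_prop) _ _ ?_
    simp only [P, add_eq_left]
    refine Finset.sum_eq_zero fun i hi => ?_
    rw [zero_pow (by have := (Finset.mem_Ico.1 hi).1; omega), zero_smul]
  have hPC (z) (hz : z ∈ strip l M) : Tendsto (fun κ => P κ + κ ^ n • C z κ) (𝓝 0) (𝓝 1) := by
    have h1 : Tendsto (fun κ : ℝ => κ ^ n • C z κ) (𝓝 0) (𝓝 0) := by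
      have := ((continuous_pow n).tendsto (0 : ℝ)).smul (hCc z hz).tendsto
      rwa [zero_pow (by omega), zero_smul] at this
    simpa using hPc.add h1
  have hstrict : HasStrictFDerivAt (fun A : Phase l j →L[ℝ] Phase l j => A.det)
      (fderiv ℝ (fun A : Phase l j →L[ℝ] Phase l j => A.det) 1) 1 :=
    contDiff_det.contDiffAt.hasStrictFDerivAt (by simp)
  have hlim : Tendsto (fun p : ℝ => (P p + p ^ n • C x p, P p + p ^ n • C y p)) (𝓝[≠] 0)
      (𝓝 (1, 1)) :=
    ((hPC x hx).prodMk_nhds (hPC y hy)).mono_left nhdsWithin_le_nhds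
  have ho := hstrict.isLittleO.comp_tendsto hlim
  have htr : Tendsto (fun κ => traceCLM (Phase l j) (C x κ - C y κ)) (𝓝[≠] 0)
      (𝓝 (traceCLM (Phase l j) (C x 0 - C y 0))) :=
    ((traceCLM _).continuous.continuousAt.comp
      ((hCc x hx).sub (hCc y hy))).tendsto.mono_left nhdsWithin_le_nhds
  have hdiff (κ : ℝ) : P κ + κ ^ n • C x κ - (P κ + κ ^ n • C y κ) = κ ^ n • (C x κ - C y κ) := by
    rw [smul_sub]; abel
  have hzero : Tendsto (fun κ => traceCLM (Phase l j) (C x κ - C y κ)) (𝓝[≠] 0) (𝓝 0) := by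
    have h1 : (fun κ : ℝ => κ ^ n * traceCLM (Phase l j) (C x κ - C y κ)) =o[𝓝[≠] 0]
        fun κ : ℝ => κ ^ n := by
      have h2 : (fun κ : ℝ => κ ^ n • (C x κ - C y κ)) =O[𝓝[≠] 0] fun κ : ℝ => κ ^ n := by
        have h3 : (fun κ : ℝ => C x κ - C y κ) =O[𝓝[≠] 0] fun _ => (1 : ℝ) :=
          (((hCc x hx).sub (hCc y hy)).tendsto.mono_left nhdsWithin_le_nhds).isBigO_one ℝ
        simpa using (isBigO_refl (fun κ : ℝ => κ ^ n) (𝓝[≠] 0)).smul h3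
      have h4 := ho.congr' (f₂ := fun κ : ℝ => -(κ ^ n * traceCLM (Phase l j) (C x κ - C y κ)))
        (g₂ := fun κ : ℝ => κ ^ n • (C x κ - C y κ)) (by
          filter_upwards [mem_nhdsWithin_of_mem_nhds (isOpen_Ioo.mem_nhds h0)] with κ hκ
          simp only [Function.comp_apply]
          rw [hD x hx rfl κ hκ, hD y hy hxy.symm κ hκ, hdiff, fderiv_det_one, ← traceCLM_apply,
            map_smul, smul_eq_mul]
          ring) (Eventually.of_forall fun κ => hdiff κ)
      simpa using h4.neg_left.trans_isBigO h2
    rw [← isLittleO_one_iff ℝ]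
    have h5 := (isBigO_refl (fun κ : ℝ => (κ ^ n)⁻¹) (𝓝[≠] 0)).mul_isLittleO h1
    refine h5.congr' ?_ ?_ <;>
    · filter_upwards [self_mem_nhdsWithin] with κ hκ
      have : κ ^ n ≠ 0 := pow_ne_zero _ hκ
      field_simp
  have h6 := tendsto_nhds_unique htr hzero
  rw [map_sub, sub_eq_zero] at h6
  rw [divergence_eq, divergence_eq, (hC x hx 0 h0).fderiv, (hC y hy 0 h0).fderiv, h6]

/-- Expressing the average as an `angleConv` on the whole phase space makes the analyticity and
divergence results for averages available. -/
theorem oscillatingPart_eq (hX : ContinuousOn (fun x => perturbation F G (x, 0)) (strip l M))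
    (hper : AnglePeriodicOn (fun x => perturbation F G (x, 0)) M) {x : Phase l j}
    (hx : x ∈ strip l M) :
    oscillatingPart F G x = perturbation F G (x, 0) -
      angleConv (fun _ => 1) (fun x => perturbation F G (x, 0)) x := by
  have hx' : ((0 : Fin l → ℝ), x.2) ∈ strip l M := mk_mem_strip.2 (mem_strip.1 hx)
  rw [angleConv_one_add hper hx, oscillatingPart, angleAverage_eq, angleAverage_eq]
  have h1 := map_angleConv (.fst ℝ (Fin l → ℝ) (Fin j → ℝ)) continuous_const hX hx' (g := fun _ => 1)
  have h2 := map_angleConv (.snd ℝ (Fin l → ℝ) (Fin j → ℝ)) continuous_const hX hx' (g := fun _ => 1)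
  ext1
  · exact congrArg (F (x, 0) - ·) h1.symm
  · exact congrArg (G (x, 0) - ·) h2.symm

theorem analyticOnNhd_oscillatingPart (hM : IsOpen M)
    (hX : AnalyticOnNhd ℝ (fun x => perturbation F G (x, 0)) (strip l M))
    (hper : AnglePeriodicOn (fun x => perturbation F G (x, 0)) M) :
    AnalyticOnNhd ℝ (oscillatingPart F G) (strip l M) :=
  (hX.sub (analyticOnNhd_angleConv continuous_const hX)).congr (isOpen_strip hM)
    fun _ hx => (oscillatingPart_eq hX.continuousOn hper hx).symm

/-- The divergence of the average is the average of the divergence, and the latter is constant along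
the angles, so the two terms cancel. -/
theorem divergence_oscillatingPart (hM : IsOpen M)
    (hX : AnalyticOnNhd ℝ (fun x => perturbation F G (x, 0)) (strip l M))
    (hper : AnglePeriodicOn (fun x => perturbation F G (x, 0)) M)
    (hdiv : ∀ x ∈ strip l M, ∀ y, x.2 = y.2 →
      divergence (fun x => perturbation F G (x, 0)) x =
        divergence (fun x => perturbation F G (x, 0)) y) {x : Phase l j} (hx : x ∈ strip l M) :
    divergence (oscillatingPart F G) x = 0 := by
  have h1 : oscillatingPart F G =ᶠ[𝓝 x] fun x => perturbation F G (x, 0) -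
      angleConv (fun _ => 1) (fun x => perturbation F G (x, 0)) x := by
    filter_upwards [(isOpen_strip hM).mem_nhds hx] with y hy
      using oscillatingPart_eq hX.continuousOn hper hy
  have h2 := (hX x hx).differentiableAt.hasFDerivAt.sub
    (analyticOnNhd_angleConv (g := fun _ => 1) continuous_const hX x hx).differentiableAt.hasFDerivAt
  rw [divergence_eq, h1.fderiv_eq]
  have h3 := h2.fderiv
  simp only [Pi.sub_def] at h3
  rw [h3, map_sub, ← divergence_eq, ← divergence_eq, divergence_angleConv continuous_const hX hx,
    angleConv_one_of_forall_eq fun θ => (hdiv x hx (θ, x.2) rfl).symm, sub_self]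

theorem anglePeriodicOn_oscillatingPart
    (hper : AnglePeriodicOn (fun x => perturbation F G (x, 0)) M) :
    AnglePeriodicOn (oscillatingPart F G) M := by
  intro k θ J hJ
  have h := hper k θ J hJ
  simp only [perturbation, Prod.mk.injEq] at h
  simp only [oscillatingPart, h.1, h.2]

theorem angleCoeff_oscillatingPart
    (hX : AnalyticOnNhd ℝ (fun x => perturbation F G (x, 0)) (strip l M))
    (hper : AnglePeriodicOn (fun x => perturbation F G (x, 0)) M) (L : Phase l j →L[ℝ] ℝ)
    {J : Fin j → ℝ} (hJ : J ∈ M) : angleCoeff L (oscillatingPart F G) J 0 = 0 := by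
  have hx (θ : Fin l → ℝ) : (θ, J) ∈ strip l M := mk_mem_strip.2 hJ
  have h1 : ∫ θ in Icc (0 : Fin l → ℝ) 1, oscillatingPart F G (θ, J) = 0 := by
    have h2 (θ : Fin l → ℝ) := oscillatingPart_eq hX.continuousOn hper (hx θ)
    simp_rw [h2]
    have hi := integrableOn_angleConv (g := fun _ => 1) continuous_const hX.continuousOn (hx 0)
    simp only [one_smul, zero_add] at hi
    have h3 (θ : Fin l → ℝ) := angleConv_one_add hper (hx θ)
    simp_rw [h3]
    rw [integral_sub hi (continuousOn_const.integrableOn_compact isCompact_Icc),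
      setIntegral_Icc_const, sub_eq_zero]
    simp [angleConv]
  have h2 (θ : Fin l → ℝ) : angleChar (-0) θ = 1 := by simp [angleChar]
  simp only [angleCoeff, h2, one_mul]
  have hi : IntegrableOn (fun θ => oscillatingPart F G (θ, J)) (Icc (0 : Fin l → ℝ) 1) := by
    have h3 (θ : Fin l → ℝ) := oscillatingPart_eq hX.continuousOn hper (hx θ)
    have h4 (θ : Fin l → ℝ) := angleConv_one_add hper (hx θ)
    simp_rw [h3, h4]
    have hi := integrableOn_angleConv (g := fun _ => 1) continuous_const hX.continuousOn (hx 0)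
    simp only [one_smul, zero_add] at hi
    exact hi.sub (continuousOn_const.integrableOn_compact isCompact_Icc)
  have h5 := (Complex.ofRealCLM.comp L).integral_comp_comm hi
  rw [h1, map_zero] at h5
  exact h5

end OscillatingPart

/-! ### Divergence-free analytic solution of the homological equation. -/

section HomologicalSolution

variable {l j : ℕ}

theorem exists_homological_solution {c μ : ℝ} (hc : 0 < c) {ω : Fin l → ℝ}
    (hω : IsDiophantine c μ ω) {M : Set (Fin j → ℝ)} (hM : IsOpen M)
    {u : Phase l j → Phase l j} (hu : AnalyticOnNhd ℝ u (strip l M)) (hper : AnglePeriodicOn u M)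
    (hdiv : ∀ x ∈ strip l M, divergence u x = 0)
    (hmean : ∀ (L : Phase l j →L[ℝ] ℝ), ∀ J ∈ M, angleCoeff L u J 0 = 0) :
    ∃ V : Phase l j → Phase l j, AnalyticOnNhd ℝ V (strip l M) ∧ AnglePeriodicOn V M ∧
      (∀ x ∈ strip l M, divergence V x = 0) ∧
      ∀ (ψ : Fin l → ℝ), ∀ J ∈ M, V (ψ + ω, J) - V (ψ, J) = u (ψ, J) := by
  obtain ⟨p, hs⟩ := hω.exists_summable_kernelCoeff hc
  have hg := continuous_homologicalKernel hs
  have hPu := analyticOnNhd_angleLaplace p hu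
  refine ⟨angleConv (homologicalKernel p ω) (angleLaplace p u), analyticOnNhd_angleConv hg hPu,
    (hper.angleLaplace hM p).angleConv _, fun x hx => ?_, fun ψ J hJ => ?_⟩
  · rw [divergence_angleConv hg hPu hx]
    have (θ : Fin l → ℝ) : divergence (angleLaplace p u) (x.1 + θ, x.2) = 0 :=
      divergence_angleLaplace hM hu hdiv p (mk_mem_strip.2 (mem_strip.1 hx))
    simp [angleConv, this]
  -- The Fourier argument is scalar, so the vector equation is tested against every continuous
  -- linear functional.
  · rw [SeparatingDual.eq_iff_forall_dual_eq (R := ℝ)]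
    exact fun L => homological_equation hc hω hs L hM hu hper hJ (hmean L J hJ) ψ

end HomologicalSolution

/-! ### The flow on the lifted strip: equivariance and uniform estimates. -/

section StripFlow

variable {l j : ℕ}

theorem strip_mono {A B : Set (Fin j → ℝ)} (h : A ⊆ B) : strip l A ⊆ strip l B :=
  prod_mono subset_rfl h

theorem add_intVec_mem_strip {M : Set (Fin j → ℝ)} {x : Phase l j} {k : Fin l → ℤ} :
    x + (intVec k, 0) ∈ strip l M ↔ x ∈ strip l M := by
  simp [mem_strip]

theorem exists_intVec_sub_mem {C : Set (Fin j → ℝ)} {x : Phase l j} (hx : x ∈ strip l C) :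
    ∃ k : Fin l → ℤ, x - (intVec k, 0) ∈ Icc (0 : Fin l → ℝ) 1 ×ˢ C := by
  refine ⟨fun i => ⌊x.1 i⌋, ⟨fun i => ?_, fun i => ?_⟩, by simpa using mem_strip.1 hx⟩
  · simp [intVec]
  · simpa [intVec] using (Int.fract_lt_one (x.1 i)).le

theorem AnglePeriodicOn.add_intVec {E : Type*} {u : Phase l j → E} {M : Set (Fin j → ℝ)}
    (hu : AnglePeriodicOn u M) {x : Phase l j} (hx : x ∈ strip l M) (k : Fin l → ℤ) :
    u (x + (intVec k, 0)) = u x := by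
  simpa [Prod.add_def] using hu k x.1 x.2 (mem_strip.1 hx)

theorem AnglePeriodicOn.translate {V : Phase l j → Phase l j} {M : Set (Fin j → ℝ)}
    (hper : AnglePeriodicOn V M) (k : Fin l → ℤ) :
    ∀ x ∈ strip l M, x + (intVec k, 0) ∈ strip l M ∧ V (x + (intVec k, 0)) = V x :=
  fun _ hx => ⟨add_intVec_mem_strip.2 hx, hper.add_intVec hx k⟩

/-- A uniform existence time on the compact set [0,1]^l × C is carried to the whole strip by integer
translations, under which V is invariant. -/
theorem exists_isFlowOn_strip {V : Phase l j → Phase l j} {M C D : Set (Fin j → ℝ)}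
    (hM : IsOpen M) (hV : AnalyticOnNhd ℝ V (strip l M)) (hper : AnglePeriodicOn V M)
    (hC : IsCompact C) (hCM : C ⊆ M) (hD : IsOpen D) (hDC : D ⊆ C) :
    ∃ δ > 0, ∃ φ, IsFlowOn V (strip l M) (strip l D) δ φ := by
  obtain ⟨δ, hδ, h⟩ := exists_uniform_isFlowOn (isOpen_strip hM) hV
    ((isCompact_Icc (a := (0 : Fin l → ℝ)) (b := 1)).prod hC) (prod_mono (subset_univ _) hCM)
  refine ⟨δ, hδ, exists_isFlowOn_of_local (isOpen_strip hD) hV fun x hx => ?_⟩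
  obtain ⟨k, hk⟩ := exists_intVec_sub_mem (strip_mono hDC hx)
  obtain ⟨φ, r, hr, hφ⟩ := h _ hk
  refine ⟨_, r, hr, hφ.translate (hper.translate k) fun y hy => ?_⟩
  rwa [Metric.mem_ball, dist_sub_right]

theorem IsFlowOn.add_intVec {V : Phase l j → Phase l j} {M D : Set (Fin j → ℝ)}
    {δ : ℝ} {φ : Phase l j × ℝ → Phase l j} (hV : AnalyticOnNhd ℝ V (strip l M))
    (hper : AnglePeriodicOn V M) (hφ : IsFlowOn V (strip l M) (strip l D) δ φ) {x : Phase l j}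
    (hx : x ∈ strip l D) {t : ℝ} (ht : t ∈ Ioo (-δ) δ) (k : Fin l → ℤ) :
    φ (x + (intVec k, 0), t) = φ (x, t) + (intVec k, 0) := by
  have h := hφ.translate (hper.translate k) (D' := strip l D) fun y hy => by
    simpa [mem_strip] using hy
  have := hφ.eqOn hV h (x := x + (intVec k, 0)) (add_intVec_mem_strip.2 hx)
    (add_intVec_mem_strip.2 hx) ht
  simpa using this

theorem isBigO_sq_of_analyticAt {F : Type*} [NormedAddCommGroup F] [NormedSpace ℝ F]
    {f : ℝ → F} (hf : AnalyticAt ℝ f 0) (h0 : f 0 = 0) (h1 : HasDerivAt f 0 0) :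
    f =O[𝓝 0] fun t => t ^ 2 := by
  obtain ⟨p, hp⟩ := hf
  have h := hp.isBigO_sub_partialSum_pow 2
  have hc0 : p.coeff 0 = 0 := (hp.coeff_zero _).trans h0
  have hc1 : p.coeff 1 = 0 := by
    have := hp.deriv.symm.trans h1.deriv
    rwa [FormalMultilinearSeries.coeff]
  have hps (y : ℝ) : p.partialSum 2 y = 0 := by
    simp [FormalMultilinearSeries.partialSum, Finset.sum_range_succ, hc0, hc1]
  simpa [hps] using h

/-- The second-order Taylor remainder is analytic in (x, t) jointly, so it can be divided by t²
analytically. -/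
theorem IsFlowOn.exists_expansion {E : Type*} [NormedAddCommGroup E] [NormedSpace ℝ E]
    [CompleteSpace E] {V : E → E} {Ω D : Set E} {δ : ℝ} (hδ : 0 < δ) {φ : E × ℝ → E}
    (hD : IsOpen D) (hV : AnalyticOnNhd ℝ V D) (hφ : IsFlowOn V Ω D δ φ) :
    ∃ R : E × ℝ → E, AnalyticOnNhd ℝ R (D ×ˢ Ioo (-δ) δ) ∧
      ∀ x ∈ D, ∀ t ∈ Ioo (-δ) δ, φ (x, t) = x + t • V x + t ^ 2 • R (x, t) := by
  have h0 : (0 : ℝ) ∈ Ioo (-δ) δ := by simpa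
  have han : AnalyticOnNhd ℝ (fun p : E × ℝ => φ p - (p.1 + p.2 • V p.1)) (D ×ˢ Ioo (-δ) δ) :=
    fun p hp => (hφ.analytic p hp).sub (analyticAt_fst.add (analyticAt_snd.smul
      ((hV p.1 hp.1).fun_comp_of_eq analyticAt_fst rfl)))
  obtain ⟨R, hR, hRφ, -⟩ := exists_eq_pow_smul_of_isBigO hD hδ 2 han (fun x hx => by
    refine IsBigO.mono (isBigO_sq_of_analyticAt ?_ ?_ ?_) nhdsWithin_le_nhds
    · exact (han (x, 0) ⟨hx, h0⟩).fun_comp_of_eq (analyticAt_const.prod analyticAt_id) rfl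
    · simp [hφ.zero x hx]
    · have h1 := (hφ.deriv x hx 0 h0).sub (((hasDerivAt_id (0 : ℝ)).smul_const (V x)).const_add x)
      rw [hφ.zero x hx, one_smul, sub_self] at h1
      exact h1)
  refine ⟨R, hR, fun x hx t ht => ?_⟩
  rw [← hRφ x hx t ht]
  abel

theorem IsFlowOn.exists_uniform_bound {V : Phase l j → Phase l j} {M D C : Set (Fin j → ℝ)}
    {δ : ℝ} (hδ : 0 < δ) {φ : Phase l j × ℝ → Phase l j} (hV : AnalyticOnNhd ℝ V (strip l M))
    (hper : AnglePeriodicOn V M) (hD : IsOpen D) (hDM : D ⊆ M)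
    (hφ : IsFlowOn V (strip l M) (strip l D) δ φ) (hC : IsCompact C) (hCD : C ⊆ D) :
    ∃ B, ∀ x ∈ strip l C, ∀ t ∈ Icc (-(δ / 2)) (δ / 2),
      ‖φ (x, t) - (x + t • V x)‖ ≤ B * t ^ 2 := by
  obtain ⟨R, hR, hRφ⟩ := hφ.exists_expansion hδ (isOpen_strip hD) (hV.mono (strip_mono hDM))
  have hI : Icc (-(δ / 2)) (δ / 2) ⊆ Ioo (-δ) δ := Icc_subset_Ioo (by linarith) (by linarith)
  obtain ⟨B, hB⟩ := (((isCompact_Icc (a := (0 : Fin l → ℝ)) (b := 1)).prod hC).prod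
    (isCompact_Icc (a := -(δ / 2)) (b := δ / 2))).exists_bound_of_continuousOn
    (hR.continuousOn.mono (prod_mono (prod_mono (subset_univ _) hCD) hI))
  refine ⟨B, fun x hx t ht => ?_⟩
  obtain ⟨k, hk⟩ := exists_intVec_sub_mem hx
  set y := x - (intVec k, 0) with hy
  have hyD : y ∈ strip l D := ⟨trivial, hCD hk.2⟩
  have hxy : x = y + (intVec k, 0) := by simp [hy]
  rw [hxy, hφ.add_intVec hV hper hyD (hI ht), hper.add_intVec (strip_mono hDM hyD),
    hRφ y hyD t (hI ht)]
  have : y + t • V y + t ^ 2 • R (y, t) + (intVec k, 0) - (y + (intVec k, 0) + t • V y) =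
      t ^ 2 • R (y, t) := by abel
  rw [this, norm_smul, norm_pow, Real.norm_eq_abs, sq_abs, mul_comm]
  gcongr
  exact hB (y, t) ⟨hk, ht⟩

end StripFlow

/-! ### Expansion of the conjugated map in κ. -/

section Conjugation

theorem isBigO_pow_pow_of_le {m n : ℕ} (h : m ≤ n) :
    (fun κ : ℝ => κ ^ n) =O[𝓝 0] fun κ : ℝ => κ ^ m := by
  obtain ⟨d, rfl⟩ := Nat.exists_eq_add_of_le h
  have h1 : (fun κ : ℝ => κ ^ d) =O[𝓝 0] fun _ => (1 : ℝ) :=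
    ((continuous_pow d).tendsto (0 : ℝ)).isBigO_one ℝ
  simpa [pow_add] using (isBigO_refl (fun κ : ℝ => κ ^ m) (𝓝 0)).mul h1

/-- If `V` solves the homological equation, conjugation with its flow at time `κ ^ n` replaces the
term `κ ^ n X` by `κ ^ n Z` up to terms of order `n + 1`. -/
theorem IsFlowOn.isBigO_conjugation {E : Type*} [NormedAddCommGroup E] [NormedSpace ℝ E]
    [CompleteSpace E] {V : E → E} {Ω D : Set E} {δ : ℝ} (hδ : 0 < δ) {φ : E × ℝ → E}
    (hD : IsOpen D) (hV : AnalyticOnNhd ℝ V D) (hφ : IsFlowOn V Ω D δ φ) {n : ℕ} (hn : 1 ≤ n)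
    {Y : ℕ → E → E} {X : E × ℝ → E} {w z x : E} (hx : x ∈ D) (hxw : x + w ∈ D)
    (hY : ∀ i ∈ Finset.Ico 1 n, DifferentiableAt ℝ (Y i) x) (hX : DifferentiableAt ℝ X (x, 0))
    (hVw : V (x + w) - V x = X (x, 0) - z) {T : ℝ → E}
    (hT : ∀ κ, T κ = φ (x, κ ^ n) + w + ∑ i ∈ Finset.Ico 1 n, κ ^ i • Y i (φ (x, κ ^ n)) +
      κ ^ n • X (φ (x, κ ^ n), κ)) :
    (fun κ => φ (T κ, -κ ^ n) - (x + w + ∑ i ∈ Finset.Ico 1 n, κ ^ i • Y i x + κ ^ n • z))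
      =O[𝓝 0] fun κ => κ ^ (n + 1) := by
  -- Modulo κ^{n+1}, T = x + w + ∑ κ^i Y_i(x) + κ^n (V(x) + X(x, 0)), and the backward flow
  -- subtracts κ^n V(T), which is κ^n V(x + w) since T = x + w + O(κ). The quadratic flow remainders
  -- are O(κ^{2n}), absorbed because 2n ≥ n + 1. What is left at order n is V(x) + X(x, 0) - V(x +
  -- w) = z.
  obtain ⟨R, hR, hRφ⟩ := hφ.exists_expansion hδ hD hV
  have h0 : (0 : ℝ) ∈ Ioo (-δ) δ := by simpa
  have hpow : Tendsto (fun κ : ℝ => κ ^ n) (𝓝 0) (𝓝 0) :=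
    (continuous_pow n).tendsto' _ _ (zero_pow (by omega))
  have hpow1 : (fun κ : ℝ => κ ^ n) =O[𝓝 0] fun κ : ℝ => κ := by
    simpa using isBigO_pow_pow_of_le hn
  have hR1 : (fun κ : ℝ => R (x, κ ^ n)) =O[𝓝 0] fun _ => (1 : ℝ) :=
    ((hR (x, 0) ⟨hx, h0⟩).continuousAt.tendsto.comp
      (tendsto_const_nhds.prodMk_nhds hpow)).isBigO_one ℝ
  have hIoo : ∀ᶠ κ : ℝ in 𝓝 0, κ ^ n ∈ Ioo (-δ) δ := hpow (isOpen_Ioo.mem_nhds h0)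
  have ha2 : (fun κ : ℝ => φ (x, κ ^ n) - x - κ ^ n • V x) =O[𝓝 0] fun κ : ℝ => κ ^ (n + 1) := by
    have h1 : (fun κ : ℝ => (κ ^ n) ^ 2 • R (x, κ ^ n)) =O[𝓝 0] fun κ : ℝ => κ ^ (n + 1) := by
      refine IsBigO.trans ?_ (isBigO_pow_pow_of_le (show n + 1 ≤ n * 2 by omega))
      simpa [pow_mul] using (isBigO_refl (fun κ : ℝ => (κ ^ n) ^ 2) (𝓝 0)).smul hR1
    refine h1.congr' ?_ .rfl
    filter_upwards [hIoo] with κ hκ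
    rw [hRφ x hx _ hκ]
    abel
  have ha : (fun κ : ℝ => φ (x, κ ^ n) - x) =O[𝓝 0] fun κ : ℝ => κ ^ n := by
    have h1 : (fun κ : ℝ => κ ^ n • V x) =O[𝓝 0] fun κ : ℝ => κ ^ n := by
      simpa using (isBigO_refl (fun κ : ℝ => κ ^ n) (𝓝 0)).smul
        (isBigO_const_const (V x) (one_ne_zero (α := ℝ)) (𝓝 0))
    simpa using (ha2.trans (isBigO_pow_pow_of_le n.le_succ)).add h1
  have hκ1 : Tendsto (fun κ : ℝ => κ) (𝓝 0) (𝓝 0) := tendsto_id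
  have hat : Tendsto (fun κ : ℝ => φ (x, κ ^ n)) (𝓝 0) (𝓝 x) :=
    tendsto_sub_nhds_zero_iff.1 (ha.trans_tendsto hpow)
  have hXt : Tendsto (fun κ : ℝ => (φ (x, κ ^ n), κ)) (𝓝 0) (𝓝 (x, 0)) := hat.prodMk_nhds hκ1
  have hXO : (fun κ : ℝ => X (φ (x, κ ^ n), κ) - X (x, 0)) =O[𝓝 0] fun κ : ℝ => κ := by
    refine (hX.isBigO_sub.comp_tendsto hXt).trans ?_
    have h1 : (fun κ : ℝ => ((φ (x, κ ^ n) - x, κ) : E × ℝ)) =O[𝓝 0] fun κ : ℝ => κ :=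
      (ha.trans hpow1).prod_left (isBigO_refl _ _)
    simpa [Function.comp_def] using h1
  have hYO (i) (hi : i ∈ Finset.Ico 1 n) :
      (fun κ : ℝ => κ ^ i • (Y i (φ (x, κ ^ n)) - Y i x)) =O[𝓝 0] fun κ : ℝ => κ ^ (n + 1) := by
    have h1 := ((hY i hi).isBigO_sub.comp_tendsto hat).trans ha
    have h2 := (isBigO_pow_pow_of_le (Finset.mem_Ico.1 hi).1).smul h1
    refine h2.congr_right fun κ => ?_
    simp [pow_succ']
  have hXn : (fun κ : ℝ => κ ^ n • (X (φ (x, κ ^ n), κ) - X (x, 0))) =O[𝓝 0]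
      fun κ : ℝ => κ ^ (n + 1) :=
    (isBigO_refl (fun κ : ℝ => κ ^ n) (𝓝 0)).smul hXO
  have hTO : (fun κ => T κ - (x + w)) =O[𝓝 0] fun κ : ℝ => κ := by
    have h1 : (fun κ : ℝ => κ ^ n • X (φ (x, κ ^ n), κ)) =O[𝓝 0] fun κ : ℝ => κ := by
      have h4 : (fun κ : ℝ => X (φ (x, κ ^ n), κ)) =O[𝓝 0] fun _ => (1 : ℝ) :=
        (hX.continuousAt.tendsto.comp hXt).isBigO_one ℝ
      simpa using hpow1.smul h4
    have h2 : (fun κ : ℝ => ∑ i ∈ Finset.Ico 1 n, κ ^ i • Y i (φ (x, κ ^ n))) =O[𝓝 0]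
        fun κ : ℝ => κ := by
      refine IsBigO.fun_sum fun i hi => ?_
      have h4 : (fun κ : ℝ => Y i (φ (x, κ ^ n))) =O[𝓝 0] fun _ => (1 : ℝ) :=
        ((hY i hi).continuousAt.tendsto.comp hat).isBigO_one ℝ
      simpa using (isBigO_pow_pow_of_le (Finset.mem_Ico.1 hi).1).smul h4
    refine (((ha.trans hpow1).add h2).add h1).congr_left fun κ => ?_
    rw [hT]
    abel
  have hTt : Tendsto T (𝓝 0) (𝓝 (x + w)) :=
    tendsto_sub_nhds_zero_iff.1 (hTO.trans_tendsto hκ1)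
  have hVn : (fun κ : ℝ => κ ^ n • (V (T κ) - V (x + w))) =O[𝓝 0]
      fun κ : ℝ => κ ^ (n + 1) :=
    (isBigO_refl (fun κ : ℝ => κ ^ n) (𝓝 0)).smul
      (((hV _ hxw).differentiableAt.isBigO_sub.comp_tendsto hTt).trans hTO)
  have hnegt : Tendsto (fun κ : ℝ => -κ ^ n) (𝓝 0) (𝓝 0) := by simpa using hpow.neg
  have hRn : (fun κ : ℝ => (-κ ^ n) ^ 2 • R (T κ, -κ ^ n)) =O[𝓝 0]
      fun κ : ℝ => κ ^ (n + 1) := by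
    have h1 : (fun κ : ℝ => R (T κ, -κ ^ n)) =O[𝓝 0] fun _ => (1 : ℝ) :=
      ((hR (x + w, 0) ⟨hxw, h0⟩).continuousAt.tendsto.comp
        (hTt.prodMk_nhds hnegt)).isBigO_one ℝ
    refine IsBigO.trans ?_ (isBigO_pow_pow_of_le (show n + 1 ≤ n * 2 by omega))
    simpa [pow_mul] using (isBigO_refl (fun κ : ℝ => (κ ^ n) ^ 2) (𝓝 0)).smul h1
  refine ((((hRn.sub hVn).add ha2).add (IsBigO.fun_sum hYO)).add hXn).congr' ?_ .rfl
  filter_upwards [hnegt (isOpen_Ioo.mem_nhds h0), hTt (hD.mem_nhds hxw)] with κ hκ hTκ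
  have hz : z = X (x, 0) - (V (x + w) - V x) := by rw [hVw]; abel
  rw [hRφ _ hTκ _ hκ, hz]
  simp only [smul_sub, Finset.sum_sub_distrib, neg_smul]
  have := hT κ
  generalize V (T κ) = v at *
  rw [this]
  abel

/-- The condition is open and holds at κ = 0, so it persists uniformly over the compact fundamental
domain; equivariance extends it to the noncompact strip. -/
theorem exists_pos_forall_mem_strip {l j : ℕ} {C O : Set (Fin j → ℝ)} (hC : IsCompact C)
    (hO : IsOpen O) {H : Phase l j × ℝ → Phase l j}
    (hH : ∀ x ∈ strip l C, ContinuousAt H (x, 0)) (h0 : ∀ x ∈ strip l C, H (x, 0) ∈ strip l O)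
    {r : ℝ} (hr : 0 < r) (heq : ∀ x ∈ strip l C, ∀ κ ∈ Ioo (-r) r, ∀ k : Fin l → ℤ,
      H (x + (intVec k, 0), κ) = H (x, κ) + (intVec k, 0)) :
    ∃ ε > 0, ε ≤ r ∧ ∀ κ ∈ Ioo (-ε) ε, ∀ x ∈ strip l C, H (x, κ) ∈ strip l O := by
  have h1 : ∀ᶠ κ in 𝓝 (0 : ℝ), ∀ x ∈ Icc (0 : Fin l → ℝ) 1 ×ˢ C, H (x, κ) ∈ strip l O := by
    refine (isCompact_Icc.prod hC).eventually_forall_of_forall_eventually fun x hx => ?_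
    have hx' : x ∈ strip l C := ⟨trivial, hx.2⟩
    exact ((hH x hx').tendsto.comp (continuous_swap.tendsto (0, x)))
      ((isOpen_strip hO).mem_nhds (h0 x hx'))
  obtain ⟨ε, hε, hball⟩ := Metric.eventually_nhds_iff_ball.1 h1
  refine ⟨min ε r, lt_min hε hr, min_le_right _ _, fun κ hκ x hx => ?_⟩
  have hκr : κ ∈ Ioo (-r) r :=
    ⟨by linarith [hκ.1, min_le_right ε r], hκ.2.trans_le (min_le_right _ _)⟩
  have hκε : κ ∈ Metric.ball (0 : ℝ) ε := by
    rw [mem_ball_zero_iff, Real.norm_eq_abs, abs_lt]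
    exact ⟨by linarith [hκ.1, min_le_left ε r], hκ.2.trans_le (min_le_left _ _)⟩
  obtain ⟨k, hk⟩ := exists_intVec_sub_mem hx
  have h3 := heq (x - (intVec k, 0)) ⟨trivial, hk.2⟩ κ hκr k
  rw [sub_add_cancel] at h3
  rw [h3, add_intVec_mem_strip]
  exact hball κ hκε _ hk

end Conjugation

/-! ### Construction of the decoupling transformation near a compact set. -/

section NearCompact

variable {l j n : ℕ} {ω₀ : Fin l → ℝ} {A : ℕ → (Fin j → ℝ) → (Fin l → ℝ)}
  {B : ℕ → (Fin j → ℝ) → (Fin j → ℝ)} {F : Phase l j × ℝ → (Fin l → ℝ)}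
  {G : Phase l j × ℝ → (Fin j → ℝ)} {M : Set (Fin j → ℝ)} {κ₁ : ℝ}

theorem slowFastMap_succ_update (hn : 1 ≤ n) (a : (Fin j → ℝ) → (Fin l → ℝ))
    (b : (Fin j → ℝ) → (Fin j → ℝ)) (κ : ℝ) (x : Phase l j) :
    slowFastMap (n + 1) ω₀ (Function.update A n a) (Function.update B n b) F G κ x =
      x + (ω₀, 0) + ∑ i ∈ Finset.Ico 1 n, κ ^ i • averagedTerm (A i) (B i) x +
        κ ^ n • averagedTerm a b x + κ ^ (n + 1) • perturbation F G (x, κ) := by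
  rw [slowFastMap_eq, Finset.sum_Ico_succ_top hn, Function.update_self, Function.update_self,
    ← add_assoc]
  congr 3
  refine Finset.sum_congr rfl fun i hi => ?_
  rw [Function.update_of_ne (Finset.mem_Ico.1 hi).2.ne,
    Function.update_of_ne (Finset.mem_Ico.1 hi).2.ne]

theorem analyticOnNhd_slowFastMap
    (hA : ∀ i ∈ Finset.Ico 1 n, AnalyticOnNhd ℝ (A i) M)
    (hB : ∀ i ∈ Finset.Ico 1 n, AnalyticOnNhd ℝ (B i) M)
    (hX : AnalyticOnNhd ℝ (perturbation F G) (strip l M ×ˢ Ioo (-κ₁) κ₁)) :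
    AnalyticOnNhd ℝ (fun p : Phase l j × ℝ => slowFastMap n ω₀ A B F G p.2 p.1)
      (strip l M ×ˢ Ioo (-κ₁) κ₁) := by
  intro p hp
  simp_rw [slowFastMap_eq]
  refine ((analyticAt_fst.add analyticAt_const).add (Finset.analyticAt_fun_sum _ fun i hi => ?_)).add
    ((analyticAt_snd.pow n).smul (hX p hp))
  exact (analyticAt_snd.pow i).smul ((analyticOnNhd_averagedTerm (hA i hi) (hB i hi) p.1
    hp.1).fun_comp_of_eq analyticAt_fst rfl)

theorem slowFastMap_add_intVec {κ : ℝ}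
    (hper : AnglePeriodicOn (fun x => perturbation F G (x, κ)) M) {x : Phase l j}
    (hx : x ∈ strip l M) (k : Fin l → ℤ) :
    slowFastMap n ω₀ A B F G κ (x + (intVec k, 0)) =
      slowFastMap n ω₀ A B F G κ x + (intVec k, 0) := by
  have h := hper.add_intVec hx k
  have h' (i : ℕ) : averagedTerm (A i) (B i) (x + (intVec k, 0)) = averagedTerm (A i) (B i) x := by
    simp [averagedTerm]
  simp only [slowFastMap_eq, h, h']
  abel

theorem slowFastMap_zero (hn : 1 ≤ n) (x : Phase l j) :
    slowFastMap n ω₀ A B F G 0 x = x + (ω₀, 0) := by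
  rw [slowFastMap_eq, Finset.sum_eq_zero fun i hi => by
    rw [zero_pow (by have := (Finset.mem_Ico.1 hi).1; omega), zero_smul], zero_pow (by omega)]
  simp

theorem averagedTerm_angleAverage (x : Phase l j) :
    averagedTerm (angleAverage F) (angleAverage G) x =
      perturbation F G (x, 0) - oscillatingPart F G x := by
  ext1 <;> simp [averagedTerm, perturbation, oscillatingPart]

theorem IsFlowOn.isExpOn {V : Phase l j → Phase l j} {Ω D : Set (Phase l j)} {δ : ℝ}
    {φ : Phase l j × ℝ → Phase l j} (hφ : IsFlowOn V Ω D δ φ) {t : ℝ} (ht : t ∈ Ioo (-δ) δ) :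
    IsExpOn (fun x => t • V x) Ω (fun x => φ (x, t)) D := by
  intro x hx
  refine ⟨fun s => φ (x, s * t), by simpa using hφ.zero x hx, by simp, fun s hs => ?_⟩
  have hst : s * t ∈ Ioo (-δ) δ := by
    rw [mem_Ioo, ← abs_lt, abs_mul, abs_of_nonneg hs.1]
    exact (mul_le_of_le_one_left (abs_nonneg t) hs.2).trans_lt (abs_lt.2 ht)
  refine ⟨hφ.mem x hx _ hst, HasDerivAt.hasDerivWithinAt ?_⟩
  have h := (hφ.deriv x hx _ hst).scomp s ((hasDerivAt_id s).mul_const t)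
  simpa [Function.comp_def] using h

theorem IsFlowOn.analyticAt_time {E : Type*} [NormedAddCommGroup E] [NormedSpace ℝ E]
    {V : E → E} {Ω D : Set E} {δ : ℝ} {φ : E × ℝ → E}
    (hφ : IsFlowOn V Ω D δ φ) {t : ℝ} (ht : t ∈ Ioo (-δ) δ) :
    AnalyticOnNhd ℝ (fun x => φ (x, t)) D := fun x hx =>
  (hφ.analytic (x, t) ⟨hx, ht⟩).fun_comp_of_eq (analyticAt_id.prod analyticAt_const) rfl

/-- The inverse is the flow at time -t. The image of D' is exactly the set of points of D that the
backward flow sends into D', and this is open by continuity. -/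
theorem IsFlowOn.analyticDiffeoOn {V : Phase l j → Phase l j} {Ω D D' : Set (Phase l j)} {δ : ℝ}
    {φ : Phase l j × ℝ → Phase l j} (hV : AnalyticOnNhd ℝ V Ω) (hφ : IsFlowOn V Ω D δ φ)
    (hD : IsOpen D) (hD' : IsOpen D') (hDD : D' ⊆ D) {t : ℝ} (ht : t ∈ Ioo (-(δ / 2)) (δ / 2))
    (hmaps : ∀ x ∈ D', φ (x, t) ∈ D) :
    AnalyticDiffeoOn (fun x => φ (x, t)) D' := by
  have hδ : 0 < δ := by linarith [ht.1.trans ht.2]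
  have ht1 : t ∈ Ioo (-δ) δ := ⟨by linarith [ht.1], by linarith [ht.2]⟩
  have hnt : -t ∈ Ioo (-(δ / 2)) (δ / 2) := ⟨by linarith [ht.2], by linarith [ht.1]⟩
  have hnt1 : -t ∈ Ioo (-δ) δ := ⟨by linarith [ht.2], by linarith [ht.1]⟩
  have hinv {x} (hx : x ∈ D') : φ (φ (x, t), -t) = x := hφ.flow_neg hV (hDD hx) ht (hmaps x hx)
  have han := hφ.analyticAt_time hnt1
  refine ⟨(hφ.analyticAt_time ht1).mono hDD, ?_, fun x => φ (x, -t),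
    han.mono (image_subset_iff.2 hmaps), fun x hx => hinv hx⟩
  have himage : (fun x => φ (x, t)) '' D' = D ∩ (fun x => φ (x, -t)) ⁻¹' D' := by
    ext y
    constructor
    · rintro ⟨x, hx, rfl⟩
      exact ⟨hmaps x hx, by simpa only [mem_preimage, hinv hx] using hx⟩
    · rintro ⟨hy, hy'⟩
      refine ⟨_, hy', ?_⟩
      have := hφ.flow_neg hV hy hnt (hDD hy')
      rwa [neg_neg] at this
  rw [himage]
  exact han.continuousOn.isOpen_inter_preimage hD hD'

theorem exists_decoupling_near_compact (hn : 1 ≤ n) (hM : IsOpen M) (hκ₁ : 0 < κ₁)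
    (hA : ∀ i ∈ Finset.Ico 1 n, AnalyticOnNhd ℝ (A i) M)
    (hB : ∀ i ∈ Finset.Ico 1 n, AnalyticOnNhd ℝ (B i) M)
    (hX : AnalyticOnNhd ℝ (perturbation F G) (strip l M ×ˢ Ioo (-κ₁) κ₁))
    (hper : ∀ κ ∈ Ioo (-κ₁) κ₁, AnglePeriodicOn (fun x => perturbation F G (x, κ)) M)
    (hu : AnalyticOnNhd ℝ (oscillatingPart F G) (strip l M))
    {V : Phase l j → Phase l j} (hV : AnalyticOnNhd ℝ V (strip l M)) (hVper : AnglePeriodicOn V M)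
    (hdiv : ∀ x ∈ strip l M, divergence V x = 0)
    (hVω : ∀ (ψ : Fin l → ℝ), ∀ I ∈ M, V (ψ + ω₀, I) - V (ψ, I) = oscillatingPart F G (ψ, I))
    {K : Set (Fin j → ℝ)} (hK : IsCompact K) (hKM : K ⊆ M) :
    ∃ (κ₀ : ℝ) (U W : Set (Fin j → ℝ)) (Φ : ℝ → Phase l j → Phase l j)
      (X' : Phase l j × ℝ → Phase l j),
      0 < κ₀ ∧ κ₀ ≤ κ₁ ∧ IsOpen U ∧ IsOpen W ∧ K ⊆ U ∧ U ⊆ W ∧ W ⊆ M ∧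
      AnalyticOnNhd ℝ (fun p : Phase l j × ℝ => Φ p.2 p.1) (strip l W ×ˢ Ioo (-κ₀) κ₀) ∧
      AnalyticOnNhd ℝ X' (strip l U ×ˢ Ioo (-κ₀) κ₀) ∧
      (∃ C : ℝ, ∀ κ ∈ Ioo (-κ₀) κ₀, ∀ x ∈ strip l W,
        ‖Φ κ x - (x + κ ^ n • V x)‖ ≤ C * |κ| ^ (2 * n)) ∧
      ∀ κ ∈ Ioo (-κ₀) κ₀,
        IsExpOn (fun x => κ ^ n • V x) (strip l M) (Φ κ) (strip l W) ∧
        AngleEquivariantOn (Φ κ) W ∧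
        AnalyticDiffeoOn (Φ κ) (strip l W) ∧
        VolumePreservingOn (Φ κ) (strip l W) ∧
        AnglePeriodicOn (fun x => X' (x, κ)) U ∧
        ∀ x ∈ strip l U, Φ κ x ∈ strip l M ∧ ∃ y ∈ strip l W,
          y = x + (ω₀, 0) + ∑ i ∈ Finset.Ico 1 n, κ ^ i • averagedTerm (A i) (B i) x +
            κ ^ n • averagedTerm (angleAverage F) (angleAverage G) x + κ ^ (n + 1) • X' (x, κ) ∧
          slowFastMap n ω₀ A B F G κ (Φ κ x) = Φ κ y := by
  -- Nested neighbourhoods K ⊆ U ⊆ C₁ ⊆ W ⊆ C₂ ⊆ W₂ ⊆ C₃ ⊆ M: the flow starts in W₂, the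
  -- transformation lives on W, and the new map on U.
  obtain ⟨C₃, hC₃, hKC₃, hC₃M⟩ := exists_compact_between hK hM hKM
  obtain ⟨C₂, hC₂, hKC₂, hC₂₃⟩ := exists_compact_between hK isOpen_interior hKC₃
  obtain ⟨C₁, hC₁, hKC₁, hC₁₂⟩ := exists_compact_between hK isOpen_interior hKC₂
  set W₂ := interior C₃
  set W := interior C₂
  set U := interior C₁
  have hW₂ : IsOpen W₂ := isOpen_interior
  have hW : IsOpen W := isOpen_interior
  have hU : IsOpen U := isOpen_interior
  have hUC : U ⊆ C₁ := interior_subset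
  have hWC : W ⊆ C₂ := interior_subset
  have hWW : W ⊆ W₂ := hWC.trans hC₂₃
  have hCW : C₁ ⊆ W₂ := hC₁₂.trans hWW
  have hWM : W₂ ⊆ M := interior_subset.trans hC₃M
  obtain ⟨δ, hδ, φ, hφ⟩ := exists_isFlowOn_strip hM hV hVper hC₃ hC₃M hW₂ interior_subset
  -- The bound r ≤ 1 gives |κ^n| ≤ |κ| < δ / 2, so the flow at times ±κ^n is defined and inverted by
  -- `IsFlowOn.flow_neg`.
  obtain ⟨r, hr, hrδ, hr1, hrκ⟩ : ∃ r > 0, r ≤ δ / 2 ∧ r ≤ 1 ∧ r ≤ κ₁ :=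
    ⟨min (δ / 2) (min 1 κ₁), by positivity, min_le_left _ _,
      (min_le_right _ _).trans (min_le_left _ _), (min_le_right _ _).trans (min_le_right _ _)⟩
  have hpow {κ : ℝ} (hκ : κ ∈ Ioo (-r) r) : κ ^ n ∈ Ioo (-(δ / 2)) (δ / 2) := by
    rw [mem_Ioo, ← abs_lt] at hκ ⊢
    rw [abs_pow]
    exact (pow_le_of_le_one (abs_nonneg κ) (hκ.le.trans hr1) (by omega)).trans_lt
      (hκ.trans_le hrδ)
  have hneg {t : ℝ} (ht : t ∈ Ioo (-(δ / 2)) (δ / 2)) : -t ∈ Ioo (-(δ / 2)) (δ / 2) :=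
    ⟨by linarith [ht.2], by linarith [ht.1]⟩
  have hδ2 {t : ℝ} (ht : t ∈ Ioo (-(δ / 2)) (δ / 2)) : t ∈ Ioo (-δ) δ :=
    ⟨by linarith [ht.1], by linarith [ht.2]⟩
  have hκr {κ : ℝ} (hκ : κ ∈ Ioo (-r) r) : κ ∈ Ioo (-κ₁) κ₁ :=
    ⟨by linarith [hκ.1], by linarith [hκ.2]⟩
  have h0r : (0 : ℝ) ∈ Ioo (-r) r := by simpa
  have h0n : (0 : ℝ) ^ n = 0 := zero_pow (by omega)
  -- the transformed point, its image, and the conjugated map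
  let a (p : Phase l j × ℝ) : Phase l j := φ (p.1, p.2 ^ n)
  let T (p : Phase l j × ℝ) : Phase l j := slowFastMap n ω₀ A B F G p.2 (a p)
  let g (p : Phase l j × ℝ) : Phase l j := φ (T p, -p.2 ^ n)
  have haM {x} (hx : x ∈ strip l W₂) {κ : ℝ} (hκ : κ ∈ Ioo (-r) r) : a (x, κ) ∈ strip l M :=
    hφ.mem x hx _ (hδ2 (hpow hκ))
  have haan : AnalyticOnNhd ℝ a (strip l W₂ ×ˢ Ioo (-r) r) := fun p hp =>
    (hφ.analytic (p.1, p.2 ^ n) ⟨hp.1, hδ2 (hpow hp.2)⟩).fun_comp_of_eq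
      (analyticAt_fst.prod (analyticAt_snd.pow n)) rfl
  have hTan : AnalyticOnNhd ℝ T (strip l W₂ ×ˢ Ioo (-r) r) := fun p hp =>
    (analyticOnNhd_slowFastMap hA hB hX (a p, p.2) ⟨haM hp.1 hp.2, hκr hp.2⟩).fun_comp_of_eq
      ((haan p hp).prod analyticAt_snd) rfl
  have hgan {p} (hp : p ∈ strip l W₂ ×ˢ Ioo (-r) r) (hTp : T p ∈ strip l W₂) :
      AnalyticAt ℝ g p :=
    (hφ.analytic (T p, -p.2 ^ n) ⟨hTp, hδ2 (hneg (hpow hp.2))⟩).fun_comp_of_eq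
      ((hTan p hp).prod (analyticAt_snd.pow n).neg) rfl
  have haeq {x} (hx : x ∈ strip l W₂) {κ : ℝ} (hκ : κ ∈ Ioo (-r) r) (k : Fin l → ℤ) :
      a (x + (intVec k, 0), κ) = a (x, κ) + (intVec k, 0) :=
    hφ.add_intVec hV hVper hx (hδ2 (hpow hκ)) k
  have hTeq {x} (hx : x ∈ strip l W₂) {κ : ℝ} (hκ : κ ∈ Ioo (-r) r) (k : Fin l → ℤ) :
      T (x + (intVec k, 0), κ) = T (x, κ) + (intVec k, 0) := by
    simp only [T, haeq hx hκ]
    exact slowFastMap_add_intVec (hper κ (hκr hκ)) (haM hx hκ) k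
  have hgeq {x} (hx : x ∈ strip l W₂) {κ : ℝ} (hκ : κ ∈ Ioo (-r) r)
      (hTx : T (x, κ) ∈ strip l W₂) (k : Fin l → ℤ) :
      g (x + (intVec k, 0), κ) = g (x, κ) + (intVec k, 0) := by
    simp only [g, hTeq hx hκ]
    exact hφ.add_intVec hV hVper hTx (hδ2 (hneg (hpow hκ))) k
  have ha0 {x} (hx : x ∈ strip l W₂) : a (x, 0) = x := by
    simp only [a, h0n]
    exact hφ.zero x hx
  have hT0 {x} (hx : x ∈ strip l W₂) : T (x, 0) = x + (ω₀, 0) := by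
    simp only [T, ha0 hx]
    exact slowFastMap_zero hn x
  have hω {S : Set (Fin j → ℝ)} {x : Phase l j} (hx : x ∈ strip l S) :
      x + (ω₀, 0) ∈ strip l S := by simpa [mem_strip] using hx
  have hg0 {x} (hx : x ∈ strip l W₂) : g (x, 0) = x + (ω₀, 0) := by
    simp only [g, hT0 hx, h0n, neg_zero]
    exact hφ.zero _ (hω hx)
  -- Three smallness conditions. Φ sends C₂ into W₂, where the backward flow inverts it; f ∘ Φ sends
  -- C₁ into W₂, where the backward flow may start; and the conjugated map g sends C₁ into W, where
  -- Φ is defined.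
  obtain ⟨r₁, hr₁, hr₁r, ha⟩ := exists_pos_forall_mem_strip hC₂ hW₂
    (fun x hx => (haan (x, 0) ⟨strip_mono hC₂₃ hx, h0r⟩).continuousAt)
    (fun x hx => by rw [ha0 (strip_mono hC₂₃ hx)]; exact strip_mono hC₂₃ hx) hr
    (fun x hx κ hκ k => haeq (strip_mono hC₂₃ hx) hκ k)
  obtain ⟨r₂, hr₂, hr₂r, hT⟩ := exists_pos_forall_mem_strip hC₁ hW₂
    (fun x hx => (hTan (x, 0) ⟨strip_mono hCW hx, h0r⟩).continuousAt)
    (fun x hx => by rw [hT0 (strip_mono hCW hx)]; exact hω (strip_mono hCW hx)) hr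
    (fun x hx κ hκ k => hTeq (strip_mono hCW hx) hκ k)
  have h0r₂ : (0 : ℝ) ∈ Ioo (-r₂) r₂ := by simpa
  have hr₂' {κ : ℝ} (hκ : κ ∈ Ioo (-r₂) r₂) : κ ∈ Ioo (-r) r :=
    ⟨by linarith [hκ.1], by linarith [hκ.2]⟩
  obtain ⟨r₃, hr₃, hr₃r, hg⟩ := exists_pos_forall_mem_strip hC₁ hW
    (fun x hx => (hgan (p := (x, 0)) ⟨strip_mono hCW hx, h0r⟩ (hT 0 h0r₂ x hx)).continuousAt)
    (fun x hx => by rw [hg0 (strip_mono hCW hx)]; exact hω (strip_mono hC₁₂ hx)) hr₂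
    (fun x hx κ hκ k => hgeq (strip_mono hCW hx) (hr₂' hκ) (hT κ hκ x hx) k)
  obtain ⟨κ₀, hκ₀, h01, h03⟩ : ∃ κ₀ > 0, κ₀ ≤ r₁ ∧ κ₀ ≤ r₃ :=
    ⟨min r₁ r₃, lt_min hr₁ hr₃, min_le_left _ _, min_le_right _ _⟩
  have hI₁ {κ : ℝ} (hκ : κ ∈ Ioo (-κ₀) κ₀) : κ ∈ Ioo (-r₁) r₁ :=
    ⟨by linarith [hκ.1], by linarith [hκ.2]⟩
  have hI₂ {κ : ℝ} (hκ : κ ∈ Ioo (-κ₀) κ₀) : κ ∈ Ioo (-r₂) r₂ :=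
    ⟨by linarith [hκ.1], by linarith [hκ.2]⟩
  have hI₃ {κ : ℝ} (hκ : κ ∈ Ioo (-κ₀) κ₀) : κ ∈ Ioo (-r₃) r₃ :=
    ⟨by linarith [hκ.1], by linarith [hκ.2]⟩
  have hI {κ : ℝ} (hκ : κ ∈ Ioo (-κ₀) κ₀) : κ ∈ Ioo (-r) r := hr₂' (hI₂ hκ)
  have h0 : (0 : ℝ) ∈ Ioo (-κ₀) κ₀ := by simpa
  have hUW : U ⊆ W := hUC.trans hC₁₂
  have hUW₂ : U ⊆ W₂ := hUW.trans hWW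
  have hUM : U ⊆ M := hUW₂.trans hWM
  have hX0 : AnalyticOnNhd ℝ (fun x => perturbation F G (x, 0)) (strip l M) := fun x hx =>
    (hX (x, 0) ⟨hx, hκr h0r⟩).fun_comp_of_eq (analyticAt_id.prod analyticAt_const) rfl
  let Z : Phase l j → Phase l j := averagedTerm (angleAverage F) (angleAverage G)
  have hZ : Z = fun x => perturbation F G (x, 0) - oscillatingPart F G x :=
    funext averagedTerm_angleAverage
  have hZan : AnalyticOnNhd ℝ Z (strip l M) := hZ ▸ hX0.sub hu
  let E (p : Phase l j × ℝ) : Phase l j := g p - (p.1 + (ω₀, 0) +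
    ∑ i ∈ Finset.Ico 1 n, p.2 ^ i • averagedTerm (A i) (B i) p.1 + p.2 ^ n • Z p.1)
  have hE : AnalyticOnNhd ℝ E (strip l U ×ˢ Ioo (-κ₀) κ₀) := by
    intro p hp
    have hpM : p.1 ∈ strip l M := strip_mono hUM hp.1
    refine (hgan ⟨strip_mono hUW₂ hp.1, hI hp.2⟩ (hT p.2 (hI₂ hp.2) p.1
      (strip_mono hUC hp.1))).sub (((analyticAt_fst.add analyticAt_const).add
      (Finset.analyticAt_fun_sum _ fun i hi => ?_)).add ((analyticAt_snd.pow n).smul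
        ((hZan p.1 hpM).fun_comp_of_eq analyticAt_fst rfl)))
    exact (analyticAt_snd.pow i).smul ((analyticOnNhd_averagedTerm (hA i hi) (hB i hi) p.1
      hpM).fun_comp_of_eq analyticAt_fst rfl)
  obtain ⟨X', hX', hEX', hX'per⟩ := exists_eq_pow_smul_of_isBigO (isOpen_strip hU) hκ₀ (n + 1) hE
    (fun x hx => by
      have hxM : x ∈ strip l M := strip_mono hUM hx
      refine (hφ.isBigO_conjugation hδ (isOpen_strip hW₂) (hV.mono (strip_mono hWM)) hn
        (z := Z x) (X := perturbation F G) (Y := fun i => averagedTerm (A i) (B i)) (strip_mono hUW₂ hx)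
        (hω (strip_mono hUW₂ hx)) (fun i hi => ?_) ?_ ?_ (T := fun κ => T (x, κ))
        fun κ => ?_).mono nhdsWithin_le_nhds
      · exact (analyticOnNhd_averagedTerm (hA i hi) (hB i hi) x hxM).differentiableAt
      · exact (hX (x, 0) ⟨hxM, hκr h0r⟩).differentiableAt
      · rw [hZ, sub_sub_cancel, ← hVω x.1 x.2 (mem_strip.1 hxM)]
        simp [Prod.add_def]
      · exact slowFastMap_eq κ _)
  refine ⟨κ₀, U, W, fun κ x => a (x, κ), X', hκ₀, by linarith, hU, hW, hKC₁, hUW,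
    hWW.trans hWM, haan.mono (prod_mono (strip_mono hWW) fun κ => hI), hX', ?_, fun κ hκ =>
      ⟨?_, ?_, ?_, ?_, ?_, fun x hx => ⟨haM (strip_mono hUW₂ hx) (hI hκ), g (x, κ),
        hg κ (hI₃ hκ) x (strip_mono hUC hx), ?_, ?_⟩⟩⟩
  · obtain ⟨C, hC⟩ := hφ.exists_uniform_bound hδ hV hVper hW₂ hWM hC₂ hC₂₃
    refine ⟨C, fun κ hκ x hx => ?_⟩
    have := hC x (strip_mono hWC hx) (κ ^ n) (Ioo_subset_Icc_self (hpow (hI hκ)))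
    rwa [← sq_abs, abs_pow, ← pow_mul, mul_comm n 2] at this
  · exact fun x hx => hφ.isExpOn (hδ2 (hpow (hI hκ))) x (strip_mono hWW hx)
  · intro k θ J hJ
    have := haeq (x := (θ, J)) (mk_mem_strip.2 (hWW hJ)) (hI hκ) k
    simpa using this
  · exact hφ.analyticDiffeoOn hV (isOpen_strip hW₂) (isOpen_strip hW) (strip_mono hWW)
      (hpow (hI hκ)) fun x hx => ha κ (hI₁ hκ) x (strip_mono hWC hx)
  · intro x hx
    have hx₂ : x ∈ strip l W₂ := strip_mono hWW hx
    exact ⟨(hφ.analyticAt_time (hδ2 (hpow (hI hκ))) x hx₂).differentiableAt,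
      hφ.det_fderiv (isOpen_strip hW₂) hV hdiv hx₂ (hδ2 (hpow (hI hκ)))⟩
  · intro k θ J hJ
    -- The defect E has equal slices at integer translates, since g and x ↦ x + (ω₀, 0) shift by the
    -- same integer vector; the quotient inherits this.
    refine hX'per _ _ (fun κ hκ => ?_) κ hκ
    have hx : ((θ, J) : Phase l j) ∈ strip l U := mk_mem_strip.2 hJ
    have hk : ((θ + intVec k, J) : Phase l j) = (θ, J) + (intVec k, 0) := by simp
    have hav (b : (Fin j → ℝ) → (Fin l → ℝ)) (c : (Fin j → ℝ) → (Fin j → ℝ)) :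
        averagedTerm b c ((θ, J) + (intVec k, 0)) = averagedTerm b c (θ, J) := by
      simp [averagedTerm]
    simp only [E, Z, hk, hav, hgeq (strip_mono hUW₂ hx) (hI hκ)
      (hT κ (hI₂ hκ) _ (strip_mono hUC hx))]
    abel
  · rw [← hEX' x hx κ hκ]
    simp only [E]
    abel
  · have hTx := hT κ (hI₂ hκ) x (strip_mono hUC hx)
    have := hφ.flow_neg hV hTx (hneg (hpow (hI hκ)))
      (strip_mono hWW (hg κ (hI₃ hκ) x (strip_mono hUC hx)))
    rw [neg_neg] at this
    exact this.symm

end NearCompact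

end Decoupling

/-! ### Assembly of the theorem. -/

theorem mainTheorem3 (l j n : ℕ) (hn : 1 ≤ n)
    (M : Set (Fin j → ℝ)) (hM : IsOpen M)
    (c μ : ℝ) (hc : 0 < c) (hμ : 0 < μ)
    (ω₀ : Fin l → ℝ) (hω : Decoupling.IsDiophantine c μ ω₀)
    (κ₁ : ℝ) (hκ₁ : 0 < κ₁)
    -- the already averaged terms of order 1, …, n - 1
    (Fbar : ℕ → (Fin j → ℝ) → (Fin l → ℝ)) (Gbar : ℕ → (Fin j → ℝ) → (Fin j → ℝ))
    (hFbar : ∀ i ∈ Finset.Ico 1 n, AnalyticOnNhd ℝ (Fbar i) M)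
    (hGbar : ∀ i ∈ Finset.Ico 1 n, AnalyticOnNhd ℝ (Gbar i) M)
    -- the terms of order n
    (F : Decoupling.Phase l j × ℝ → (Fin l → ℝ)) (G : Decoupling.Phase l j × ℝ → (Fin j → ℝ))
    (hF : AnalyticOnNhd ℝ F (Decoupling.strip l M ×ˢ Set.Ioo (-κ₁) κ₁))
    (hG : AnalyticOnNhd ℝ G (Decoupling.strip l M ×ˢ Set.Ioo (-κ₁) κ₁))
    (hFper : ∀ κ ∈ Set.Ioo (-κ₁) κ₁, Decoupling.AnglePeriodicOn (fun x => F (x, κ)) M)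
    (hGper : ∀ κ ∈ Set.Ioo (-κ₁) κ₁, Decoupling.AnglePeriodicOn (fun x => G (x, κ)) M)
    -- the map is volume-preserving
    (hvol : ∀ κ ∈ Set.Ioo (-κ₁) κ₁,
      Decoupling.VolumePreservingOn (Decoupling.slowFastMap n ω₀ Fbar Gbar F G κ)
        (Decoupling.strip l M)) :
    -- the right-hand side of the homological equation is analytic and divergence-free
    (AnalyticOnNhd ℝ (Decoupling.oscillatingPart F G) (Decoupling.strip l M) ∧
      ∀ x ∈ Decoupling.strip l M, Decoupling.divergence (Decoupling.oscillatingPart F G) x = 0) ∧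
    -- the generating vector field V = (T, S) on 𝕋^l × M
    ∃ V : Decoupling.Phase l j → Decoupling.Phase l j,
      AnalyticOnNhd ℝ V (Decoupling.strip l M) ∧
      Decoupling.AnglePeriodicOn V M ∧
      (∀ x ∈ Decoupling.strip l M, Decoupling.divergence V x = 0) ∧
      -- the homological equation
      (∀ (ψ : Fin l → ℝ), ∀ I ∈ M,
        V (ψ + ω₀, I) - V (ψ, I) = Decoupling.oscillatingPart F G (ψ, I)) ∧
      -- near each compact set of slow variables, the exponential of κ^n V decouples the map
      ∀ K : Set (Fin j → ℝ), IsCompact K → K ⊆ M →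
        ∃ (κ₀ : ℝ) (U W : Set (Fin j → ℝ)) (Φ : ℝ → Decoupling.Phase l j → Decoupling.Phase l j)
          (F' : Decoupling.Phase l j × ℝ → (Fin l → ℝ))
          (G' : Decoupling.Phase l j × ℝ → (Fin j → ℝ)),
          0 < κ₀ ∧ κ₀ ≤ κ₁ ∧
          IsOpen U ∧ IsOpen W ∧ K ⊆ U ∧ U ⊆ W ∧ W ⊆ M ∧
          AnalyticOnNhd ℝ (fun p : Decoupling.Phase l j × ℝ => Φ p.2 p.1)
            (Decoupling.strip l W ×ˢ Set.Ioo (-κ₀) κ₀) ∧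
          AnalyticOnNhd ℝ F' (Decoupling.strip l U ×ˢ Set.Ioo (-κ₀) κ₀) ∧
          AnalyticOnNhd ℝ G' (Decoupling.strip l U ×ˢ Set.Ioo (-κ₀) κ₀) ∧
          -- Φ agrees with the transformation id + κ^n (T, S) up to O(κ^(2n))
          (∃ C : ℝ, ∀ κ ∈ Set.Ioo (-κ₀) κ₀, ∀ x ∈ Decoupling.strip l W,
            ‖Φ κ x - (x + κ ^ n • V x)‖ ≤ C * |κ| ^ (2 * n)) ∧
          ∀ κ ∈ Set.Ioo (-κ₀) κ₀,
            Decoupling.IsExpOn (fun x => κ ^ n • V x) (Decoupling.strip l M) (Φ κ)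
              (Decoupling.strip l W) ∧
            Decoupling.AngleEquivariantOn (Φ κ) W ∧
            Decoupling.AnalyticDiffeoOn (Φ κ) (Decoupling.strip l W) ∧
            Decoupling.VolumePreservingOn (Φ κ) (Decoupling.strip l W) ∧
            Decoupling.AnglePeriodicOn (fun x => F' (x, κ)) U ∧
            Decoupling.AnglePeriodicOn (fun x => G' (x, κ)) U ∧
            -- (θ, J) = Φ(ψ, I) conjugates the map to its averaged form of order n
            ∀ x ∈ Decoupling.strip l U,
              Φ κ x ∈ Decoupling.strip l M ∧
              Decoupling.slowFastMap (n + 1) ω₀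
                (Function.update Fbar n (Decoupling.angleAverage F))
                (Function.update Gbar n (Decoupling.angleAverage G)) F' G' κ x
                  ∈ Decoupling.strip l W ∧
              Decoupling.slowFastMap n ω₀ Fbar Gbar F G κ (Φ κ x) =
                Φ κ (Decoupling.slowFastMap (n + 1) ω₀
                  (Function.update Fbar n (Decoupling.angleAverage F))
                  (Function.update Gbar n (Decoupling.angleAverage G)) F' G' κ x) := by
  have hX : AnalyticOnNhd ℝ (Decoupling.perturbation F G)
      (Decoupling.strip l M ×ˢ Ioo (-κ₁) κ₁) := hF.prod hG
  have hper (κ : ℝ) (hκ : κ ∈ Ioo (-κ₁) κ₁) :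
      Decoupling.AnglePeriodicOn (fun x => Decoupling.perturbation F G (x, κ)) M :=
    fun k θ J hJ => Prod.ext (hFper κ hκ k θ J hJ) (hGper κ hκ k θ J hJ)
  have h0 : (0 : ℝ) ∈ Ioo (-κ₁) κ₁ := by simpa
  have hX0 : AnalyticOnNhd ℝ (fun x => Decoupling.perturbation F G (x, 0))
      (Decoupling.strip l M) := fun x hx =>
    (hX (x, 0) ⟨hx, h0⟩).fun_comp_of_eq (analyticAt_id.prod analyticAt_const) rfl
  have hu := Decoupling.analyticOnNhd_oscillatingPart hM hX0 (hper 0 h0)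
  have hdiv (x : Decoupling.Phase l j) (hx : x ∈ Decoupling.strip l M) :
      Decoupling.divergence (Decoupling.oscillatingPart F G) x = 0 :=
    Decoupling.divergence_oscillatingPart hM hX0 (hper 0 h0) (fun x hx y hxy =>
      Decoupling.divergence_eq_of_volumePreserving hn hκ₁ hFbar hGbar hX hvol hx hxy) hx
  obtain ⟨V, hV, hVper, hVdiv, hVω⟩ := Decoupling.exists_homological_solution hc hω hM hu
    (Decoupling.anglePeriodicOn_oscillatingPart (hper 0 h0)) hdiv
    fun L J hJ => Decoupling.angleCoeff_oscillatingPart hX0 (hper 0 h0) L hJ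
  refine ⟨⟨hu, hdiv⟩, V, hV, hVper, hVdiv, hVω, fun K hK hKM => ?_⟩
  obtain ⟨κ₀, U, W, Φ, X', hκ₀, hκ₀₁, hU, hW, hKU, hUW, hWM, hΦ, hX', hbound, h⟩ :=
    Decoupling.exists_decoupling_near_compact hn hM hκ₁ hFbar hGbar hX hper hu hV hVper hVdiv hVω
      hK hKM
  refine ⟨κ₀, U, W, Φ, fun p => (X' p).1, fun p => (X' p).2, hκ₀, hκ₀₁, hU, hW, hKU, hUW, hWM,
    hΦ, fun p hp => analyticAt_fst.fun_comp_of_eq (hX' p hp) rfl,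
    fun p hp => analyticAt_snd.fun_comp_of_eq (hX' p hp) rfl, hbound, fun κ hκ => ?_⟩
  obtain ⟨hexp, heq, hdiffeo, hΦvol, hX'per, hconj⟩ := h κ hκ
  refine ⟨hexp, heq, hdiffeo, hΦvol, fun k θ J hJ => congrArg Prod.fst (hX'per k θ J hJ),
    fun k θ J hJ => congrArg Prod.snd (hX'per k θ J hJ), fun x hx => ?_⟩
  obtain ⟨hM', y, hyW, hy, hfy⟩ := hconj x hx
  rw [Decoupling.slowFastMap_succ_update hn]
  change _ ∧ x + (ω₀, 0) + _ + _ + κ ^ (n + 1) • X' (x, κ) ∈ _ ∧ _ = Φ κ (_ + κ ^ (n + 1) • X' (x, κ))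
  rw [← hy]
  exact ⟨hM', hyW, hfy⟩
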